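/- Let $X$ be a (smooth) K3 surface, i.e. a compact connected complex manifold of dimension $2$, not necessarily projective, with trivial canonical bundle and $H^1(X,\mathcal O_X)=0$. Let $S$ be a compact connected Riemann surface and let $(E_s)_{s\in S}$ be a one-parameter family of (possibly singular) elliptic curves of $X$. By this we mean that each $E_s$ is a subset of $X$ with empty interior; that the incidence graph $\{(s,x)\in S\times X : x\in E_s\}$ is a complex analytic hypersurface of $S\times X$ (closed, nowhere dense, and locally the zero set of one holomorphic function); that for all but finitely many $s$ the set $E_s$ is an irreducible compact curve whose normalization is an elliptic curve $\mathbb C/\Lambda$ (finitely many members may degenerate); and that there is no curve $C\subset X$ with $E_s=C$ for all but finitely many $s$. Then the family has no base point: there is no point of $X$ which lies on $E_s$ for all $s\in S$. Moreover, through each point of $X$ pass only finitely many members of the family: for every $x\in X$ the set $\{s\in S : x\in E_s\}$ is finite. -/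

import Mathlib

open scoped Manifold ContDiff

/-- The model space of a complex surface. -/
abbrev ComplexPlane : Type := EuclideanSpace ℂ (Fin 2)

section Surface

variable (X : Type) [TopologicalSpace X] [ChartedSpace ComplexPlane X]

/-- A field of alternating `ℂ`-bilinear forms on the tangent spaces of a complex surface. -/
abbrev TwoFormField : Type :=
  ∀ x : X, TangentSpace 𝓘(ℂ, ComplexPlane) x [⋀^Fin 2]→L[ℂ] ℂ

variable {X}

/-- The pullback of `σ` along the inverse of the preferred chart at `p`: the expression of `σ` in
the local coordinates around `p`. -/
noncomputable def TwoFormField.inChart (σ : TwoFormField X) (p : X) (y : ComplexPlane) :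
    ComplexPlane [⋀^Fin 2]→L[ℂ] ℂ :=
  (σ ((chartAt ComplexPlane p).symm y)).compContinuousLinearMap
    (mfderiv 𝓘(ℂ, ComplexPlane) 𝓘(ℂ, ComplexPlane) (chartAt ComplexPlane p).symm y)

/-- `σ` is a holomorphic `2`-form, i.e. a holomorphic section of the canonical bundle: its
expression in each of the local coordinate systems is holomorphic. -/
def TwoFormField.IsHolomorphic (σ : TwoFormField X) : Prop :=
  ∀ p : X, AnalyticOnNhd ℂ (σ.inChart p) (chartAt ComplexPlane p).target

variable (X)

/-- A (smooth) K3 surface: a compact connected complex manifold of dimension `2` whose canonical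
bundle is trivial, i.e. has a nowhere vanishing holomorphic section, and such that
`H¹(X, 𝒪_X) = 0`. (Over `ℂ`, the sheaf of `C^∞` functions in Mathlib's sense, those that are
infinitely often `ℂ`-differentiable, is the sheaf of holomorphic functions.) -/
structure IsK3Surface : Prop where
  isManifold : IsManifold 𝓘(ℂ, ComplexPlane) ω X
  t2Space : T2Space X
  compactSpace : CompactSpace X
  connectedSpace : ConnectedSpace X
  canonical_trivial : ∃ σ : TwoFormField X, σ.IsHolomorphic ∧ ∀ x, σ x ≠ 0
  irregularity_zero : Subsingleton
    (CategoryTheory.Sheaf.H (smoothSheafAddCommGroup 𝓘(ℂ, ComplexPlane) 𝓘(ℂ) X ℂ) 1)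

end Surface

section Family

/-- A (complex analytic) hypersurface in a complex manifold: a closed nowhere dense subset which is,
near each of its points, the zero set of one holomorphic function. -/
def IsAnalyticHypersurface {V H M : Type*} [NormedAddCommGroup V] [NormedSpace ℂ V]
    [TopologicalSpace H] (I : ModelWithCorners ℂ V H) [TopologicalSpace M] [ChartedSpace H M]
    (Γ : Set M) : Prop :=
  IsClosed Γ ∧ interior Γ = ∅ ∧
    ∀ p ∈ Γ, ∃ U : Set M, IsOpen U ∧ p ∈ U ∧ ∃ f : M → ℂ,
      ContMDiffOn I 𝓘(ℂ) ω f U ∧ ∀ q ∈ U, q ∈ Γ ↔ f q = 0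

variable {X : Type*} [TopologicalSpace X] [ChartedSpace ComplexPlane X]

/-- `C` is a (possibly singular) elliptic curve in the complex surface `X`, i.e. an irreducible
compact curve whose normalization is an elliptic curve: it is the image of a holomorphic map `ν`
from a complex torus `ℂ / Λ` of dimension one to `X` that is injective outside a finite set.
(Such a `ν` is the normalization of its image.) -/
def IsEllipticCurveIn (C : Set X) : Prop :=
  ∃ (L : PeriodPair) (ν : ℂ ⧸ L.lattice → X),
    ContMDiff 𝓘(ℂ) 𝓘(ℂ, ComplexPlane) ω (fun z : ℂ ↦ ν (Submodule.Quotient.mk z)) ∧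
    Set.range ν = C ∧
    ∃ B : Set (ℂ ⧸ L.lattice), B.Finite ∧ Set.InjOn ν Bᶜ

variable {S : Type*} [TopologicalSpace S] [ChartedSpace ℂ S]

/-- A one-parameter family `(E s)`, `s ∈ S`, of elliptic curves in the complex surface `X`:
the incidence graph `{(s, x) | x ∈ E s}` is an analytic hypersurface of `S × X`, every member is a
curve, i.e. contains no nonempty open subset of `X`, all members but finitely many are (possibly
singular) elliptic curves, and the family really varies: its general member is not constant. -/
structure IsEllipticCurveFamily (E : S → Set X) : Prop where
  graph_analytic : IsAnalyticHypersurface (𝓘(ℂ).prod 𝓘(ℂ, ComplexPlane))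
    {p : S × X | p.2 ∈ E p.1}
  interior_eq_empty : ∀ s, interior (E s) = ∅
  general_elliptic : ∀ᶠ s in Filter.cofinite, IsEllipticCurveIn (E s)
  not_constant : ¬ ∃ C : Set X, ∀ᶠ s in Filter.cofinite, E s = C

end Family

/-! Suppose that `x` lies on every member and let `σ` be the nowhere vanishing holomorphic 2-form.
In a coordinate patch the family is the zero set of some `F (y, s)`; solving for `s` gives sheets `s
= g y`. Parametrize a member `E t` by `γ : ℂ → X`, periodic under a lattice. Both `σ (·, γ' z)` and
`dg` kill `γ' z`, so `σ (·, γ' z) = φ z • dg` (`val_apply_velocity`). For general `t`, sheets that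
agree along `γ` have the same `dg`, so `φ` is a well-defined periodic function, holomorphic off a
closed countable set. It cannot vanish on an open set, because `γ` is nowhere locally constant.

The key is an `L²` bound for `φ`. Fix an elliptic member `E s₀`. The number of sheets over `y` may
be unbounded near base points, but Jensen's inequality bounds it by `2 (1 + log (1 / |F (y, s₀)|))`.
Hence the weight `W y = |y - x|⁻² / (1 + log (1 / |F (y, s₀)|))`, integrated over all sheets, is
dominated by `2 |y - x|⁻²`, which is integrable in real dimension four
(`tsum_lintegral_newSheet_le`). In the coordinates `(g, ℓ)`, Fubini gives `∫ |φ|² W(γ) < ∞` locally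
on `E t` for almost every `t` (`lintegral_slice_lt_top`).

If `E t` is not contained in `E s₀`, then `F (γ z, s₀)` vanishes to finite order. So, up to a
constant, `W (γ z)` is at least `1 / (1 + log (1 / |z - z₀|))` near every `z₀`, with an extra factor
`|z - z₀|⁻²` when `γ z₀ = x` (`exists_le_weight`). The first bound still makes isolated
singularities removable; a nonempty closed countable set has an isolated point, so `φ` extends to an
entire function (`exists_entire_extension`), constant by periodicity and Liouville. The second
weight is not integrable at `z₀` (`lintegral_ball_inv_sq_mul_logWeight`), so the constant is `0`, a
contradiction.

General position means avoiding countably many parameters (`exists_countable_exceptional`),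
compatible with "almost every `t`". Finiteness of `{s | x ∈ E s}` then follows from the identity
theorem on the compact connected `S`. -/

open scoped Manifold ContDiff

/-! ### One complex variable: zero counting, logarithmic weights, removable singularities -/

section OneVariable

open Metric Set Filter Topology MeasureTheory

/-- A Jensen-type bound: a function bounded by `1` on a disc of radius `3 r` is exponentially small
at the centre in the number of its zeros in the disc of radius `r`. -/
lemma norm_le_pow_card_of_zeros {c : ℂ} {r : ℝ} (hr : 0 < r) (Z : Finset ℂ) :
    ∀ g : ℂ → ℂ, DifferentiableOn ℂ g (ball c (4 * r)) →
      (∀ z ∈ closedBall c (3 * r), ‖g z‖ ≤ 1) → (∀ z ∈ Z, z ∈ ball c r ∧ g z = 0) →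
      ‖g c‖ ≤ (1 / 2) ^ Z.card := by
  induction Z using Finset.induction_on with
  | empty =>
    intro g _ hb _
    simpa using hb c (mem_closedBall_self (by positivity))
  | insert a Z ha ih =>
    intro g hg hb hz
    obtain ⟨har, hga⟩ := hz a (Finset.mem_insert_self a Z)
    have har' : ‖a - c‖ < r := by simpa [dist_eq_norm] using har
    have ha4 : a ∈ ball c (4 * r) := ball_subset_ball (by linarith) har
    have hd : DifferentiableOn ℂ (dslope g a) (ball c (4 * r)) :=
      (Complex.differentiableOn_dslope (isOpen_ball.mem_nhds ha4)).2 hg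
    have hsl : ∀ z, z ≠ a → g z = (z - a) * dslope g a z := by
      intro z hza
      have := sub_smul_dslope g a z
      simp only [hga, sub_zero, smul_eq_mul] at this
      exact this.symm
    -- On the circle of radius `3 r` the zero `a` is at distance at least `2 r`, so `2 r · g / (z -
    -- a)` keeps the bound `1`. At the centre `|c - a| ≤ r`, so each zero removed gains a factor `1
    -- / 2`.
    have hfr : ∀ z ∈ frontier (ball c (3 * r)), ‖((2 * r : ℝ) : ℂ) * dslope g a z‖ ≤ 1 := by
      intro z hz
      rw [frontier_ball c (by positivity)] at hz
      have hz3 : ‖z - c‖ = 3 * r := by simpa [dist_eq_norm] using hz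
      have hza : 2 * r ≤ ‖z - a‖ := by
        have := norm_sub_norm_le (z - c) (a - c)
        rw [sub_sub_sub_cancel_right] at this
        linarith
      have hne : z ≠ a := by
        rintro rfl
        simp at hza
        linarith
      have h1 := hb z (sphere_subset_closedBall hz)
      rw [hsl z hne, norm_mul] at h1
      rw [norm_mul, Complex.norm_real, Real.norm_of_nonneg (by positivity)]
      exact (mul_le_mul_of_nonneg_right hza (norm_nonneg _)).trans h1
    have hdc : DifferentiableOn ℂ (fun z ↦ ((2 * r : ℝ) : ℂ) * dslope g a z) (ball c (4 * r)) :=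
      hd.const_mul _
    have hmax : ∀ z ∈ closedBall c (3 * r), ‖((2 * r : ℝ) : ℂ) * dslope g a z‖ ≤ 1 := by
      intro z hz
      refine Complex.norm_le_of_forall_mem_frontier_norm_le (isBounded_ball (x := c) (r := 3 * r))
        ?_ hfr (by rwa [closure_ball c (by positivity)])
      refine DifferentiableOn.diffContOnCl ?_
      rw [closure_ball c (by positivity)]
      exact hdc.mono (closedBall_subset_ball (by linarith))
    have key := ih _ hdc hmax (fun z hz' ↦ by
      obtain ⟨h1, h2⟩ := hz z (Finset.mem_insert_of_mem hz')
      refine ⟨h1, ?_⟩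
      have hne : z ≠ a := fun h ↦ ha (h ▸ hz')
      rw [hsl z hne] at h2
      simp [(mul_eq_zero.1 h2).resolve_left (sub_ne_zero.2 hne)])
    rw [Finset.card_insert_of_notMem ha, pow_succ]
    have hgc : ‖g c‖ ≤ r * ‖dslope g a c‖ := by
      by_cases hca : c = a
      · subst hca
        rw [hga]; simp; positivity
      · rw [hsl c hca, norm_mul, norm_sub_rev]
        gcongr
    rw [norm_mul, Complex.norm_real, Real.norm_of_nonneg (by positivity)] at key
    linarith

/-- The logarithmic weight `1 / (1 + log (1 / t))` for `0 < t ≤ 1`. -/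
noncomputable def logWeight (t : ℝ) : ℝ := (1 - Real.log t)⁻¹

lemma logWeight_pos {t : ℝ} (h0 : 0 ≤ t) (ht : t ≤ 1) : 0 < logWeight t :=
  inv_pos.2 (by linarith [Real.log_nonpos h0 ht])

lemma measurable_logWeight : Measurable logWeight := by
  unfold logWeight; fun_prop

/-- The integrand is minus the derivative of `log (1 - log t)`, which is unbounded as `t → 0`. -/
lemma not_integrableOn_inv_mul_logWeight {δ : ℝ} (hδ : 0 < δ) :
    ¬ IntegrableOn (fun t : ℝ ↦ t⁻¹ * logWeight t) (Ioo 0 δ) := by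
  intro h
  have hd : ∀ᶠ t in 𝓝[>] (0:ℝ), HasDerivAt (fun t ↦ Real.log (1 - Real.log t))
      (-(t⁻¹ * logWeight t)) t := by
    filter_upwards [Ioo_mem_nhdsGT (zero_lt_one' ℝ)] with t ht
    have h1 : 1 - Real.log t ≠ 0 := by linarith [Real.log_neg ht.1 ht.2]
    have := ((Real.hasDerivAt_log ht.1.ne').const_sub 1).log h1
    convert this using 1
    unfold logWeight
    ring
  refine not_integrableOn_of_tendsto_norm_atTop_of_deriv_isBigO_filter (𝓝[>] (0:ℝ))
    (Ioo_mem_nhdsGT hδ) (hd.mono fun t ht ↦ ht.differentiableAt) ?_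
      (f := fun t ↦ Real.log (1 - Real.log t)) (g := fun t : ℝ ↦ t⁻¹ * logWeight t) ?_ h
  · refine tendsto_norm_atTop_atTop.comp (Real.tendsto_log_atTop.comp ?_)
    exact tendsto_atTop_add_const_left _ _
      (tendsto_neg_atBot_atTop.comp Real.tendsto_log_nhdsGT_zero)
  · refine Asymptotics.IsBigO.of_bound 1 (hd.mono fun t ht ↦ ?_)
    simp only [ht.deriv]
    simp

/-- The weight `1 / (|z|² log (1 / |z|))` is not integrable near `0` in the plane. -/
lemma lintegral_ball_inv_sq_mul_logWeight (z₀ : ℂ) {δ : ℝ} (hδ : 0 < δ) :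
    ∫⁻ z in ball z₀ δ, ENNReal.ofReal ((‖z - z₀‖ ^ 2)⁻¹ * logWeight ‖z - z₀‖) = ⊤ := by
  set δ' := min δ 1
  have hδ' : 0 < δ' := lt_min hδ one_pos
  suffices h : ∫⁻ z in ball z₀ δ', ENNReal.ofReal ((‖z - z₀‖ ^ 2)⁻¹ * logWeight ‖z - z₀‖) = ⊤ from
    top_le_iff.1 (h ▸ lintegral_mono_set (ball_subset_ball (min_le_left _ _)))
  have htr : ∫⁻ z in ball z₀ δ', ENNReal.ofReal ((‖z - z₀‖ ^ 2)⁻¹ * logWeight ‖z - z₀‖) =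
      ∫⁻ z in ball (0:ℂ) δ', ENNReal.ofReal ((‖z‖ ^ 2)⁻¹ * logWeight ‖z‖) := by
    rw [← lintegral_indicator measurableSet_ball, ← lintegral_indicator measurableSet_ball,
      ← lintegral_sub_right_eq_self ((ball (0:ℂ) δ').indicator _) z₀]
    congr 1 with z
    simp [indicator, dist_eq_norm]
  rw [htr]
  by_contra hfin
  have hmeas : Measurable fun z : ℂ ↦ (‖z‖ ^ 2)⁻¹ * logWeight ‖z‖ := by
    have := measurable_logWeight
    fun_prop
  have hint : IntegrableOn (fun z : ℂ ↦ (‖z‖ ^ 2)⁻¹ * logWeight ‖z‖) (ball 0 δ') := by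
    refine ⟨hmeas.aestronglyMeasurable, ?_⟩
    rw [hasFiniteIntegral_iff_ofReal]
    · exact lt_top_iff_ne_top.2 hfin
    · filter_upwards [ae_restrict_mem measurableSet_ball] with z hz
      have : ‖z‖ ≤ 1 := (by simpa using hz : ‖z‖ < δ').le.trans (min_le_right _ _)
      exact mul_nonneg (by positivity) (logWeight_pos (norm_nonneg _) this).le
  rw [integrableOn_fun_norm_addHaar volume (f := fun t ↦ (t ^ 2)⁻¹ * logWeight t)] at hint
  refine not_integrableOn_inv_mul_logWeight hδ' (hint.congr_fun (fun t ht ↦ ?_) measurableSet_Ioo)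
  have := ht.1.ne'
  simp [Complex.finrank_real_complex]
  field_simp

/-- If every small circle violated the bound, polar coordinates would bound the finite integral
below by `ε ∫ ρ⁻¹ logWeight ρ dρ`, which diverges. -/
lemma exists_circle_lintegral_lt {G : ℂ → ENNReal} (hG : Measurable G) {z₀ : ℂ} {δ : ℝ}
    (hint : ∫⁻ z in ball z₀ δ, G z * ENNReal.ofReal (logWeight ‖z - z₀‖) < ⊤)
    {ε ρ₁ : ℝ} (hε : 0 < ε) (hρ₁ : 0 < ρ₁) (hρδ : ρ₁ ≤ δ) (hρ1 : ρ₁ ≤ 1) :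
    ∃ ρ ∈ Ioo 0 ρ₁, ∫⁻ θ in Ioo (-Real.pi) Real.pi, G (circleMap z₀ ρ θ) <
      ENNReal.ofReal (ε * (ρ ^ 2)⁻¹) := by
  by_contra! hcon
  refine hint.ne (top_le_iff.1 ?_)
  have htr : ∫⁻ z in ball z₀ ρ₁, G z * ENNReal.ofReal (logWeight ‖z - z₀‖) =
      ∫⁻ z, (ball (0:ℂ) ρ₁).indicator
        (fun z ↦ G (z + z₀) * ENNReal.ofReal (logWeight ‖z‖)) z := by
    rw [← lintegral_indicator measurableSet_ball, ← lintegral_add_right_eq_self _ z₀]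
    congr 1 with z
    simp [indicator, dist_eq_norm]
  have hlw := measurable_logWeight
  have hsub : Ioo 0 ρ₁ ×ˢ Ioo (-Real.pi) Real.pi ⊆ polarCoord.target := by
    rw [polarCoord_target]
    exact prod_mono Ioo_subset_Ioi_self le_rfl
  calc (⊤ : ENNReal) = ENNReal.ofReal ε * ∫⁻ ρ in Ioo 0 ρ₁, ENNReal.ofReal (ρ⁻¹ * logWeight ρ) := by
        have : ∫⁻ ρ in Ioo 0 ρ₁, ENNReal.ofReal (ρ⁻¹ * logWeight ρ) = ⊤ := by
          by_contra hfin
          refine not_integrableOn_inv_mul_logWeight hρ₁ ⟨by fun_prop, ?_⟩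
          rw [hasFiniteIntegral_iff_ofReal]
          · exact lt_top_iff_ne_top.2 hfin
          · filter_upwards [ae_restrict_mem measurableSet_Ioo] with t ht
            exact mul_nonneg (inv_nonneg.2 ht.1.le)
              (logWeight_pos ht.1.le (ht.2.le.trans hρ1)).le
        rw [this, ENNReal.mul_top (by simpa using hε)]
    _ = ∫⁻ ρ in Ioo 0 ρ₁, ENNReal.ofReal ε * ENNReal.ofReal (ρ⁻¹ * logWeight ρ) := by
        rw [lintegral_const_mul _ (by fun_prop)]
    _ ≤ ∫⁻ ρ in Ioo 0 ρ₁, ∫⁻ θ in Ioo (-Real.pi) Real.pi,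
          ENNReal.ofReal ρ * (G (circleMap z₀ ρ θ) * ENNReal.ofReal (logWeight ρ)) := by
        refine setLIntegral_mono' measurableSet_Ioo fun ρ hρ ↦ ?_
        have hm : Measurable fun θ ↦ G (circleMap z₀ ρ θ) :=
          hG.comp (continuous_circleMap z₀ ρ).measurable
        rw [lintegral_const_mul _ (by fun_prop), lintegral_mul_const _ hm]
        refine le_trans ?_ (mul_le_mul_right (mul_le_mul_left (hcon ρ hρ) _) _)
        rw [← ENNReal.ofReal_mul hε.le, ← ENNReal.ofReal_mul (by have := hρ.1; positivity),
          ← ENNReal.ofReal_mul hρ.1.le]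
        refine le_of_eq (congrArg _ ?_)
        have := hρ.1.ne'
        field_simp
    _ = ∫⁻ p in Ioo 0 ρ₁ ×ˢ Ioo (-Real.pi) Real.pi,
          ENNReal.ofReal p.1 * (G (circleMap z₀ p.1 p.2) * ENNReal.ofReal (logWeight p.1)) := by
        rw [Measure.volume_eq_prod, ← Measure.prod_restrict, lintegral_prod]
        have : Measurable fun p : ℝ × ℝ ↦ circleMap z₀ p.1 p.2 := by
          unfold circleMap; fun_prop
        have := hG.comp this
        exact Measurable.aemeasurable (by fun_prop)
    _ ≤ ∫⁻ p in polarCoord.target, ENNReal.ofReal p.1 • (ball (0:ℂ) ρ₁).indicator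
          (fun z ↦ G (z + z₀) * ENNReal.ofReal (logWeight ‖z‖)) (Complex.polarCoord.symm p) := by
        refine le_trans (setLIntegral_mono' (measurableSet_Ioo.prod measurableSet_Ioo)
          fun p hp ↦ ?_) (lintegral_mono_set hsub)
        have hn : Complex.polarCoord.symm p + z₀ = circleMap z₀ p.1 p.2 := by
          rw [Complex.polarCoord_symm_apply, circleMap, Complex.exp_mul_I]
          push_cast
          ring
        have hn' : ‖Complex.polarCoord.symm p‖ = p.1 := by
          rw [Complex.norm_polarCoord_symm, abs_of_pos hp.1.1]
        rw [indicator_of_mem (mem_ball_zero_iff.2 (hn' ▸ hp.1.2)), hn, hn']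
        rfl
    _ = ∫⁻ z in ball z₀ ρ₁, G z * ENNReal.ofReal (logWeight ‖z - z₀‖) := by
        rw [htr, Complex.lintegral_comp_polarCoord_symm]
    _ ≤ _ := lintegral_mono_set (ball_subset_ball hρδ)

/-- Turns the `L²` estimate on circles into the `L¹` estimate needed for a contour integral. -/
lemma exists_circle_norm_integral_le {f : ℂ → ℂ} {z₀ : ℂ} {δ : ℝ}
    (hf : ContinuousOn f (ball z₀ δ \ {z₀}))
    (hint : ∫⁻ z in ball z₀ δ, ENNReal.ofReal (‖f z‖ ^ 2) * ENNReal.ofReal (logWeight ‖z - z₀‖) < ⊤)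
    {ε ρ₁ : ℝ} (hε : 0 < ε) (hρ₁ : 0 < ρ₁) (hρδ : ρ₁ ≤ δ) (hρ1 : ρ₁ ≤ 1) :
    ∃ ρ ∈ Ioo 0 ρ₁, ρ * ∫ θ in 0..2 * Real.pi, ‖f (circleMap z₀ ρ θ)‖ ≤ ε := by
  classical
  have hmS : MeasurableSet (ball z₀ δ \ {z₀}) := measurableSet_ball.diff (measurableSet_singleton _)
  have hG : Measurable ((ball z₀ δ \ {z₀}).piecewise (fun z ↦ ENNReal.ofReal (‖f z‖ ^ 2)) 0) := by
    refine ContinuousOn.measurable_piecewise ?_ continuousOn_const hmS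
    exact ENNReal.continuous_ofReal.comp_continuousOn (hf.norm.pow 2)
  have hGint : ∫⁻ z in ball z₀ δ, (ball z₀ δ \ {z₀}).piecewise
      (fun z ↦ ENNReal.ofReal (‖f z‖ ^ 2)) 0 z * ENNReal.ofReal (logWeight ‖z - z₀‖) < ⊤ := by
    refine lt_of_le_of_lt (lintegral_mono fun z ↦ mul_le_mul_left ?_ _) hint
    by_cases hz : z ∈ ball z₀ δ \ {z₀}
    · rw [piecewise_eq_of_mem _ _ _ hz]
    · rw [piecewise_eq_of_notMem _ _ _ hz]
      exact zero_le
  obtain ⟨ρ, hρ, hlt⟩ := exists_circle_lintegral_lt hG hGint (ε := (ε / 4) ^ 2)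
    (by positivity) hρ₁ hρδ hρ1
  have hmem : ∀ θ, circleMap z₀ ρ θ ∈ ball z₀ δ \ {z₀} := by
    intro θ
    refine ⟨?_, by simpa using hρ.1.ne'⟩
    have := circleMap_mem_sphere z₀ hρ.1.le θ
    exact sphere_subset_ball (hρ.2.trans_le hρδ) this
  refine ⟨ρ, hρ, ?_⟩
  set g : ℝ → ℝ := fun θ ↦ ‖f (circleMap z₀ ρ θ)‖ with hgdef
  have hg : Continuous g := by
    refine (hf.comp_continuous (continuous_circleMap z₀ ρ) hmem).norm
  have hper : Function.Periodic g (2 * Real.pi) := fun θ ↦ by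
    simp only [hgdef, periodic_circleMap z₀ ρ θ]
  have hpi := Real.pi_pos
  have h1 : ∫ θ in 0..2 * Real.pi, g θ = ∫ θ in -Real.pi..Real.pi, g θ := by
    have := hper.intervalIntegral_add_eq 0 (-Real.pi)
    rw [zero_add] at this
    rw [this]
    congr 1
    ring
  have h2 : ∫ θ in -Real.pi..Real.pi, g θ ^ 2 ≤ (ε / 4) ^ 2 * (ρ ^ 2)⁻¹ := by
    rw [intervalIntegral.integral_of_le (by linarith), integral_Ioc_eq_integral_Ioo]
    rw [← ENNReal.ofReal_le_ofReal_iff (by positivity), ofReal_integral_eq_lintegral_ofReal]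
    · refine le_of_eq_of_le (lintegral_congr fun θ ↦ ?_) hlt.le
      rw [piecewise_eq_of_mem _ _ _ (hmem θ)]
    · exact ((hg.pow 2).integrableOn_Icc).mono_set Ioo_subset_Icc_self
    · exact Eventually.of_forall fun θ ↦ by positivity
  set a := ε / 4 with ha
  have hapos : 0 < a := by positivity
  have hρ0 := hρ.1
  have h3 : ∫ θ in -Real.pi..Real.pi, g θ ≤
      ∫ θ in -Real.pi..Real.pi, (a / ρ / 2 + ρ / a / 2 * g θ ^ 2) := by
    refine intervalIntegral.integral_mono_on (by linarith) (hg.intervalIntegrable _ _)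
      (Continuous.intervalIntegrable (by fun_prop) _ _) fun θ _ ↦ ?_
    -- Weighted arithmetic-geometric mean in place of Cauchy–Schwarz. With `a = ε / 4` the resulting
    -- total is `a (π + 1/2) ≤ 4 a = ε`.
    have h4 : 0 ≤ (a / ρ - g θ) ^ 2 * (ρ / a / 2) := by positivity
    have h5 : (a / ρ - g θ) ^ 2 * (ρ / a / 2) = a / ρ / 2 + ρ / a / 2 * g θ ^ 2 - g θ := by
      field_simp
      ring
    linarith
  rw [intervalIntegral.integral_add (by simp) (Continuous.intervalIntegrable (by fun_prop) _ _),
    intervalIntegral.integral_const_mul, intervalIntegral.integral_const] at h3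
  have h6 : ρ / a / 2 * ∫ θ in -Real.pi..Real.pi, g θ ^ 2 ≤ a / ρ / 2 := by
    refine (mul_le_mul_of_nonneg_left h2 (by positivity)).trans (le_of_eq ?_)
    field_simp
  rw [h1]
  have h7 : ρ * ∫ θ in -Real.pi..Real.pi, g θ ≤
      ρ * ((Real.pi - -Real.pi) • (a / ρ / 2) + a / ρ / 2) :=
    mul_le_mul_of_nonneg_left (h3.trans (by linarith)) hρ0.le
  refine h7.trans ?_
  have : ρ * ((Real.pi - -Real.pi) • (a / ρ / 2) + a / ρ / 2) = a * (Real.pi + 1 / 2) - 0 := by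
    simp only [smul_eq_mul]
    field_simp
    ring
  rw [this]
  nlinarith [Real.pi_lt_d2]

/-- An isolated singularity of a holomorphic function that is square integrable with respect to the
logarithmic weight is removable. -/
lemma exists_analyticAt_of_lintegral_logWeight {f : ℂ → ℂ} {z₀ : ℂ} {δ : ℝ} (hδ : 0 < δ)
    (hf : DifferentiableOn ℂ f (ball z₀ δ \ {z₀}))
    (hint : ∫⁻ z in ball z₀ δ,
      ENNReal.ofReal (‖f z‖ ^ 2) * ENNReal.ofReal (logWeight ‖z - z₀‖) < ⊤) :
    ∃ h : ℂ → ℂ, AnalyticAt ℂ h z₀ ∧ ∀ᶠ z in 𝓝[≠] z₀, f z = h z := by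
  have hopen : IsOpen (ball z₀ δ \ {z₀}) := isOpen_ball.sdiff isClosed_singleton
  set R : ℝ := δ / 2 with hR
  have hRpos : 0 < R := by positivity
  have hRδ : R < δ := by linarith
  have hcirc : ∀ r, 0 < r → r < δ → ContinuousOn f (sphere z₀ r) := fun r h0 h1 ↦
    hf.continuousOn.mono fun z hz ↦ ⟨sphere_subset_ball h1 hz, by
      rintro rfl; simp at hz; exact h0.ne hz⟩
  -- The extension is the Cauchy integral over a fixed outer circle, which is analytic across `z₀`
  -- whatever `f` does there.
  refine ⟨fun w ↦ (2 * Real.pi * Complex.I : ℂ)⁻¹ • ∮ z in C(z₀, R), (z - w)⁻¹ • f z, ?_, ?_⟩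
  · lift R to NNReal using hRpos.le with R'
    exact (hasFPowerSeriesOn_cauchy_integral
      ((hcirc _ hRpos hRδ).circleIntegrable hRpos.le) (by exact_mod_cast hRpos)).analyticAt
  · have hball : ball z₀ R \ {z₀} ∈ 𝓝[≠] z₀ :=
      sdiff_mem_nhdsWithin_compl (ball_mem_nhds _ hRpos) _
    filter_upwards [hball] with z hz
    have hzd : z ∈ ball z₀ δ \ {z₀} := ⟨ball_subset_ball hRδ.le hz.1, hz.2⟩
    have hz0 : 0 < ‖z - z₀‖ := norm_pos_iff.2 (sub_ne_zero.2 hz.2)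
    have hzR : ‖z - z₀‖ < R := by simpa [dist_eq_norm] using hz.1
    -- The difference quotient at `z` is holomorphic at `z` as well, so its integrals over the two
    -- circles agree although `z` lies in the annulus.
    have hds : DifferentiableOn ℂ (dslope f z) (ball z₀ δ \ {z₀}) :=
      (Complex.differentiableOn_dslope (hopen.mem_nhds hzd)).2 hf
    -- Cauchy's formula in the annulus, with the inner circle contributing arbitrarily little
    have key : ∀ ρ, 0 < ρ → ρ < ‖z - z₀‖ →
        (∮ w in C(z₀, R), (w - z)⁻¹ • f w) - 2 * Real.pi * Complex.I * f z =
          ∮ w in C(z₀, ρ), (w - z)⁻¹ • f w := by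
      intro ρ hρ hρz
      have hsub : closedBall z₀ R \ ball z₀ ρ ⊆ ball z₀ δ \ {z₀} := fun w hw ↦
        ⟨closedBall_subset_ball hRδ hw.1, by rintro rfl; exact hw.2 (mem_ball_self hρ)⟩
      have hgour := Complex.circleIntegral_eq_of_differentiable_on_annulus_off_countable hρ
        (hρz.le.trans hzR.le) countable_empty (hds.continuousOn.mono hsub) (fun w hw ↦
          hds.differentiableAt (hopen.mem_nhds (hsub ⟨ball_subset_closedBall hw.1.1, fun h ↦
            hw.1.2 (ball_subset_closedBall h)⟩)))
      have hsplit : ∀ r, 0 < r → r < δ → r ≠ ‖z - z₀‖ → (∮ w in C(z₀, r), dslope f z w) =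
          (∮ w in C(z₀, r), (w - z)⁻¹ • f w) - (∮ w in C(z₀, r), (w - z)⁻¹) * f z := by
        intro r hr hrδ hrz
        have hne : ∀ w ∈ sphere z₀ r, w ≠ z := by
          rintro w hw rfl
          simp at hw
          exact hrz hw.symm
        have hinv : ContinuousOn (fun w ↦ (w - z)⁻¹) (sphere z₀ r) :=
          (continuousOn_id.sub continuousOn_const).inv₀ fun w hw ↦ sub_ne_zero.2 (hne w hw)
        rw [← smul_eq_mul, ← circleIntegral.integral_smul_const, ← circleIntegral.integral_sub]
        · refine circleIntegral.integral_congr hr.le fun w hw ↦ ?_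
          simp only [dslope_of_ne _ (hne w hw), slope_def_field, smul_eq_mul]
          ring
        · exact (hinv.smul (hcirc r hr hrδ)).circleIntegrable hr.le
        · exact (hinv.smul continuousOn_const).circleIntegrable hr.le
      rw [hsplit R hRpos hRδ hzR.ne', hsplit ρ hρ (by linarith) hρz.ne,
        circleIntegral.integral_sub_inv_of_mem_ball hz.1] at hgour
      have hzero : (∮ w in C(z₀, ρ), (w - z)⁻¹) = 0 := by
        refine Complex.circleIntegral_eq_zero_of_differentiable_on_off_countable hρ.le
          countable_empty ?_ ?_
        · refine (continuousOn_id.sub continuousOn_const).inv₀ fun w hw ↦ ?_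
          change w - z ≠ 0
          rw [sub_ne_zero]
          rintro rfl
          simp [dist_eq_norm] at hw
          linarith
        · intro w hw
          refine (differentiableAt_id.sub_const z).inv ?_
          change w - z ≠ 0
          rw [sub_ne_zero]
          rintro rfl
          have := hw.1
          simp [dist_eq_norm] at this
          linarith
      rw [hgour, hzero, zero_mul, sub_zero]
    have hlim : (∮ w in C(z₀, R), (w - z)⁻¹ • f w) - 2 * Real.pi * Complex.I * f z = 0 := by
      rw [← norm_le_zero_iff]
      refine le_of_forall_pos_le_add fun ε hε ↦ ?_
      rw [zero_add]
      -- For `ρ < ‖z - z₀‖ / 2` the Cauchy kernel is at most `(‖z - z₀‖ / 2)⁻¹`, which the factor in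
      -- the tolerance absorbs.
      obtain ⟨ρ, hρ, hle⟩ := exists_circle_norm_integral_le hf.continuousOn hint
        (ε := ε * (‖z - z₀‖ / 2)) (ρ₁ := min (‖z - z₀‖ / 2) (min δ 1)) (by positivity)
        (by positivity) ((min_le_right _ _).trans (min_le_left _ _))
        ((min_le_right _ _).trans (min_le_right _ _))
      have hρz : ρ < ‖z - z₀‖ / 2 := hρ.2.trans_le (min_le_left _ _)
      have hρδ : ρ < δ := hρ.2.trans_le ((min_le_right _ _).trans (min_le_left _ _))
      rw [key ρ hρ.1 (by linarith)]
      have hρ0 := hρ.1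
      have hbound : ∀ θ, ‖deriv (circleMap z₀ ρ) θ •
          ((circleMap z₀ ρ θ - z)⁻¹ • f (circleMap z₀ ρ θ))‖ ≤
          ρ * (‖z - z₀‖ / 2)⁻¹ * ‖f (circleMap z₀ ρ θ)‖ := by
        intro θ
        rw [norm_smul, norm_smul, norm_inv, mul_assoc]
        have h1 : ‖deriv (circleMap z₀ ρ) θ‖ = ρ := by
          simp [deriv_circleMap, abs_of_pos hρ0]
        have h2 : ‖z - z₀‖ / 2 ≤ ‖circleMap z₀ ρ θ - z‖ := by
          have h3 : ‖circleMap z₀ ρ θ - z₀‖ = ρ := by simp [abs_of_pos hρ0]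
          have := norm_sub_norm_le (z - z₀) (circleMap z₀ ρ θ - z₀)
          rw [sub_sub_sub_cancel_right] at this
          rw [norm_sub_rev _ z]
          linarith
        rw [h1]
        gcongr
      have hcont : Continuous fun θ ↦ ‖f (circleMap z₀ ρ θ)‖ :=
        ((hcirc ρ hρ0 hρδ).comp_continuous (continuous_circleMap z₀ ρ)
          (circleMap_mem_sphere z₀ hρ0.le)).norm
      refine (intervalIntegral.norm_integral_le_of_norm_le (by positivity)
        (Eventually.of_forall fun θ _ ↦ hbound θ)
        (Continuous.intervalIntegrable (by fun_prop) _ _)).trans ?_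
      rw [intervalIntegral.integral_const_mul]
      calc ρ * (‖z - z₀‖ / 2)⁻¹ * ∫ θ in 0..2 * Real.pi, ‖f (circleMap z₀ ρ θ)‖
          = (‖z - z₀‖ / 2)⁻¹ * (ρ * ∫ θ in 0..2 * Real.pi, ‖f (circleMap z₀ ρ θ)‖) := by ring
        _ ≤ (‖z - z₀‖ / 2)⁻¹ * (ε * (‖z - z₀‖ / 2)) := by gcongr
        _ = ε := by field_simp
    rw [sub_eq_zero.1 hlim, smul_eq_mul, inv_mul_cancel_left₀ Complex.two_pi_I_ne_zero]

/-- A closed set without isolated points is perfect; if nonempty it contains an injective image of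
`ℕ → Bool`, which is uncountable. -/
lemma exists_isolated_of_countable {C : Set ℂ} (hC : IsClosed C) (hcount : C.Countable)
    (hne : C.Nonempty) : ∃ x ∈ C, ∀ᶠ y in 𝓝[≠] x, y ∉ C := by
  by_contra! hcon
  have hperf : Perfect C := by
    refine ⟨hC, fun x hx ↦ ?_⟩
    have := hcon x hx
    rw [accPt_iff_frequently_nhdsNE]
    exact this
  obtain ⟨φ, hφ, -, hinj⟩ := hperf.exists_nat_bool_injection hne
  have : (range φ).Countable := hcount.mono hφ
  have h2 : Countable (ℕ → Bool) := by
    have := this.to_subtype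
    exact (rangeFactorization_injective.2 hinj).countable
  obtain ⟨e, he⟩ := exists_surjective_nat (ℕ → Bool)
  obtain ⟨n, hn⟩ := he fun k ↦ !(e k k)
  simpa using congrFun hn n

/-- A function that is holomorphic off a closed countable set and locally square integrable with
respect to logarithmic weights extends to an entire function. -/
lemma exists_entire_extension {K : Set ℂ} (hK : IsClosed K) (hKc : K.Countable) {f : ℂ → ℂ}
    (hf : DifferentiableOn ℂ f Kᶜ)
    (hint : ∀ z₀, ∃ δ > 0, ∫⁻ z in ball z₀ δ,
      ENNReal.ofReal (‖f z‖ ^ 2) * ENNReal.ofReal (logWeight ‖z - z₀‖) < ⊤) :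
    ∃ g : ℂ → ℂ, Differentiable ℂ g ∧ ∀ z ∉ K, g z = f z := by
  set R : Set ℂ := {z | ∃ h : ℂ → ℂ, AnalyticAt ℂ h z ∧ ∀ᶠ w in 𝓝 z, w ∉ K → f w = h w} with hR
  have hdense : Dense Kᶜ := hKc.dense_compl ℝ
  -- The values of `f` on `K` carry no information. The limit along the dense complement recovers
  -- the value of any analytic germ agreeing with `f` off `K`.
  set g : ℂ → ℂ := fun z ↦ limUnder (𝓝[Kᶜ] z) f with hg
  have hgeq : ∀ z h, AnalyticAt ℂ h z → (∀ᶠ w in 𝓝 z, w ∉ K → f w = h w) → g z = h z := by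
    intro z h hh hev
    have : (𝓝[Kᶜ] z).NeBot := mem_closure_iff_nhdsWithin_neBot.1 (hdense z)
    refine Tendsto.limUnder_eq (Tendsto.congr' ?_ (hh.continuousAt.continuousWithinAt))
    filter_upwards [nhdsWithin_le_nhds hev, self_mem_nhdsWithin] with w hw hwK
    exact (hw hwK).symm
  have hgloc : ∀ z h, AnalyticAt ℂ h z → (∀ᶠ w in 𝓝 z, w ∉ K → f w = h w) →
      ∀ᶠ w in 𝓝 z, w ∈ R ∧ g w = h w := by
    intro z h hh hev
    filter_upwards [hh.eventually_analyticAt, hev.eventually_nhds] with w hw1 hw2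
    exact ⟨⟨h, hw1, hw2⟩, hgeq w h hw1 hw2⟩
  have hRK : Kᶜ ⊆ R := fun z hz ↦
    ⟨f, hf.analyticAt (hK.isOpen_compl.mem_nhds hz), Eventually.of_forall fun _ _ ↦ rfl⟩
  have hRo : IsOpen R := by
    rw [isOpen_iff_mem_nhds]
    rintro z ⟨h, hh, hev⟩
    exact (hgloc z h hh hev).mono fun _ hw ↦ hw.1
  have hgd : ∀ z ∈ R, DifferentiableAt ℂ g z := by
    rintro z ⟨h, hh, hev⟩
    exact hh.differentiableAt.congr_of_eventuallyEq ((hgloc z h hh hev).mono fun _ hw ↦ hw.2)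
  have hgf : ∀ z ∉ K, g z = f z := fun z hz ↦
    hgeq z f (hf.analyticAt (hK.isOpen_compl.mem_nhds hz)) (Eventually.of_forall fun _ _ ↦ rfl)
  suffices hRu : Rᶜ = ∅ from
    ⟨g, fun z ↦ hgd z (compl_empty_iff.1 hRu ▸ mem_univ z), hgf⟩
  -- The points with no analytic germ form a closed subset of the countable set `K`. At an isolated
  -- point of it, `g` is holomorphic in a punctured disc, so the removability lemma provides the
  -- missing germ.
  by_contra hne
  obtain ⟨z₀, hz₀, hiso⟩ := exists_isolated_of_countable hRo.isClosed_compl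
    (hKc.mono (compl_subset_comm.1 hRK)) (nonempty_iff_ne_empty.2 hne)
  obtain ⟨δ₁, hδ₁, hint₁⟩ := hint z₀
  obtain ⟨δ₂, hδ₂, hball⟩ := Metric.mem_nhdsWithin_iff.1 hiso
  set δ := min δ₁ δ₂
  have hδ : 0 < δ := lt_min hδ₁ hδ₂
  obtain ⟨h, hh, hev⟩ := exists_analyticAt_of_lintegral_logWeight (f := g) (z₀ := z₀) hδ
    (fun z hz ↦ (hgd z (not_not.1 (hball
      ⟨ball_subset_ball (min_le_right _ _) hz.1, hz.2⟩))).differentiableWithinAt) (by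
      refine lt_of_le_of_lt ?_ hint₁
      refine le_trans (le_of_eq ?_) (lintegral_mono_set (ball_subset_ball (min_le_left δ₁ δ₂)))
      refine lintegral_congr_ae (ae_restrict_of_ae ?_)
      filter_upwards [hKc.ae_notMem volume] with z hz
      rw [hgf z hz])
  refine hz₀ ⟨h, hh, ?_⟩
  have hz₀K : z₀ ∈ K := by
    by_contra hcon
    exact hz₀ (hRK hcon)
  rw [eventually_nhdsWithin_iff] at hev
  filter_upwards [hev] with w hw hwK
  rw [← hgf w hwK]
  exact hw (by rintro rfl; exact hwK hz₀K)

end OneVariable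

/-! ### Holomorphic arcs in analytic subsets of the plane -/

section TwoVariables

open Metric Set Filter Topology

/-- Lindelöf: the neighbourhoods meeting `s` in one point have a countable subcover. -/
lemma countable_of_forall_isolated {α : Type*} [TopologicalSpace α] [SecondCountableTopology α]
    {s : Set α} (h : ∀ x ∈ s, ∀ᶠ y in 𝓝[≠] x, y ∉ s) : s.Countable := by
  have h' : ∀ x ∈ s, {y | y ≠ x → y ∉ s} ∈ 𝓝[s] x := fun x hx ↦ by
    have := h x hx
    rw [eventually_nhdsWithin_iff] at this
    exact nhdsWithin_le_nhds this
  obtain ⟨t, hts, htc, hst⟩ := TopologicalSpace.countable_cover_nhdsWithin h'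
  refine htc.mono fun x hx ↦ ?_
  obtain ⟨y, hy, hxy⟩ := mem_iUnion₂.1 (hst hx)
  by_contra hxt
  exact hxy (by rintro rfl; exact hxt hy) hx

lemma countable_zeros_ball {f : ℂ → ℂ} {c : ℂ} {r : ℝ} (hf : AnalyticOnNhd ℂ f (ball c r))
    (hne : ¬ ∀ w ∈ ball c r, f w = 0) : {w ∈ ball c r | f w = 0}.Countable := by
  refine countable_of_forall_isolated fun x hx ↦ ?_
  rcases (hf x hx.1).eventually_eq_zero_or_eventually_ne_zero with h | h
  · exact absurd (fun w hw ↦ hf.eqOn_zero_of_preconnected_of_eventuallyEq_zero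
      (convex_ball c r).isPreconnected hx.1 h hw) hne
  · exact h.mono fun y hy hy' ↦ hy hy'.2

/-- `Q` collects, for countably many small boxes and a dense set of first coordinates `a`, the zeros
of `Δ (a, ·)` whenever this function is not identically zero. An arc with nonconstant first
coordinate crosses the lines over all `a` near its base point. If it avoided `Q`, then `Δ (a, ·)`
would vanish identically for a dense set of `a`, hence `Δ` would vanish near the base point. -/
lemma exists_countable_meets_zero_arcs_fst {U : Set (ℂ × ℂ)} {Δ : ℂ × ℂ → ℂ} (hU : IsOpen U)
    (hΔ : AnalyticOnNhd ℂ Δ U) : ∃ Q : Set (ℂ × ℂ), Q.Countable ∧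
      ∀ (n : ℂ → ℂ × ℂ) (z₀ : ℂ), AnalyticAt ℂ n z₀ → n z₀ ∈ U →
        (¬ ∀ᶠ z in 𝓝 z₀, (n z).1 = (n z₀).1) → (∀ᶠ z in 𝓝 z₀, Δ (n z) = 0) →
        (¬ ∀ᶠ y in 𝓝 (n z₀), Δ y = 0) → ∃ᶠ z in 𝓝[≠] z₀, n z ∈ Q := by
  obtain ⟨T, hTc, hT⟩ := TopologicalSpace.exists_countable_dense (ℂ × ℂ)
  obtain ⟨A, hAc, hA⟩ := TopologicalSpace.exists_countable_dense ℂ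
  refine ⟨⋃ c ∈ T, ⋃ k : ℕ, ⋃ (_ : ball c (1 / (k + 1)) ⊆ U), ⋃ a ∈ A,
    ⋃ (_ : a ∈ ball c.1 (1 / (k + 1))), ⋃ (_ : ¬ ∀ w ∈ ball c.2 (1 / (k + 1)), Δ (a, w) = 0),
      (fun w ↦ (a, w)) '' {w ∈ ball c.2 (1 / (k + 1)) | Δ (a, w) = 0}, ?_, ?_⟩
  · refine hTc.biUnion fun c _ ↦ countable_iUnion fun k ↦ countable_iUnion fun hkU ↦
      hAc.biUnion fun a _ ↦ countable_iUnion fun ha ↦ countable_iUnion fun hne ↦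
        (countable_zeros_ball (fun w hw ↦ ?_) hne).image _
    have : (a, w) ∈ U := hkU (by rw [← ball_prod_same]; exact ⟨ha, hw⟩)
    exact (hΔ _ this).comp_of_eq (f := fun w : ℂ ↦ (a, w)) (by fun_prop) rfl
  · intro n z₀ hn hnU hconst hzero hΔne hev
    obtain ⟨ε, hε, hεU⟩ := Metric.isOpen_iff.1 hU _ hnU
    obtain ⟨k, hk⟩ := exists_nat_one_div_lt (half_pos hε)
    obtain ⟨c, hcT, hc⟩ := hT.exists_dist_lt (n z₀) (ε := 1 / ((k : ℝ) + 1)) (by positivity)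
    have hkU : ball c (1 / ((k : ℝ) + 1)) ⊆ U := fun y hy ↦ hεU <| by
      have := dist_triangle y c (n z₀)
      rw [dist_comm c] at this
      rw [mem_ball] at hy ⊢
      linarith
    have hmem : n z₀ ∈ ball c (1 / ((k : ℝ) + 1)) := hc
    have hnear : ∀ᶠ z in 𝓝 z₀, n z ∈ ball c (1 / ((k : ℝ) + 1)) :=
      hn.continuousAt.eventually (isOpen_ball.mem_nhds hmem)
    rw [eventually_nhdsWithin_iff] at hev
    have hopen := (AnalyticAt.eventually_constant_or_nhds_le_map_nhds
      (analyticAt_fst.comp hn)).resolve_left hconst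
    -- By the open mapping theorem every nearby `a` is the first coordinate of a point of the arc.
    -- The value `(n z₀).1` is excluded because nothing is known about `Q` at `z₀` itself.
    have himg : ∀ᶠ a in 𝓝 (n z₀).1, a ∈ A → a ≠ (n z₀).1 →
        ∀ w ∈ ball c.2 (1 / ((k : ℝ) + 1)), Δ (a, w) = 0 := by
      have hS := hopen (image_mem_map (hnear.and (hzero.and hev)))
      filter_upwards [hS] with a ha haA hane
      obtain ⟨z, ⟨hz1, hz2, hz3⟩, rfl⟩ := ha
      by_contra hne
      refine hz3 (by rintro rfl; exact hane rfl) ?_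
      simp only [mem_iUnion]
      rw [← ball_prod_same] at hz1
      exact ⟨c, hcT, k, hkU, _, haA, hz1.1, hne, _, ⟨hz1.2, hz2⟩, rfl⟩
    obtain ⟨N, hN, hNo, hNz⟩ := _root_.eventually_nhds_iff.1 himg
    have hall : ∀ a ∈ N, a ∈ ball c.1 (1 / ((k : ℝ) + 1)) →
        ∀ w ∈ ball c.2 (1 / ((k : ℝ) + 1)), Δ (a, w) = 0 := by
      intro a haN hac w hw
      have hmemU : (a, w) ∈ U := hkU (by rw [← ball_prod_same]; exact ⟨hac, hw⟩)
      have hcont : ContinuousAt (fun a ↦ Δ (a, w)) a :=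
        ((hΔ _ hmemU).continuousAt).comp (f := fun a ↦ (a, w)) (by fun_prop)
      have hdense : Dense (A \ {(n z₀).1}) := hA.sdiff_singleton _
      have hne : (𝓝[A \ {(n z₀).1}] a).NeBot := mem_closure_iff_nhdsWithin_neBot.1 (hdense a)
      refine tendsto_nhds_unique (hcont.continuousWithinAt (s := A \ {(n z₀).1})) ?_
      refine tendsto_const_nhds.congr' ?_
      filter_upwards [nhdsWithin_le_nhds (hNo.mem_nhds haN), self_mem_nhdsWithin] with b hb1 hb2
      exact (hN b hb1 hb2.1 hb2.2 w hw).symm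
    refine hΔne ?_
    have h1 : ∀ᶠ y in 𝓝 (n z₀), y.1 ∈ N := continuousAt_fst.eventually (hNo.mem_nhds hNz)
    filter_upwards [h1, isOpen_ball.mem_nhds hmem] with y hy1 hy2
    rw [← ball_prod_same] at hy2
    exact hall y.1 hy1 hy2.1 y.2 hy2.2

/-- A countable set met by every nonconstant holomorphic arc contained in the zero set of `Δ`, at
points where `Δ` does not vanish identically. -/
lemma exists_countable_meets_zero_arcs {U : Set (ℂ × ℂ)} {Δ : ℂ × ℂ → ℂ} (hU : IsOpen U)
    (hΔ : AnalyticOnNhd ℂ Δ U) : ∃ Q : Set (ℂ × ℂ), Q.Countable ∧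
      ∀ (n : ℂ → ℂ × ℂ) (z₀ : ℂ), AnalyticAt ℂ n z₀ → n z₀ ∈ U →
        (¬ ∀ᶠ z in 𝓝 z₀, n z = n z₀) → (∀ᶠ z in 𝓝 z₀, Δ (n z) = 0) →
        (¬ ∀ᶠ y in 𝓝 (n z₀), Δ y = 0) → ∃ᶠ z in 𝓝[≠] z₀, n z ∈ Q := by
  obtain ⟨Q₁, hQ₁, h₁⟩ := exists_countable_meets_zero_arcs_fst hU hΔ
  have hsw : Continuous (Prod.swap : ℂ × ℂ → ℂ × ℂ) := continuous_swap
  have hswa : ∀ y, AnalyticAt ℂ (Prod.swap : ℂ × ℂ → ℂ × ℂ) y := fun y ↦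
    analyticAt_snd.prod analyticAt_fst
  obtain ⟨Q₂, hQ₂, h₂⟩ := exists_countable_meets_zero_arcs_fst (U := Prod.swap ⁻¹' U)
    (Δ := Δ ∘ Prod.swap) (hU.preimage hsw) (fun y hy ↦ (hΔ _ hy).comp (hswa y))
  refine ⟨Q₁ ∪ Prod.swap '' Q₂, hQ₁.union (hQ₂.image _), ?_⟩
  intro n z₀ hn hnU hconst hzero hne
  by_cases hc : ∀ᶠ z in 𝓝 z₀, (n z).1 = (n z₀).1
  · have := h₂ (Prod.swap ∘ n) z₀ ((hswa _).comp hn) (by simpa using hnU) (fun h ↦ hconst ?_)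
      (by simpa using hzero) (fun h ↦ hne ?_)
    · exact this.mono fun z hz ↦ Or.inr ⟨_, hz, by simp⟩
    · filter_upwards [hc, h] with z hz1 hz2
      exact Prod.ext hz1 hz2
    · have h3 : Tendsto Prod.swap (𝓝 (n z₀)) (𝓝 (Prod.swap (n z₀))) := hsw.continuousAt
      filter_upwards [h3.eventually h] with y hy
      simpa using hy
  · exact (h₁ n z₀ hn hnU hc hzero hne).mono fun z hz ↦ Or.inl hz

end TwoVariables

/-! ### Covering the zero set of `F` by graphs of holomorphic functions -/

section GraphCharts

open Metric Set Filter Topology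

/-- The partial derivative of `F` with respect to the last variable. -/
noncomputable def partialLast (F : (ℂ × ℂ) × ℂ → ℂ) (p : (ℂ × ℂ) × ℂ) : ℂ :=
  fderiv ℂ F p (0, 1)

lemma AnalyticOnNhd.fderiv_apply_const {E G : Type*} [NormedAddCommGroup E] [NormedSpace ℂ E]
    [NormedAddCommGroup G] [NormedSpace ℂ G] [CompleteSpace G]
    {F : E → G} {W : Set E} (hF : AnalyticOnNhd ℂ F W) (v : E) :
    AnalyticOnNhd ℂ (fun p ↦ fderiv ℂ F p v) W := fun p hp ↦
  ((ContinuousLinearMap.apply ℂ G v).analyticAt _).comp (hF.fderiv p hp)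

lemma AnalyticOnNhd.iterate_partialLast {F : (ℂ × ℂ) × ℂ → ℂ} {W : Set ((ℂ × ℂ) × ℂ)}
    (hF : AnalyticOnNhd ℂ F W) (m : ℕ) : AnalyticOnNhd ℂ (partialLast^[m] F) W := by
  induction m with
  | zero => exact hF
  | succ m ih =>
    rw [Function.iterate_succ_apply']
    exact ih.fderiv_apply_const _

lemma iteratedDeriv_eq_iterate_partialLast {F : (ℂ × ℂ) × ℂ → ℂ} {W : Set ((ℂ × ℂ) × ℂ)}
    (hW : IsOpen W) (hF : AnalyticOnNhd ℂ F W) (y : ℂ × ℂ) (m : ℕ) :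
    ∀ s, (y, s) ∈ W → iteratedDeriv m (fun t ↦ F (y, t)) s = partialLast^[m] F (y, s) := by
  induction m with
  | zero => intro s _; simp
  | succ m ih =>
    intro s hs
    rw [iteratedDeriv_succ, Function.iterate_succ_apply']
    have hc : Continuous fun t : ℂ ↦ (y, t) := by fun_prop
    have hev : iteratedDeriv m (fun t ↦ F (y, t)) =ᶠ[𝓝 s] fun t ↦ partialLast^[m] F (y, t) := by
      filter_upwards [hc.continuousAt.eventually (hW.mem_nhds hs)] with t ht using ih t ht
    rw [hev.deriv_eq]
    have hd : HasDerivAt (fun t : ℂ ↦ (y, t)) (0, 1) s :=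
      (hasDerivAt_const s y).prodMk (hasDerivAt_id s)
    exact ((hF.iterate_partialLast m _ hs).differentiableAt.hasFDerivAt.comp_hasDerivAt s hd).deriv

/-- A zero of `F (y, ·)` that is not a zero of all its derivatives. -/
lemma exists_iterate_partialLast_ne_zero {F : (ℂ × ℂ) × ℂ → ℂ} {W : Set ((ℂ × ℂ) × ℂ)}
    (hW : IsOpen W) (hF : AnalyticOnNhd ℂ F W) {y : ℂ × ℂ} {s : ℂ} (hys : (y, s) ∈ W)
    (h0 : F (y, s) = 0) (hne : ¬ ∀ᶠ t in 𝓝 s, F (y, t) = 0) :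
    ∃ m, partialLast^[m] F (y, s) = 0 ∧ partialLast^[m + 1] F (y, s) ≠ 0 := by
  by_contra! hcon
  have hall : ∀ m, partialLast^[m] F (y, s) = 0 := fun m ↦ by
    induction m with
    | zero => exact h0
    | succ m ih => exact hcon m ih
  have han : AnalyticAt ℂ (fun t ↦ F (y, t)) s :=
    (hF _ hys).comp_of_eq (f := fun t : ℂ ↦ (y, t)) (by fun_prop) rfl
  refine hne (analyticOrderAt_eq_top.1 (ENat.eq_top_iff_forall_ge.2 fun m ↦ ?_))
  rw [natCast_le_analyticOrderAt_iff_iteratedDeriv_eq_zero han]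
  intro i _
  rw [iteratedDeriv_eq_iterate_partialLast hW hF y i s hys, hall]

/-- `Θ` is a local coordinate system `(g, ℓ)` of `ℂ × ℂ`, with `ℓ` linear and `g` a function whose
graph is contained in the zero set of `F`. -/
structure IsGraphChart (F : (ℂ × ℂ) × ℂ → ℂ) (V : Set (ℂ × ℂ)) (D : Set ℂ)
    (Θ : OpenPartialHomeomorph (ℂ × ℂ) (ℂ × ℂ)) (ℓ : ℂ × ℂ →L[ℂ] ℂ) : Prop where
  source_subset : Θ.source ⊆ V
  analytic : AnalyticOnNhd ℂ Θ Θ.source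
  det_ne_zero : ∀ y ∈ Θ.source, LinearMap.det (fderiv ℂ Θ y : ℂ × ℂ →ₗ[ℂ] ℂ × ℂ) ≠ 0
  snd_eq : ∀ y ∈ Θ.source, (Θ y).2 = ℓ y
  fst_mem : ∀ y ∈ Θ.source, (Θ y).1 ∈ D
  zero : ∀ y ∈ Θ.source, F (y, (Θ y).1) = 0

/-- The kernel of `ℓ` lies in the line spanned by `e`, and `dg` does not kill `e`. -/
lemma det_fderiv_prod_ne_zero {g : ℂ × ℂ → ℂ} {y e : ℂ × ℂ} {ℓ : ℂ × ℂ →L[ℂ] ℂ}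
    (hg : DifferentiableAt ℂ g y) (hℓ : ∀ v, ℓ v = 0 → ∃ c : ℂ, v = c • e)
    (he : fderiv ℂ g y e ≠ 0) :
    LinearMap.det (fderiv ℂ (fun y ↦ (g y, ℓ y)) y : ℂ × ℂ →ₗ[ℂ] ℂ × ℂ) ≠ 0 := by
  intro hdet
  obtain ⟨v, hv, hv0⟩ := Submodule.exists_mem_ne_zero_of_ne_bot
    (LinearMap.bot_lt_ker_of_det_eq_zero hdet).ne'
  rw [hg.fderiv_prodMk ℓ.differentiableAt, ℓ.fderiv] at hv
  simp only [LinearMap.mem_ker, ContinuousLinearMap.coe_coe, ContinuousLinearMap.prod_apply,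
    Prod.mk_eq_zero] at hv
  obtain ⟨c, rfl⟩ := hℓ v hv.2
  have := hv.1
  rw [map_smul, smul_eq_mul, mul_eq_zero] at this
  rcases this with h | h
  · simp [h] at hv0
  · exact he h

/-- Inverse function theorem for `(g, ℓ)`, restricted to a neighbourhood where `g` is analytic and
`dg e` stays nonzero. -/
lemma exists_openPartialHomeomorph_fst_eq {g : ℂ × ℂ → ℂ} {y₀ e : ℂ × ℂ} {ℓ : ℂ × ℂ →L[ℂ] ℂ}
    (hg : AnalyticAt ℂ g y₀) (hℓ : ∀ v, ℓ v = 0 → ∃ c : ℂ, v = c • e)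
    (he : fderiv ℂ g y₀ e ≠ 0) {U : Set (ℂ × ℂ)} (hU : U ∈ 𝓝 y₀) :
    ∃ Θ : OpenPartialHomeomorph (ℂ × ℂ) (ℂ × ℂ), y₀ ∈ Θ.source ∧ Θ.source ⊆ U ∧
      AnalyticOnNhd ℂ Θ Θ.source ∧
      (∀ y ∈ Θ.source, LinearMap.det (fderiv ℂ Θ y : ℂ × ℂ →ₗ[ℂ] ℂ × ℂ) ≠ 0) ∧
      ∀ y ∈ Θ.source, Θ y = (g y, ℓ y) := by
  have hev : ∀ᶠ y in 𝓝 y₀, y ∈ U ∧ AnalyticAt ℂ g y ∧ fderiv ℂ g y e ≠ 0 := by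
    refine Filter.Eventually.and hU (hg.eventually_analyticAt.and ?_)
    have : ContinuousAt (fun y ↦ fderiv ℂ g y e) y₀ :=
      (((ContinuousLinearMap.apply ℂ ℂ e).analyticAt _).comp hg.fderiv).continuousAt
    exact this.eventually_ne he
  obtain ⟨N, hN, hNo, hyN⟩ := _root_.eventually_nhds_iff.1 hev
  set Φ : ℂ × ℂ → ℂ × ℂ := fun y ↦ (g y, ℓ y) with hΦ
  have hΦan : ∀ y, AnalyticAt ℂ g y → AnalyticAt ℂ Φ y := fun y hy ↦ hy.prod (ℓ.analyticAt y)
  have hdet := det_fderiv_prod_ne_zero hg.differentiableAt hℓ he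
  set L : (ℂ × ℂ) ≃L[ℂ] (ℂ × ℂ) :=
    (LinearMap.equivOfDetNeZero _ hdet).toContinuousLinearEquiv with hL
  have hs : HasStrictFDerivAt Φ (L : ℂ × ℂ →L[ℂ] ℂ × ℂ) y₀ := by
    have h1 := (hΦan y₀ hg).hasStrictFDerivAt
    have h2 : (L : ℂ × ℂ →L[ℂ] ℂ × ℂ) = fderiv ℂ Φ y₀ := by
      ext <;> rfl
    rwa [h2]
  set Θ := (hs.toOpenPartialHomeomorph Φ).restrOpen N hNo with hΘ
  have hsrc : ∀ y ∈ Θ.source, y ∈ N := fun y hy ↦ by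
    rw [hΘ, OpenPartialHomeomorph.restrOpen_source] at hy
    exact hy.2
  have hcoe : ⇑Θ = Φ := rfl
  refine ⟨Θ, ?_, fun y hy ↦ (hN y (hsrc y hy)).1, fun y hy ↦ ?_, fun y hy ↦ ?_, fun y hy ↦ rfl⟩
  · rw [hΘ, OpenPartialHomeomorph.restrOpen_source]
    exact ⟨hs.mem_toOpenPartialHomeomorph_source, hyN⟩
  · exact hcoe ▸ hΦan y (hN y (hsrc y hy)).2.1
  · have h3 := hN y (hsrc y hy)
    exact det_fderiv_prod_ne_zero h3.2.1.differentiableAt hℓ h3.2.2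

/-- Near a zero of `F` at which `∂ₛᵐ F` vanishes simply, the zeros of `∂ₛᵐ F` form the graph of a
holomorphic function. -/
lemma exists_implicit_graph {P : (ℂ × ℂ) × ℂ → ℂ} {p : (ℂ × ℂ) × ℂ} (hP : AnalyticAt ℂ P p)
    (h0 : P p = 0) (h1 : partialLast P p ≠ 0) :
    ∃ g : ℂ × ℂ → ℂ, AnalyticAt ℂ g p.1 ∧ g p.1 = p.2 ∧ ∀ᶠ q in 𝓝 p, P q = 0 → g q.1 = q.2 := by
  have hc : ContDiffAt ℂ ω P p := hP.contDiffAt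
  have hinv : (fderiv ℂ P p ∘L .inr ℂ (ℂ × ℂ) ℂ).IsInvertible := by
    refine ⟨ContinuousLinearEquiv.unitsEquivAut ℂ (Units.mk0 _ h1), ?_⟩
    ext
    simp [partialLast]
  refine ⟨hc.implicitFunction (by simp) hinv, ?_, hc.implicitFunction_apply_self (by simp) hinv, ?_⟩
  · exact (hc.contDiffAt_implicitFunction (by simp) hinv).analyticAt
  · filter_upwards [hc.eventually_apply_eq_iff_implicitFunction (by simp) hinv] with q hq hq0
    exact hq.1 (hq0.trans h0.symm)

/-- Local description of the zero set of `F` at a point where the order of `F (y, ·)` is finite: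
it is covered by a graph chart, or it lies over a proper analytic subset. -/
lemma exists_local_graph_alternative {F : (ℂ × ℂ) × ℂ → ℂ} {V : Set (ℂ × ℂ)} {D : Set ℂ}
    (hV : IsOpen V) (hD : IsOpen D) (hF : AnalyticOnNhd ℂ F (V ×ˢ D))
    (hne : ∀ s ∈ D, ∀ y ∈ V, ¬ ∀ᶠ y' in 𝓝 y, F (y', s) = 0) {m : ℕ} {p : (ℂ × ℂ) × ℂ}
    (hp : p ∈ V ×ˢ D) (h0 : partialLast^[m] F p = 0) (h1 : partialLast^[m + 1] F p ≠ 0) :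
    ∃ O ∈ 𝓝 p, ∃ (U : Set (ℂ × ℂ)) (Δ : ℂ × ℂ → ℂ), IsOpen U ∧ U ⊆ V ∧ AnalyticOnNhd ℂ Δ U ∧
      (∀ y ∈ U, ¬ ∀ᶠ y' in 𝓝 y, Δ y' = 0) ∧
      ∀ q ∈ O, F q = 0 → partialLast^[m] F q = 0 → q.1 ∈ U ∧
        (Δ q.1 = 0 ∨ ∃ Θ ℓ, IsGraphChart F V D Θ ℓ ∧ ∃ O' ∈ 𝓝 q, ∀ q' ∈ O', F q' = 0 →
          partialLast^[m] F q' = 0 → q'.1 ∈ Θ.source ∧ (Θ q'.1).1 = q'.2) := by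
  rw [Function.iterate_succ_apply'] at h1
  obtain ⟨g, hg, hgp, hgev⟩ := exists_implicit_graph (hF.iterate_partialLast m p hp) h0 h1
  have hU₀ : ∀ᶠ y in 𝓝 p.1, AnalyticAt ℂ g y ∧ y ∈ V ∧ g y ∈ D :=
    hg.eventually_analyticAt.and ((hV.eventually_mem hp.1).and
      (hg.continuousAt.eventually (hD.eventually_mem (hgp ▸ hp.2))))
  obtain ⟨ε, hε, hball⟩ := Metric.eventually_nhds_iff_ball.1 hU₀
  have hpU : p.1 ∈ ball p.1 ε := mem_ball_self hε
  have hnz : ∀ r, 0 < r → ∀ h : ℂ × ℂ → ℂ, AnalyticOnNhd ℂ h (ball p.1 r) →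
      (¬ ∀ᶠ y in 𝓝 p.1, h y = 0) → ∀ y ∈ ball p.1 r, ¬ ∀ᶠ y' in 𝓝 y, h y' = 0 := by
    intro r hr h hh hhne y hy hev
    refine hhne ?_
    filter_upwards [ball_mem_nhds p.1 hr] with y' hy'
    exact hh.eqOn_zero_of_preconnected_of_eventuallyEq_zero (convex_ball _ _).isPreconnected hy hev
      hy'
  have hha : AnalyticOnNhd ℂ (fun y ↦ F (y, g y)) (ball p.1 ε) := fun y hy ↦
    (hF (y, g y) (hball y hy).2).comp_of_eq
      (f := fun y ↦ (y, g y)) (analyticAt_id.prod (hball y hy).1) rfl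
  have hO : ∀ r, 0 < r → {q : (ℂ × ℂ) × ℂ | q.1 ∈ ball p.1 r ∧
      ∀ᶠ q' in 𝓝 q, partialLast^[m] F q' = 0 → g q'.1 = q'.2} ∈ 𝓝 p := fun r hr ↦
    (continuousAt_fst.eventually (ball_mem_nhds p.1 hr)).and hgev.eventually_nhds
  by_cases hh : ∀ᶠ y in 𝓝 p.1, F (y, g y) = 0
  · obtain ⟨r', hr', hzero⟩ := Metric.eventually_nhds_iff_ball.1 hh
    set r := min ε r'
    have hr : 0 < r := lt_min hε hr'
    have hrε : ball p.1 r ⊆ ball p.1 ε := ball_subset_ball (min_le_left _ _)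
    have hrr' : ball p.1 r ⊆ ball p.1 r' := ball_subset_ball (min_le_right _ _)
    have hga : AnalyticOnNhd ℂ g (ball p.1 r) := fun y hy ↦ (hball y (hrε hy)).1
    -- Here the graph of `g` is a sheet of the zero set. If both partial derivatives of `g` vanished
    -- near the point, `g` would be constant and `F (·, p.2)` would vanish on an open set. So some
    -- partial derivative serves as `Δ`, and where it is nonzero `(g, ℓ)` is a chart.
    obtain ⟨e, ℓ, hℓ, he⟩ : ∃ (e : ℂ × ℂ) (ℓ : ℂ × ℂ →L[ℂ] ℂ),
        (∀ v, ℓ v = 0 → ∃ c : ℂ, v = c • e) ∧ ¬ ∀ᶠ y in 𝓝 p.1, fderiv ℂ g y e = 0 := by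
      by_contra! hcon
      have e1 := hcon (1, 0) (.snd ℂ ℂ ℂ) fun v hv ↦ ⟨v.1, by ext <;> simp_all⟩
      have e2 := hcon (0, 1) (.fst ℂ ℂ ℂ) fun v hv ↦ ⟨v.2, by ext <;> simp_all⟩
      have hfd : ∀ᶠ y in 𝓝 p.1, fderiv ℂ g y = 0 := by
        filter_upwards [e1, e2] with y h1 h2
        ext <;> simp [h1, h2]
      obtain ⟨t, ht, htz⟩ := Metric.eventually_nhds_iff_ball.1 hfd
      set t' := min r t
      have ht' : 0 < t' := lt_min hr ht
      have hconst : ∀ y ∈ ball p.1 t', g y = g p.1 := fun y hy ↦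
        isOpen_ball.is_const_of_fderiv_eq_zero (convex_ball _ _).isPreconnected
          (fun y hy ↦ (hga y (ball_subset_ball (min_le_left _ _) hy)).differentiableAt
            |>.differentiableWithinAt)
          (fun y hy ↦ htz y (ball_subset_ball (min_le_right _ _) hy)) hy (mem_ball_self ht')
      refine hne p.2 hp.2 p.1 hp.1 ?_
      filter_upwards [ball_mem_nhds p.1 ht'] with y hy
      have := hzero y (hrr' (ball_subset_ball (min_le_left _ _) hy))
      rwa [hconst y hy, hgp] at this
    have hΔ : AnalyticOnNhd ℂ (fun y ↦ fderiv ℂ g y e) (ball p.1 r) := hga.fderiv_apply_const e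
    refine ⟨_, hO r hr, ball p.1 r, fun y ↦ fderiv ℂ g y e, isOpen_ball,
      fun y hy ↦ (hball y (hrε hy)).2.1, hΔ, hnz r hr _ hΔ he, ?_⟩
    rintro q ⟨hq1, hq2⟩ - -
    refine ⟨hq1, or_iff_not_imp_left.2 fun hqe ↦ ?_⟩
    obtain ⟨Θ, hqΘ, hΘU, hΘan, hΘdet, hΘeq⟩ := exists_openPartialHomeomorph_fst_eq
      (hga q.1 hq1) hℓ hqe (isOpen_ball.mem_nhds hq1)
    refine ⟨Θ, ℓ, ⟨fun y hy ↦ (hball y (hrε (hΘU hy))).2.1, hΘan, hΘdet,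
      fun y hy ↦ by rw [hΘeq y hy],
      fun y hy ↦ by rw [hΘeq y hy]; exact (hball y (hrε (hΘU hy))).2.2,
      fun y hy ↦ by rw [hΘeq y hy]; exact hzero y (hrr' (hΘU hy))⟩,
      {q' | q'.1 ∈ Θ.source ∧ (partialLast^[m] F q' = 0 → g q'.1 = q'.2)}, ?_, ?_⟩
    · exact (continuousAt_fst.eventually (Θ.open_source.eventually_mem hqΘ)).and hq2
    · rintro q' ⟨hq'1, hq'2⟩ - hq'0
      exact ⟨hq'1, by rw [hΘeq _ hq'1]; exact hq'2 hq'0⟩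
  -- Here the graph of `g` is not locally contained in the zero set. Common zeros of `F` and its
  -- `m`-th derivative lie on the graph, hence over the zeros of `F (y, g y)`.
  · refine ⟨_, hO ε hε, ball p.1 ε, fun y ↦ F (y, g y), isOpen_ball,
      fun y hy ↦ (hball y hy).2.1, hha, hnz ε hε _ hha hh, ?_⟩
    rintro q ⟨hq1, hq2⟩ hFq hPq
    refine ⟨hq1, Or.inl ?_⟩
    simpa only [hq2.self_of_nhds hPq] using hFq

/-- The zero set of `F` is covered, up to countably many proper analytic subsets and away from the
points where `F (y, ·)` vanishes identically, by countably many graph charts. -/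
lemma exists_countable_graph_cover {F : (ℂ × ℂ) × ℂ → ℂ} {V : Set (ℂ × ℂ)} {D : Set ℂ}
    (hV : IsOpen V) (hD : IsOpen D) (hF : AnalyticOnNhd ℂ F (V ×ˢ D))
    (hne : ∀ s ∈ D, ∀ y ∈ V, ¬ ∀ᶠ y' in 𝓝 y, F (y', s) = 0) :
    ∃ (C : Set (OpenPartialHomeomorph (ℂ × ℂ) (ℂ × ℂ) × (ℂ × ℂ →L[ℂ] ℂ)))
      (B : Set (Set (ℂ × ℂ) × (ℂ × ℂ → ℂ))), C.Countable ∧ B.Countable ∧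
      (∀ c ∈ C, IsGraphChart F V D c.1 c.2) ∧
      (∀ b ∈ B, IsOpen b.1 ∧ b.1 ⊆ V ∧ AnalyticOnNhd ℂ b.2 b.1 ∧
        ∀ y ∈ b.1, ¬ ∀ᶠ y' in 𝓝 y, b.2 y' = 0) ∧
      ∀ y ∈ V, ∀ s ∈ D, F (y, s) = 0 → (¬ ∀ᶠ t in 𝓝 s, F (y, t) = 0) →
        (∃ c ∈ C, y ∈ c.1.source ∧ (c.1 y).1 = s) ∨ ∃ b ∈ B, y ∈ b.1 ∧ b.2 y = 0 := by
  classical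
  -- The zeros of finite order in `s` are sorted by an `m` at which the `s`-derivatives pass from
  -- zero to nonzero; `N m` is the part of `Z m` where a graph chart exists nearby. Each of `N m`
  -- and `Z m \ N m` is covered by countably many local pieces by Lindelöf.
  set Z : ℕ → Set ((ℂ × ℂ) × ℂ) := fun m ↦ {p | p ∈ V ×ˢ D ∧ F p = 0 ∧ partialLast^[m] F p = 0 ∧
    partialLast^[m + 1] F p ≠ 0} with hZ
  set N : ℕ → Set ((ℂ × ℂ) × ℂ) := fun m ↦ {p | p ∈ Z m ∧ ∃ Θ ℓ, IsGraphChart F V D Θ ℓ ∧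
    ∃ O' ∈ 𝓝 p, ∀ q' ∈ O', F q' = 0 → partialLast^[m] F q' = 0 →
      q'.1 ∈ Θ.source ∧ (Θ q'.1).1 = q'.2} with hN
  have step1 : ∀ m, ∃ C : Set (OpenPartialHomeomorph (ℂ × ℂ) (ℂ × ℂ) × (ℂ × ℂ →L[ℂ] ℂ)),
      C.Countable ∧ (∀ c ∈ C, IsGraphChart F V D c.1 c.2) ∧
      ∀ p ∈ N m, ∃ c ∈ C, p.1 ∈ c.1.source ∧ (c.1 p.1).1 = p.2 := by
    intro m
    have : ∀ p : N m, ∃ c : OpenPartialHomeomorph (ℂ × ℂ) (ℂ × ℂ) × (ℂ × ℂ →L[ℂ] ℂ),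
        IsGraphChart F V D c.1 c.2 ∧ ∃ O' ∈ 𝓝 p.1, ∀ q' ∈ O', F q' = 0 →
          partialLast^[m] F q' = 0 → q'.1 ∈ c.1.source ∧ (c.1 q'.1).1 = q'.2 := by
      rintro ⟨p, -, Θ, ℓ, h1, h2⟩
      exact ⟨(Θ, ℓ), h1, h2⟩
    choose c hc O hO hOc using this
    obtain ⟨t, htc, ht⟩ := TopologicalSpace.countable_cover_nhds
      (f := fun p : N m ↦ Subtype.val ⁻¹' O p) fun p ↦ continuous_subtype_val.continuousAt (hO p)
    refine ⟨c '' t, htc.image _, ?_, ?_⟩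
    · rintro _ ⟨p, -, rfl⟩
      exact hc p
    · intro p hp
      obtain ⟨q, hqt, hq⟩ := mem_iUnion₂.1 (ht.symm ▸ mem_univ (⟨p, hp⟩ : N m))
      exact ⟨_, mem_image_of_mem _ hqt, hOc q p hq hp.1.2.1 hp.1.2.2.1⟩
  have step2 : ∀ m, ∃ B : Set (Set (ℂ × ℂ) × (ℂ × ℂ → ℂ)), B.Countable ∧
      (∀ b ∈ B, IsOpen b.1 ∧ b.1 ⊆ V ∧ AnalyticOnNhd ℂ b.2 b.1 ∧
        ∀ y ∈ b.1, ¬ ∀ᶠ y' in 𝓝 y, b.2 y' = 0) ∧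
      ∀ p ∈ Z m \ N m, ∃ b ∈ B, p.1 ∈ b.1 ∧ b.2 p.1 = 0 := by
    intro m
    have : ∀ p : (Z m \ N m : Set _), ∃ b : Set (ℂ × ℂ) × (ℂ × ℂ → ℂ),
        (IsOpen b.1 ∧ b.1 ⊆ V ∧ AnalyticOnNhd ℂ b.2 b.1 ∧
          ∀ y ∈ b.1, ¬ ∀ᶠ y' in 𝓝 y, b.2 y' = 0) ∧
        ∃ O ∈ 𝓝 p.1, ∀ q ∈ O, q ∈ Z m \ N m → q.1 ∈ b.1 ∧ b.2 q.1 = 0 := by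
      rintro ⟨p, hp, -⟩
      obtain ⟨O, hO, U, Δ, hU, hUV, hΔ, hΔne, h⟩ :=
        exists_local_graph_alternative hV hD hF hne hp.1 hp.2.2.1 hp.2.2.2
      refine ⟨(U, Δ), ⟨hU, hUV, hΔ, hΔne⟩, O, hO, fun q hq hqZ ↦ ?_⟩
      obtain ⟨h1, h2⟩ := h q hq hqZ.1.2.1 hqZ.1.2.2.1
      exact ⟨h1, h2.resolve_right fun h3 ↦ hqZ.2 ⟨hqZ.1, h3⟩⟩
    choose b hb O hO hOb using this
    obtain ⟨t, htc, ht⟩ := TopologicalSpace.countable_cover_nhds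
      (f := fun p : (Z m \ N m : Set _) ↦ Subtype.val ⁻¹' O p)
      fun p ↦ continuous_subtype_val.continuousAt (hO p)
    refine ⟨b '' t, htc.image _, ?_, ?_⟩
    · rintro _ ⟨p, -, rfl⟩
      exact hb p
    · intro p hp
      obtain ⟨q, hqt, hq⟩ := mem_iUnion₂.1 (ht.symm ▸ mem_univ (⟨p, hp⟩ : (Z m \ N m : Set _)))
      exact ⟨_, mem_image_of_mem _ hqt, hOb q p hq hp⟩
  choose C hCc hC hCN using step1
  choose B hBc hB hBZ using step2
  refine ⟨⋃ m, C m, ⋃ m, B m, countable_iUnion hCc, countable_iUnion hBc, ?_, ?_, ?_⟩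
  · intro c hc
    obtain ⟨m, hm⟩ := mem_iUnion.1 hc
    exact hC m c hm
  · intro b hb
    obtain ⟨m, hm⟩ := mem_iUnion.1 hb
    exact hB m b hm
  · intro y hy s hs hF0 hne0
    obtain ⟨m, hm0, hm1⟩ := exists_iterate_partialLast_ne_zero (hV.prod hD) hF ⟨hy, hs⟩ hF0 hne0
    have hZm : (y, s) ∈ Z m := ⟨⟨hy, hs⟩, hF0, hm0, hm1⟩
    by_cases hNm : (y, s) ∈ N m
    · obtain ⟨c, hc, h⟩ := hCN m _ hNm
      exact Or.inl ⟨c, mem_iUnion.2 ⟨m, hc⟩, h⟩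
    · obtain ⟨b, hb, h⟩ := hBZ m _ ⟨hZm, hNm⟩
      exact Or.inr ⟨b, mem_iUnion.2 ⟨m, hb⟩, h⟩

end GraphCharts

/-! ### Fubini on the sheets, and finite integrals on almost every slice -/

section Slicing

open Metric Set Filter Topology MeasureTheory

lemma abs_det_restrictScalars {E : Type*} [NormedAddCommGroup E] [NormedSpace ℂ E]
    [FiniteDimensional ℂ E] (T : E →L[ℂ] E) :
    |(T.restrictScalars ℝ).det| = ‖LinearMap.det (T : E →ₗ[ℂ] E)‖ ^ 2 := by
  have h : (T.restrictScalars ℝ).det = Algebra.norm ℝ (LinearMap.det (T : E →ₗ[ℂ] E)) :=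
    LinearMap.det_restrictScalars (f := (T : E →ₗ[ℂ] E))
  rw [h, Algebra.norm_complex_eq, ← Complex.normSq_eq_norm_sq]
  exact abs_of_nonneg (Complex.normSq_nonneg _)

lemma ContinuousOn.measurableSet_inter_preimage {α β : Type*} [TopologicalSpace α]
    [MeasurableSpace α] [BorelSpace α] [TopologicalSpace β] [MeasurableSpace β] [BorelSpace β]
    {f : α → β} {s : Set α} (hf : ContinuousOn f s) (hs : MeasurableSet s) {t : Set β}
    (ht : MeasurableSet t) : MeasurableSet (s ∩ f ⁻¹' t) := by
  have h1 : Measurable (s.domRestrict f) := hf.domRestrict.measurable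
  have h2 := hs.subtype_image (h1 ht)
  convert h2 using 1
  ext x
  exact ⟨fun h ↦ ⟨⟨x, h.1⟩, h.2, rfl⟩, fun ⟨y, hy, hyx⟩ ↦ hyx ▸ ⟨y.2, hy⟩⟩

/-- The squared modulus of the complex Jacobian. -/
noncomputable def jacobianSq (Θ : ℂ × ℂ → ℂ × ℂ) (y : ℂ × ℂ) : ENNReal :=
  ENNReal.ofReal (‖LinearMap.det (fderiv ℂ Θ y : ℂ × ℂ →ₗ[ℂ] ℂ × ℂ)‖ ^ 2)

/-- The points of the `j`-th chart domain at which the `j`-th sheet does not coincide with a sheet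
of smaller index. -/
def newSheet (Θ : ℕ → OpenPartialHomeomorph (ℂ × ℂ) (ℂ × ℂ)) (j : ℕ) : Set (ℂ × ℂ) :=
  {y | y ∈ (Θ j).source ∧ ∀ k < j, y ∈ (Θ k).source → (Θ k y).1 ≠ (Θ j y).1}

lemma measurableSet_newSheet (Θ : ℕ → OpenPartialHomeomorph (ℂ × ℂ) (ℂ × ℂ)) (j : ℕ) :
    MeasurableSet (newSheet Θ j) := by
  have : newSheet Θ j = (Θ j).source \ ⋃ k, ⋃ (_ : k < j), ((Θ k).source ∩ (Θ j).source) ∩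
      (fun y ↦ (Θ k y).1 - (Θ j y).1) ⁻¹' {0} := by
    ext y
    simp only [newSheet, mem_ofPred_eq, Set.mem_sdiff, mem_iUnion, mem_inter_iff, mem_preimage,
      mem_singleton_iff, sub_eq_zero]
    grind
  rw [this]
  refine (Θ j).open_source.measurableSet.diff (MeasurableSet.iUnion fun k ↦ MeasurableSet.iUnion
    fun _ ↦ ContinuousOn.measurableSet_inter_preimage ?_
      ((Θ k).open_source.inter (Θ j).open_source).measurableSet (measurableSet_singleton 0))
  exact (((Θ k).continuousOn.mono inter_subset_left).fst).sub
    (((Θ j).continuousOn.mono inter_subset_right).fst)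

/-- The density on the slices of the `j`-th sheet, in the coordinates given by `Θ j`. -/
noncomputable def sheetDensity (Θ : ℕ → OpenPartialHomeomorph (ℂ × ℂ) (ℂ × ℂ))
    (W : ℂ × ℂ → ENNReal) (j : ℕ) : ℂ × ℂ → ENNReal :=
  (Θ j).target.indicator fun p ↦ (newSheet Θ j).indicator (fun y ↦ W y * (jacobianSq (Θ j) y)⁻¹)
    ((Θ j).symm p)

lemma sheetDensity_apply {Θ : ℕ → OpenPartialHomeomorph (ℂ × ℂ) (ℂ × ℂ)}
    {W : ℂ × ℂ → ENNReal} {j : ℕ} {y : ℂ × ℂ} (hy : y ∈ newSheet Θ j) :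
    sheetDensity Θ W j (Θ j y) = W y * (jacobianSq (Θ j) y)⁻¹ := by
  rw [sheetDensity, indicator_of_mem ((Θ j).map_source hy.1), (Θ j).left_inv hy.1,
    indicator_of_mem hy]

lemma continuousOn_jacobianSq {Θ : OpenPartialHomeomorph (ℂ × ℂ) (ℂ × ℂ)}
    (h : AnalyticOnNhd ℂ Θ Θ.source) : ContinuousOn (jacobianSq Θ) Θ.source := by
  have h1 : ContinuousOn (fderiv ℂ Θ) Θ.source := h.fderiv.continuousOn
  have h2 : Continuous fun T : ℂ × ℂ →L[ℂ] ℂ × ℂ ↦ T.det := ContinuousLinearMap.continuous_det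
  exact ENNReal.continuous_ofReal.comp_continuousOn ((h2.comp_continuousOn h1).norm.pow 2)

lemma aemeasurable_sheetDensity {Θ : ℕ → OpenPartialHomeomorph (ℂ × ℂ) (ℂ × ℂ)}
    {W : ℂ × ℂ → ENNReal} (hW : Measurable W) {j : ℕ}
    (h : AnalyticOnNhd ℂ (Θ j) (Θ j).source) : AEMeasurable (sheetDensity Θ W j) volume := by
  classical
  rw [sheetDensity, aemeasurable_indicator_iff (Θ j).open_target.measurableSet]
  have h1 : AEMeasurable (Θ j).symm (volume.restrict (Θ j).target) :=
    (Θ j).symm.continuousOn.aemeasurable (Θ j).open_target.measurableSet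
  have h2 : Measurable ((newSheet Θ j).indicator (fun y ↦ W y * (jacobianSq (Θ j) y)⁻¹)) := by
    have h3 : Measurable ((Θ j).source.piecewise (jacobianSq (Θ j)) 0) :=
      (continuousOn_jacobianSq h).measurable_piecewise continuousOn_const
        (Θ j).open_source.measurableSet
    have h4 : (newSheet Θ j).indicator (fun y ↦ W y * (jacobianSq (Θ j) y)⁻¹) =
        (newSheet Θ j).indicator
          (fun y ↦ W y * ((Θ j).source.piecewise (jacobianSq (Θ j)) 0 y)⁻¹) := by
      ext y
      by_cases hy : y ∈ newSheet Θ j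
      · rw [indicator_of_mem hy, indicator_of_mem hy, piecewise_eq_of_mem _ _ _ hy.1]
      · rw [indicator_of_notMem hy, indicator_of_notMem hy]
    rw [h4]
    exact (hW.mul h3.inv).indicator (measurableSet_newSheet Θ j)
  exact h2.comp_aemeasurable h1

/-- Change of variables: the real Jacobian of a holomorphic map is the squared modulus of its
complex determinant, and the density was divided by exactly this. -/
lemma lintegral_sheetDensity {Θ : ℕ → OpenPartialHomeomorph (ℂ × ℂ) (ℂ × ℂ)}
    {W : ℂ × ℂ → ENNReal} {j : ℕ} (h : AnalyticOnNhd ℂ (Θ j) (Θ j).source)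
    (hdet : ∀ y ∈ (Θ j).source, LinearMap.det (fderiv ℂ (Θ j) y : ℂ × ℂ →ₗ[ℂ] ℂ × ℂ) ≠ 0) :
    ∫⁻ p, sheetDensity Θ W j p = ∫⁻ y in newSheet Θ j, W y := by
  have hhaar : (volume : Measure (ℂ × ℂ)).IsAddHaarMeasure :=
    Measure.prod.instIsAddHaarMeasure _ _
  have hinj : InjOn (Θ j) (newSheet Θ j) := (Θ j).injOn.mono fun y hy ↦ hy.1
  have hd : ∀ y ∈ newSheet Θ j, HasFDerivWithinAt (Θ j)
      ((fderiv ℂ (Θ j) y).restrictScalars ℝ) (newSheet Θ j) y := fun y hy ↦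
    ((h y hy.1).differentiableAt.hasFDerivAt.restrictScalars ℝ).hasFDerivWithinAt
  have hms := measurableSet_newSheet Θ j
  have himg : MeasurableSet (Θ j '' newSheet Θ j) := by
    have : Θ j '' newSheet Θ j = (Θ j).target ∩ (Θ j).symm ⁻¹' newSheet Θ j := by
      rw [← (Θ j).image_source_inter_eq', inter_eq_right.2 fun y hy ↦ hy.1]
    rw [this]
    exact (Θ j).symm.continuousOn.measurableSet_inter_preimage
      (Θ j).open_target.measurableSet hms
  have hsupp : sheetDensity Θ W j =
      (Θ j '' newSheet Θ j).indicator (sheetDensity Θ W j) := by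
    ext p
    by_cases hp : p ∈ Θ j '' newSheet Θ j
    · rw [indicator_of_mem hp]
    · rw [indicator_of_notMem hp, sheetDensity]
      by_cases hpt : p ∈ (Θ j).target
      · rw [indicator_of_mem hpt, indicator_of_notMem]
        exact fun hmem ↦ hp ⟨_, hmem, (Θ j).right_inv hpt⟩
      · rw [indicator_of_notMem hpt]
  rw [hsupp, lintegral_indicator himg, lintegral_image_eq_lintegral_abs_det_fderiv_mul volume hms
    hd hinj]
  refine setLIntegral_congr_fun hms fun y hy ↦ ?_
  rw [sheetDensity_apply hy, abs_det_restrictScalars, mul_comm, mul_assoc]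
  change W y * ((jacobianSq (Θ j) y)⁻¹ * jacobianSq (Θ j) y) = W y
  rw [ENNReal.inv_mul_cancel, mul_one]
  · have := norm_pos_iff.2 (hdet y hy.1)
    simp only [jacobianSq, ne_eq, ENNReal.ofReal_eq_zero, not_le]
    positivity
  · exact ENNReal.ofReal_ne_top

/-- For almost every `s`, the densities have finite total mass on the slices over `s`. -/
lemma ae_tsum_lintegral_sheetDensity_lt_top {Θ : ℕ → OpenPartialHomeomorph (ℂ × ℂ) (ℂ × ℂ)}
    {W : ℂ × ℂ → ENNReal} (hW : Measurable W) (h : ∀ j, AnalyticOnNhd ℂ (Θ j) (Θ j).source)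
    (hdet : ∀ j, ∀ y ∈ (Θ j).source,
      LinearMap.det (fderiv ℂ (Θ j) y : ℂ × ℂ →ₗ[ℂ] ℂ × ℂ) ≠ 0)
    (hfin : ∑' j, ∫⁻ y in newSheet Θ j, W y < ⊤) :
    ∀ᵐ s : ℂ, ∑' j, ∫⁻ t, sheetDensity Θ W j (s, t) < ⊤ := by
  have hm : ∀ j, AEMeasurable (sheetDensity Θ W j)
      ((volume : Measure ℂ).prod (volume : Measure ℂ)) := fun j ↦ aemeasurable_sheetDensity hW (h j)
  have hm' : ∀ j, AEMeasurable fun s ↦ ∫⁻ t, sheetDensity Θ W j (s, t) := fun j ↦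
    (hm j).lintegral_prod_right'
  refine ae_lt_top' (AEMeasurable.tsum hm') ?_
  rw [lintegral_tsum hm']
  refine (lt_of_eq_of_lt (tsum_congr fun j ↦ ?_) hfin).ne
  rw [← lintegral_prod _ (hm j), ← lintegral_sheetDensity (h j) (hdet j)]
  rfl

/-- Integrals over the sheets are controlled by the number of sheets. -/
lemma tsum_lintegral_newSheet_le {F : (ℂ × ℂ) × ℂ → ℂ} {V : Set (ℂ × ℂ)} {s₀ : ℂ} {r : ℝ}
    (hr : 0 < r) (hV : MeasurableSet V)
    (hF : ∀ y ∈ V, DifferentiableOn ℂ (fun s ↦ F (y, s)) (ball s₀ (4 * r)))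
    (hF1 : ∀ y ∈ V, ∀ s ∈ ball s₀ (4 * r), ‖F (y, s)‖ ≤ 1)
    {Θ : ℕ → OpenPartialHomeomorph (ℂ × ℂ) (ℂ × ℂ)} {ℓ : ℕ → ℂ × ℂ →L[ℂ] ℂ}
    (hΘ : ∀ j, IsGraphChart F V (ball s₀ r) (Θ j) (ℓ j)) {q : ℂ × ℂ → ENNReal} (hq : Measurable q)
    {W : ℂ × ℂ → ENNReal} (hW : Measurable W)
    (hWq : ∀ y ∈ V, W y ≤ {y | F (y, s₀) ≠ 0}.indicator
      (fun y ↦ ENNReal.ofReal (logWeight ‖F (y, s₀)‖) * q y) y) :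
    ∑' j, ∫⁻ y in newSheet Θ j, W y ≤ 2 * ∫⁻ y in V, q y := by
  classical
  have hsub : ∀ j, newSheet Θ j ⊆ V := fun j y hy ↦ (hΘ j).source_subset hy.1
  have h1 : ∀ j, ∫⁻ y in newSheet Θ j, W y = ∫⁻ y in V, (newSheet Θ j).indicator W y := by
    intro j
    rw [setLIntegral_indicator (measurableSet_newSheet Θ j), inter_eq_left.2 (hsub j)]
  simp_rw [h1]
  rw [← lintegral_tsum fun j ↦ (hW.indicator (measurableSet_newSheet Θ j)).aemeasurable,
    ← lintegral_const_mul _ hq]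
  refine setLIntegral_mono' hV fun y hy ↦ ?_
  by_cases hy0 : F (y, s₀) = 0
  · have hW0 : W y = 0 := by simpa [hy0] using hWq y hy
    simp [indicator, hW0]
  have hWy : W y ≤ ENNReal.ofReal (logWeight ‖F (y, s₀)‖) * q y := by
    simpa [hy0] using hWq y hy
  rw [ENNReal.tsum_eq_iSup_sum]
  refine iSup_le fun J ↦ ?_
  set J' := J.filter fun j ↦ y ∈ newSheet Θ j
  have h2 : ∑ j ∈ J, (newSheet Θ j).indicator W y = J'.card * W y := by
    rw [Finset.sum_congr rfl fun j _ ↦ indicator_apply (newSheet Θ j) W y, ← Finset.sum_filter,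
      Finset.sum_const, nsmul_eq_mul]
  have hmem : ∀ j ∈ J', y ∈ newSheet Θ j := fun j hj ↦ (Finset.mem_filter.1 hj).2
  -- Counting only new sheets makes the values at `y` distinct, so they are that many distinct zeros
  -- of `F (y, ·)`.
  have hinj : Set.InjOn (fun j ↦ (Θ j y).1) J' := by
    intro j hj k hk hjk
    rcases lt_trichotomy j k with h | h | h
    · exact absurd hjk ((hmem k hk).2 j h (hmem j hj).1)
    · exact h
    · exact absurd hjk.symm ((hmem j hj).2 k h (hmem k hk).1)
  have hcard := norm_le_pow_card_of_zeros hr (J'.image fun j ↦ (Θ j y).1) (fun s ↦ F (y, s))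
    (hF y hy) (fun z hz ↦ hF1 y hy z (closedBall_subset_ball (by linarith) hz)) (by
      intro z hz
      obtain ⟨j, hj, rfl⟩ := Finset.mem_image.1 hz
      exact ⟨(hΘ j).fst_mem y (hmem j hj).1, (hΘ j).zero y (hmem j hj).1⟩)
  rw [Finset.card_image_of_injOn hinj] at hcard
  have hpos : 0 < ‖F (y, s₀)‖ := norm_pos_iff.2 hy0
  -- Logarithms in `‖F (y, s₀)‖ ≤ 2 ^ (-card)` give `card · log 2 ≤ -log ‖F (y, s₀)‖`, and `log 2 >
  -- 1 / 2`.
  have hlog : (J'.card : ℝ) * logWeight ‖F (y, s₀)‖ ≤ 2 := by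
    have h3 := Real.log_le_log hpos hcard
    rw [Real.log_pow, one_div, Real.log_inv] at h3
    have h4 : Real.log ‖F (y, s₀)‖ ≤ 0 :=
      Real.log_nonpos hpos.le (hF1 y hy s₀ (mem_ball_self (by positivity)))
    have h5 := Real.log_two_gt_d9
    have h6 : (0 : ℝ) ≤ J'.card := Nat.cast_nonneg _
    rw [logWeight, ← div_eq_mul_inv, div_le_iff₀ (by linarith)]
    nlinarith
  rw [h2]
  calc (J'.card : ENNReal) * W y
      ≤ J'.card * (ENNReal.ofReal (logWeight ‖F (y, s₀)‖) * q y) := by gcongr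
    _ = ENNReal.ofReal (J'.card * logWeight ‖F (y, s₀)‖) * q y := by
        rw [ENNReal.ofReal_mul (Nat.cast_nonneg _), ENNReal.ofReal_natCast, mul_assoc]
    _ ≤ ENNReal.ofReal 2 * q y := by gcongr
    _ = 2 * q y := by simp

/-- The integral over a slice, computed on a parametrization `n` of the slice. -/
lemma lintegral_slice_lt_top {Θ : ℕ → OpenPartialHomeomorph (ℂ × ℂ) (ℂ × ℂ)}
    {ℓ : ℕ → ℂ × ℂ →L[ℂ] ℂ} {W : ℂ × ℂ → ENNReal} {s : ℂ}
    (hΘ : ∀ j, ∀ y ∈ (Θ j).source, (Θ j y).2 = ℓ j y)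
    (hdet : ∀ j, ∀ y ∈ (Θ j).source,
      LinearMap.det (fderiv ℂ (Θ j) y : ℂ × ℂ →ₗ[ℂ] ℂ × ℂ) ≠ 0)
    (hs : ∑' j, ∫⁻ t, sheetDensity Θ W j (s, t) < ⊤) {n : ℂ → ℂ × ℂ} {B K : Set ℂ}
    (hB : IsOpen B) (hn : DifferentiableOn ℂ n B) (hK : K.Countable) (hinj : InjOn n (B \ K))
    {f : ℂ → ℂ} {M : ℝ} (hM : 0 ≤ M)
    (hcov : ∀ z ∈ B \ K, ∃ j, n z ∈ (Θ j).source ∧ (Θ j (n z)).1 = s)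
    (hf : ∀ z ∈ B \ K, ∀ j, n z ∈ (Θ j).source → (Θ j (n z)).1 = s →
      ‖f z‖ ^ 2 * ‖LinearMap.det (fderiv ℂ (Θ j) (n z) : ℂ × ℂ →ₗ[ℂ] ℂ × ℂ)‖ ^ 2 ≤
        M * ‖ℓ j (deriv n z)‖ ^ 2) :
    ∫⁻ z in B, ENNReal.ofReal (‖f z‖ ^ 2) * W (n z) < ⊤ := by
  classical
  set P : ℕ → Set ℂ := fun j ↦ (B \ K) ∩ n ⁻¹' {y | y ∈ newSheet Θ j ∧ (Θ j y).1 = s} with hP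
  have hBm : MeasurableSet (B \ K) := hB.measurableSet.diff hK.measurableSet
  have hPm : ∀ j, MeasurableSet (P j) := by
    intro j
    refine (hn.continuousOn.mono sdiff_subset).measurableSet_inter_preimage hBm ?_
    have : {y | y ∈ newSheet Θ j ∧ (Θ j y).1 = s} =
        newSheet Θ j ∩ ((Θ j).source ∩ (fun y ↦ (Θ j y).1) ⁻¹' {s}) := by
      ext y
      exact ⟨fun h ↦ ⟨h.1, h.1.1, h.2⟩, fun h ↦ ⟨h.1, h.2.2⟩⟩
    rw [this]
    exact (measurableSet_newSheet Θ j).inter ((Θ j).continuousOn.fst.measurableSet_inter_preimage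
      (Θ j).open_source.measurableSet (measurableSet_singleton s))
  -- The smallest index of a chart taking the value `s` at `n z` is one for which `n z` is on a new
  -- sheet.
  have hcovP : B \ K ⊆ ⋃ j, P j := by
    intro z hz
    have hex := hcov z hz
    obtain ⟨h1, h2⟩ := Nat.find_spec hex
    refine mem_iUnion.2 ⟨Nat.find hex, hz, ⟨h1, fun k hk hkz hks ↦ ?_⟩, h2⟩
    exact Nat.find_min hex hk ⟨hkz, hks.trans h2⟩
  have hpiece : ∀ j, ∫⁻ z in P j, ENNReal.ofReal (‖f z‖ ^ 2) * W (n z) ≤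
      ENNReal.ofReal M * ∫⁻ t, sheetDensity Θ W j (s, t) := by
    intro j
    have hΘeq : ∀ z ∈ P j, Θ j (n z) = (s, ℓ j (n z)) := fun z hz ↦
      Prod.ext hz.2.2 (hΘ j _ hz.2.1.1)
    have hd : ∀ z ∈ P j, HasDerivAt (fun z ↦ ℓ j (n z)) (ℓ j (deriv n z)) z := fun z hz ↦
      (ℓ j).hasFDerivAt.comp_hasDerivAt z (hn.differentiableAt (hB.mem_nhds hz.1.1)).hasDerivAt
    have hi : InjOn (fun z ↦ ℓ j (n z)) (P j) := by
      intro z hz w hw hzw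
      refine hinj hz.1 hw.1 ((Θ j).injOn hz.2.1.1 hw.2.1.1 ?_)
      rw [hΘeq z hz, hΘeq w hw]
      exact congrArg (Prod.mk s) hzw
    -- On `P j` the curve reads `(s, ℓ j (n z))` in the chart, so `ℓ j ∘ n` is an injective
    -- coordinate on the slice.
    have hcv := lintegral_image_eq_lintegral_abs_det_fderiv_mul volume (hPm j)
      (fun z hz ↦ ((hd z hz).hasFDerivAt.restrictScalars ℝ).hasFDerivWithinAt) hi
      (fun t ↦ sheetDensity Θ W j (s, t))
    calc ∫⁻ z in P j, ENNReal.ofReal (‖f z‖ ^ 2) * W (n z)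
        ≤ ∫⁻ z in P j, ENNReal.ofReal M * (ENNReal.ofReal
          |(((ContinuousLinearMap.toSpanSingleton ℂ (ℓ j (deriv n z)))).restrictScalars ℝ).det| *
            sheetDensity Θ W j (s, ℓ j (n z))) := by
          refine setLIntegral_mono' (hPm j) fun z hz ↦ ?_
          rw [← hΘeq z hz, sheetDensity_apply hz.2.1, abs_det_restrictScalars]
          have hdet1 : LinearMap.det ((ContinuousLinearMap.toSpanSingleton ℂ (ℓ j (deriv n z)) :
              ℂ →L[ℂ] ℂ) : ℂ →ₗ[ℂ] ℂ) = ℓ j (deriv n z) := by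
            rw [LinearMap.det_ring]
            simp
          rw [hdet1]
          have hle := hf z hz.1 j hz.2.1.1 hz.2.2
          have hle' : ENNReal.ofReal (‖f z‖ ^ 2) * jacobianSq (Θ j) (n z) ≤
              ENNReal.ofReal M * ENNReal.ofReal (‖ℓ j (deriv n z)‖ ^ 2) := by
            rw [jacobianSq, ← ENNReal.ofReal_mul (by positivity), ← ENNReal.ofReal_mul hM]
            exact ENNReal.ofReal_le_ofReal hle
          have hj0 : jacobianSq (Θ j) (n z) ≠ 0 := by
            have := norm_pos_iff.2 (hdet j _ hz.2.1.1)
            simp only [jacobianSq, ne_eq, ENNReal.ofReal_eq_zero, not_le]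
            positivity
          have hjt : jacobianSq (Θ j) (n z) ≠ ⊤ := ENNReal.ofReal_ne_top
          calc ENNReal.ofReal (‖f z‖ ^ 2) * W (n z)
              = (ENNReal.ofReal (‖f z‖ ^ 2) * jacobianSq (Θ j) (n z)) *
                (W (n z) * (jacobianSq (Θ j) (n z))⁻¹) := by
                rw [mul_mul_mul_comm, ENNReal.mul_inv_cancel hj0 hjt, mul_one]
            _ ≤ (ENNReal.ofReal M * ENNReal.ofReal (‖ℓ j (deriv n z)‖ ^ 2)) *
                (W (n z) * (jacobianSq (Θ j) (n z))⁻¹) := by gcongr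
            _ = _ := by rw [mul_assoc]
      _ = ENNReal.ofReal M * ∫⁻ t in (fun z ↦ ℓ j (n z)) '' P j, sheetDensity Θ W j (s, t) := by
          rw [hcv, lintegral_const_mul' _ _ ENNReal.ofReal_ne_top]
      _ ≤ _ := by
          gcongr
          exact Measure.restrict_le_self
  calc ∫⁻ z in B, ENNReal.ofReal (‖f z‖ ^ 2) * W (n z)
      = ∫⁻ z in B \ K, ENNReal.ofReal (‖f z‖ ^ 2) * W (n z) := by
        refine (setLIntegral_congr ?_).symm
        exact sdiff_null_ae_eq_self (hK.measure_zero volume)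
    _ ≤ ∫⁻ z in ⋃ j, P j, ENNReal.ofReal (‖f z‖ ^ 2) * W (n z) := lintegral_mono_set hcovP
    _ ≤ ∑' j, ∫⁻ z in P j, ENNReal.ofReal (‖f z‖ ^ 2) * W (n z) := lintegral_iUnion_le _ _
    _ ≤ ∑' j, ENNReal.ofReal M * ∫⁻ t, sheetDensity Θ W j (s, t) := ENNReal.tsum_le_tsum hpiece
    _ = ENNReal.ofReal M * ∑' j, ∫⁻ t, sheetDensity Θ W j (s, t) := ENNReal.tsum_mul_left
    _ < ⊤ := ENNReal.mul_lt_top ENNReal.ofReal_lt_top hs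

end Slicing

/-! ### Coordinates with values in `ℂ × ℂ` -/

section Coordinates

open Metric Set Filter Topology

/-- The identification of the model space with `ℂ × ℂ`. -/
noncomputable def planeEquiv : ComplexPlane ≃L[ℂ] ℂ × ℂ :=
  (EuclideanSpace.equiv (Fin 2) ℂ).trans (ContinuousLinearEquiv.finTwoArrow ℂ ℂ)

variable {X : Type*} [TopologicalSpace X] [ChartedSpace ComplexPlane X]

/-- The coordinates around `p` with values in `ℂ × ℂ`. -/
noncomputable def coord (p : X) : OpenPartialHomeomorph X (ℂ × ℂ) :=
  (chartAt ComplexPlane p).transHomeomorph planeEquiv.toHomeomorph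

lemma mem_coord_source (p : X) : p ∈ (coord p).source := mem_chart_source ComplexPlane p

/-- A function on a complex surface is holomorphic at a point. -/
abbrev HolAt (g : X → ℂ) (x : X) : Prop := ContMDiffAt 𝓘(ℂ, ComplexPlane) 𝓘(ℂ) ω g x

lemma analyticAt_of_contMDiffAt {E G : Type*} [NormedAddCommGroup E] [NormedSpace ℂ E]
    [CompleteSpace E] [NormedAddCommGroup G] [NormedSpace ℂ G] {f : E → G} {x : E}
    (h : ContMDiffAt 𝓘(ℂ, E) 𝓘(ℂ, G) ω f x) : AnalyticAt ℂ f x :=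
  h.contDiffAt.analyticAt

lemma HolAt.analyticAt_comp_curve {g : X → ℂ} {γ : ℂ → X} {z : ℂ} (hg : HolAt g (γ z))
    (hγ : ContMDiff 𝓘(ℂ) 𝓘(ℂ, ComplexPlane) ω γ) : AnalyticAt ℂ (fun z ↦ g (γ z)) z :=
  analyticAt_of_contMDiffAt (ContMDiffAt.comp z hg (hγ z))

variable [IsManifold 𝓘(ℂ, ComplexPlane) ω X]

lemma contMDiffOn_coord_symm (p : X) :
    ContMDiffOn 𝓘(ℂ, ℂ × ℂ) 𝓘(ℂ, ComplexPlane) ω (coord p).symm (coord p).target := by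
  refine (contMDiffOn_chart_symm (I := 𝓘(ℂ, ComplexPlane)) (x := p) (n := ω)).comp
    (f := planeEquiv.symm) ?_ (fun y hy ↦ hy)
  exact planeEquiv.symm.contDiff.contMDiff.contMDiffOn

lemma contMDiffOn_coord (p : X) :
    ContMDiffOn 𝓘(ℂ, ComplexPlane) 𝓘(ℂ, ℂ × ℂ) ω (coord p) (coord p).source := by
  refine ContMDiff.comp_contMDiffOn (g := planeEquiv) planeEquiv.contDiff.contMDiff
    (contMDiffOn_chart (I := 𝓘(ℂ, ComplexPlane)) (x := p) (n := ω))

lemma AnalyticAt.contMDiffAt' {E G : Type*} [NormedAddCommGroup E] [NormedSpace ℂ E]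
    [NormedAddCommGroup G] [NormedSpace ℂ G] [CompleteSpace G] {f : E → G} {x : E}
    (h : AnalyticAt ℂ f x) : ContMDiffAt 𝓘(ℂ, E) 𝓘(ℂ, G) ω f x :=
  h.contDiffAt.contMDiffAt

lemma analyticAt_coord_comp {γ : ℂ → X} (hγ : ContMDiff 𝓘(ℂ) 𝓘(ℂ, ComplexPlane) ω γ) {p : X}
    {z : ℂ} (hz : γ z ∈ (coord p).source) : AnalyticAt ℂ (fun z ↦ coord p (γ z)) z :=
  analyticAt_of_contMDiffAt <| ((contMDiffOn_coord p).contMDiffAt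
    ((coord p).open_source.mem_nhds hz)).comp z (hγ z)

lemma HolAt.analyticAt_comp_coord_symm {g : X → ℂ} {p : X} {y : ℂ × ℂ}
    (hy : y ∈ (coord p).target) (hg : HolAt g ((coord p).symm y)) :
    AnalyticAt ℂ (fun y ↦ g ((coord p).symm y)) y :=
  analyticAt_of_contMDiffAt (ContMDiffAt.comp y hg
    ((contMDiffOn_coord_symm p).contMDiffAt ((coord p).open_target.mem_nhds hy)))

lemma holAt_comp_coord {h : ℂ × ℂ → ℂ} {p x : X} (hx : x ∈ (coord p).source)
    (hh : AnalyticAt ℂ h (coord p x)) : HolAt (fun x ↦ h (coord p x)) x :=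
  ContMDiffAt.comp x hh.contMDiffAt'
    ((contMDiffOn_coord p).contMDiffAt ((coord p).open_source.mem_nhds hx))

variable {S : Type*} [TopologicalSpace S] [ChartedSpace ℂ S] [IsManifold 𝓘(ℂ) ω S]

/-- An analytic hypersurface of `S × X` in local coordinates. -/
lemma IsAnalyticHypersurface.exists_analyticAt_coord {Γ : Set (S × X)}
    (hΓ : IsAnalyticHypersurface (𝓘(ℂ).prod 𝓘(ℂ, ComplexPlane)) Γ) (s₀ s : S) (p x : X)
    (hs : s ∈ (chartAt ℂ s₀).source) (hx : x ∈ (coord p).source) :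
    ∃ F : (ℂ × ℂ) × ℂ → ℂ, AnalyticAt ℂ F (coord p x, chartAt ℂ s₀ s) ∧
      ∀ᶠ q in 𝓝 (coord p x, chartAt ℂ s₀ s),
        F q = 0 ↔ ((chartAt ℂ s₀).symm q.2, (coord p).symm q.1) ∈ Γ := by
  set e := chartAt ℂ s₀
  set Ψ : (ℂ × ℂ) × ℂ → S × X := fun q ↦ (e.symm q.2, (coord p).symm q.1) with hΨ
  set q₀ : (ℂ × ℂ) × ℂ := (coord p x, e s) with hq₀
  have hΨq : Ψ q₀ = (s, x) := by
    simp only [hΨ, hq₀, e.left_inv hs, (coord p).left_inv hx]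
  have hq1 : q₀.1 ∈ (coord p).target := (coord p).map_source hx
  have hq2 : q₀.2 ∈ e.target := e.map_source hs
  have hΨc : ContMDiffAt 𝓘(ℂ, (ℂ × ℂ) × ℂ) (𝓘(ℂ).prod 𝓘(ℂ, ComplexPlane)) ω Ψ q₀ := by
    refine ContMDiffAt.prodMk ?_ ?_
    · exact ((contMDiffOn_chart_symm (I := 𝓘(ℂ)) (x := s₀) (n := ω)).contMDiffAt
        (e.open_target.mem_nhds hq2)).comp q₀ (contDiff_snd.contMDiff.contMDiffAt)
    · exact ((contMDiffOn_coord_symm p).contMDiffAt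
        ((coord p).open_target.mem_nhds hq1)).comp q₀ (contDiff_fst.contMDiff.contMDiffAt)
  have hcont : Tendsto Ψ (𝓝 q₀) (𝓝 (s, x)) := hΨq ▸ hΨc.continuousAt
  by_cases hmem : (s, x) ∈ Γ
  · obtain ⟨U, hU, hsU, f, hf, hfΓ⟩ := hΓ.2.2 _ hmem
    refine ⟨f ∘ Ψ, ?_, ?_⟩
    · refine analyticAt_of_contMDiffAt (ContMDiffAt.comp q₀ ?_ hΨc)
      rw [hΨq]
      exact hf.contMDiffAt (hU.mem_nhds hsU)
    · filter_upwards [hcont (hU.mem_nhds hsU)] with q hq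
      exact (hfΓ _ hq).symm
  · refine ⟨fun _ ↦ 1, analyticAt_const, ?_⟩
    filter_upwards [hcont (hΓ.1.isOpen_compl.mem_nhds hmem)] with q hq
    simpa using hq

end Coordinates

/-! ### Torus parametrizations and the identity theorem for families -/

section Families

open Metric Set Filter Topology

/-- Topological form of the identity theorem: the interior of `A` is open and closed. -/
lemma eq_univ_of_eventually_dichotomy {α : Type*} [TopologicalSpace α] [PreconnectedSpace α]
    {A : Set α} (h : ∀ x, (∀ᶠ y in 𝓝 x, y ∈ A) ∨ ∀ᶠ y in 𝓝[≠] x, y ∉ A)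
    (hf : ∃ x, ∃ᶠ y in 𝓝[≠] x, y ∈ A) : A = univ := by
  set T : Set α := {x | ∀ᶠ y in 𝓝 x, y ∈ A} with hT
  have hTo : IsOpen T := isOpen_iff_mem_nhds.2 fun x hx ↦ Filter.Eventually.eventually_nhds hx
  have hTc : IsClosed T := by
    refine isOpen_compl_iff.1 (isOpen_iff_mem_nhds.2 fun x hx ↦ ?_)
    have h1 := (h x).resolve_left hx
    rw [eventually_nhdsWithin_iff] at h1
    filter_upwards [h1] with y hy hyT
    rcases eq_or_ne y x with rfl | hne
    · exact hx hyT
    · exact hy hne hyT.self_of_nhds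
  obtain ⟨x, hx⟩ := hf
  have hxT : x ∈ T := (h x).resolve_right hx
  have hTu : T = univ := IsClopen.eq_univ ⟨hTc, hTo⟩ ⟨x, hxT⟩
  exact eq_univ_of_forall fun y ↦ Filter.Eventually.self_of_nhds (hTu ▸ mem_univ y : y ∈ T)

variable {X : Type*} [TopologicalSpace X] [ChartedSpace ComplexPlane X]

/-- `γ` is a holomorphic parametrization of `C` with period lattice `L`, injective modulo `L` off
the countable set `K`. -/
structure IsTorusParam (L : PeriodPair) (γ : ℂ → X) (C : Set X) (K : Set ℂ) : Prop where
  contMDiff : ContMDiff 𝓘(ℂ) 𝓘(ℂ, ComplexPlane) ω γ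
  periodic : ∀ z, ∀ l ∈ L.lattice, γ (z + l) = γ z
  range_eq : range γ = C
  countable : K.Countable
  injective : ∀ z ∉ K, ∀ w ∉ K, γ z = γ w → z - w ∈ L.lattice

lemma countable_of_sub_mem_lattice {L : PeriodPair} {A : Set ℂ}
    (h : ∀ z ∈ A, ∀ w ∈ A, z - w ∈ L.lattice) : A.Countable := by
  rcases A.eq_empty_or_nonempty with rfl | ⟨w, hw⟩
  · exact countable_empty
  · refine (countable_range fun l : L.lattice ↦ (l : ℂ) + w).mono fun z hz ↦ ?_
    exact ⟨⟨z - w, h z hz w hw⟩, by simp⟩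

lemma IsEllipticCurveIn.exists_isTorusParam {C : Set X} (h : IsEllipticCurveIn C) :
    ∃ L γ K, IsTorusParam L γ C K := by
  obtain ⟨L, ν, hν, hr, B, hB, hinj⟩ := h
  refine ⟨L, fun z ↦ ν (Submodule.Quotient.mk z), Submodule.Quotient.mk ⁻¹' B, hν, ?_, ?_, ?_, ?_⟩
  · intro z l hl
    congr 1
    rw [Submodule.Quotient.eq]
    simpa using hl
  · rw [← hr]
    exact (Submodule.Quotient.mk_surjective L.lattice).range_comp ν
  · have : (Submodule.Quotient.mk ⁻¹' B : Set ℂ) =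
        ⋃ b ∈ B, {z : ℂ | (Submodule.Quotient.mk z : ℂ ⧸ L.lattice) = b} := by
      ext z
      simp
    rw [this]
    refine hB.countable.biUnion fun b _ ↦ countable_of_sub_mem_lattice (L := L) fun z hz w hw ↦ ?_
    exact (Submodule.Quotient.eq _).1 (Eq.trans hz (Eq.symm hw))
  · intro z hz w hw hzw
    exact (Submodule.Quotient.eq _).1 (hinj hz hw hzw)

lemma Set.Countable.not_mem_nhds {A : Set ℂ} (hA : A.Countable) (z : ℂ) : A ∉ 𝓝 z := by
  intro h
  obtain ⟨w, hw1, hw2⟩ := (hA.dense_compl ℝ).inter_nhds_nonempty h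
  exact hw1 hw2

namespace IsTorusParam

variable {L : PeriodPair} {γ : ℂ → X} {C : Set X} {K : Set ℂ}

lemma countable_fiber (h : IsTorusParam L γ C K) (x : X) : {z | γ z = x}.Countable := by
  have h1 : ({z | γ z = x} \ K).Countable := countable_of_sub_mem_lattice (L := L)
    fun z hz w hw ↦ h.injective z hz.2 w hw.2 (hz.1.trans hw.1.symm)
  exact (h1.union h.countable).mono fun z hz ↦ by by_cases hzK : z ∈ K <;> simp_all

lemma not_eventually_eq (h : IsTorusParam L γ C K) (z₀ : ℂ) (x : X) :
    ¬ ∀ᶠ z in 𝓝 z₀, γ z = x :=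
  (h.countable_fiber x).not_mem_nhds z₀

lemma not_countable (h : IsTorusParam L γ C K) : ¬ C.Countable := by
  intro hC
  have h1 : (⋃ x ∈ C, {z | γ z = x}).Countable := hC.biUnion fun x _ ↦ h.countable_fiber x
  refine h1.not_mem_nhds 0 (mem_of_superset univ_mem fun z _ ↦ ?_)
  exact mem_biUnion (h.range_eq ▸ mem_range_self z) rfl

/-- Points in a ball of half the minimal distance of the discrete lattice cannot differ by a nonzero
period. -/
lemma exists_injOn_ball (h : IsTorusParam L γ C K) (z₀ : ℂ) :
    ∃ δ > 0, InjOn γ (ball z₀ δ \ K) := by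
  obtain ⟨ε, hε, hball⟩ := Metric.exists_ball_inter_eq_singleton_of_mem_discrete
    (s := (L.lattice : Set ℂ)) ⟨inferInstanceAs (DiscreteTopology L.lattice)⟩ L.lattice.zero_mem
  refine ⟨ε / 2, half_pos hε, fun z hz w hw hzw ↦ ?_⟩
  have h1 := h.injective z hz.2 w hw.2 hzw
  have h2 : z - w ∈ ball (0 : ℂ) ε := by
    have := dist_triangle_right z w z₀
    have hz1 := mem_ball.1 hz.1
    have hw1 := mem_ball.1 hw.1
    rw [mem_ball_zero_iff, ← dist_eq_norm]
    linarith
  have h3 : z - w ∈ ({0} : Set ℂ) := hball ▸ ⟨h2, h1⟩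
  exact sub_eq_zero.1 h3

end IsTorusParam

variable [IsManifold 𝓘(ℂ, ComplexPlane) ω X]
variable {S : Type*} [TopologicalSpace S] [ChartedSpace ℂ S] [IsManifold 𝓘(ℂ) ω S]
  {E : S → Set X}

namespace IsEllipticCurveFamily

/-- With `x` fixed, the local equation of the incidence graph is an analytic function of the
parameter alone, so its zeros are isolated or fill a neighbourhood. -/
lemma eventually_mem_or_param (hE : IsEllipticCurveFamily E) (x : X) (s₁ : S) :
    (∀ᶠ s in 𝓝 s₁, x ∈ E s) ∨ ∀ᶠ s in 𝓝[≠] s₁, x ∉ E s := by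
  obtain ⟨F, hF, hev⟩ := hE.graph_analytic.exists_analyticAt_coord s₁ s₁ x x
    (mem_chart_source ℂ s₁) (mem_coord_source x)
  set e := chartAt ℂ s₁
  have hs₁ : s₁ ∈ e.source := mem_chart_source ℂ s₁
  have hF' : AnalyticAt ℂ (fun t ↦ F (coord x x, t)) (e s₁) :=
    hF.comp_of_eq (f := fun t : ℂ ↦ (coord x x, t)) (by fun_prop) rfl
  have hcont : Tendsto (fun s ↦ (coord x x, e s)) (𝓝 s₁) (𝓝 (coord x x, e s₁)) :=
    tendsto_const_nhds.prodMk_nhds (e.continuousAt hs₁)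
  have hiff : ∀ᶠ s in 𝓝 s₁, F (coord x x, e s) = 0 ↔ x ∈ E s := by
    filter_upwards [hcont.eventually hev, e.open_source.eventually_mem hs₁] with s hs hss
    rw [hs, e.left_inv hss, (coord x).left_inv (mem_coord_source x)]
  rcases hF'.eventually_eq_zero_or_eventually_ne_zero with h | h
  · refine Or.inl ?_
    filter_upwards [(e.continuousAt hs₁).eventually h, hiff] with s h1 h2 using h2.1 h1
  · refine Or.inr ?_
    rw [eventually_nhdsWithin_iff] at h ⊢
    filter_upwards [(e.continuousAt hs₁).eventually h, hiff,
      e.open_source.eventually_mem hs₁] with s h1 h2 h3 hne hmem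
    exact h1 (fun h4 ↦ hne (e.injOn h3 hs₁ h4)) (h2.2 hmem)

/-- The same alternative for the local equation with `s` fixed, pulled back along the curve. -/
lemma eventually_mem_or_curve (hE : IsEllipticCurveFamily E) (s : S) {γ : ℂ → X}
    (hγ : ContMDiff 𝓘(ℂ) 𝓘(ℂ, ComplexPlane) ω γ) (z₀ : ℂ) :
    (∀ᶠ z in 𝓝 z₀, γ z ∈ E s) ∨ ∀ᶠ z in 𝓝[≠] z₀, γ z ∉ E s := by
  obtain ⟨F, hF, hev⟩ := hE.graph_analytic.exists_analyticAt_coord s s (γ z₀) (γ z₀)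
    (mem_chart_source ℂ s) (mem_coord_source _)
  set e := chartAt ℂ s
  set χ := coord (γ z₀)
  have hz₀ : γ z₀ ∈ χ.source := mem_coord_source _
  have hn : AnalyticAt ℂ (fun z ↦ χ (γ z)) z₀ := analyticAt_coord_comp hγ hz₀
  have hF' : AnalyticAt ℂ (fun z ↦ F (χ (γ z), e s)) z₀ :=
    hF.comp_of_eq (f := fun z : ℂ ↦ (χ (γ z), e s)) (hn.prod analyticAt_const) rfl
  have hcont : Tendsto (fun z ↦ (χ (γ z), e s)) (𝓝 z₀) (𝓝 (χ (γ z₀), e s)) :=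
    hn.continuousAt.tendsto.prodMk_nhds tendsto_const_nhds
  have hiff : ∀ᶠ z in 𝓝 z₀, F (χ (γ z), e s) = 0 ↔ γ z ∈ E s := by
    filter_upwards [hcont.eventually hev, (hγ.continuous.continuousAt (x := z₀)).eventually
      (χ.open_source.eventually_mem hz₀)] with z hz hzs
    rw [hz, e.left_inv (mem_chart_source ℂ s), χ.left_inv hzs]
  rcases hF'.eventually_eq_zero_or_eventually_ne_zero with h | h
  · exact Or.inl ((h.and hiff).mono fun z hz ↦ hz.2.1 hz.1)
  · exact Or.inr ((h.and (nhdsWithin_le_nhds hiff)).mono fun z hz hmem ↦ hz.1 (hz.2.2 hmem))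

lemma range_subset_of_frequently (hE : IsEllipticCurveFamily E) (s : S) {γ : ℂ → X}
    (hγ : ContMDiff 𝓘(ℂ) 𝓘(ℂ, ComplexPlane) ω γ) {z₀ : ℂ} (h : ∃ᶠ z in 𝓝[≠] z₀, γ z ∈ E s) :
    range γ ⊆ E s := by
  have : {z | γ z ∈ E s} = univ :=
    eq_univ_of_eventually_dichotomy (fun z ↦ hE.eventually_mem_or_curve s hγ z) ⟨z₀, h⟩
  rintro _ ⟨z, rfl⟩
  exact (this ▸ mem_univ z : z ∈ {z | γ z ∈ E s})

/-- Elliptic members are irreducible. -/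
lemma eq_of_subset (hE : IsEllipticCurveFamily E) {s s' : S} (hs : IsEllipticCurveIn (E s))
    (hs' : IsEllipticCurveIn (E s')) (hsub : E s ⊆ E s') : E s = E s' := by
  obtain ⟨L, γ, K, h⟩ := hs.exists_isTorusParam
  obtain ⟨L', γ', K', h'⟩ := hs'.exists_isTorusParam
  refine hsub.antisymm ?_
  by_contra hcon
  -- If `γ'` returned to `E s` at an accumulation point, it would stay in `E s` throughout. So `E s`
  -- meets `E s'` in a countable set, although `E s` is an uncountable subset of `E s'`.
  have hcount : {z | γ' z ∈ E s}.Countable := countable_of_forall_isolated fun z _ ↦ by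
    by_contra hz
    exact hcon (h'.range_eq ▸ hE.range_subset_of_frequently s h'.contMDiff (z₀ := z)
      (by simpa using hz))
  refine h.not_countable ((hcount.image γ').mono fun x hx ↦ ?_)
  obtain ⟨z, rfl⟩ : x ∈ range γ' := h'.range_eq ▸ hsub hx
  exact mem_image_of_mem _ hx

/-- By irreducibility a member contained in all members would equal every elliptic one, and the
family would be constant. -/
lemma not_forall_subset (hE : IsEllipticCurveFamily E) {s : S} (hs : IsEllipticCurveIn (E s)) :
    ¬ ∀ s', E s ⊆ E s' := fun h ↦
  hE.not_constant ⟨E s, hE.general_elliptic.mono fun s' hs' ↦ (hE.eq_of_subset hs hs' (h s')).symm⟩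

/-- An elliptic member meets the base locus in isolated points. -/
lemma eventually_exists_notMem (hE : IsEllipticCurveFamily E) {s : S} {L : PeriodPair} {γ : ℂ → X}
    {K : Set ℂ} (hs : IsEllipticCurveIn (E s)) (h : IsTorusParam L γ (E s) K) (z₀ : ℂ) :
    ∀ᶠ z in 𝓝[≠] z₀, ∃ s', γ z ∉ E s' := by
  by_contra hcon
  have hcon' : ∃ᶠ z in 𝓝[≠] z₀, ∀ s', γ z ∈ E s' := by simpa using hcon
  refine hE.not_forall_subset hs fun s' ↦ ?_
  rw [← h.range_eq]
  exact hE.range_subset_of_frequently s' h.contMDiff (hcon'.mono fun z hz ↦ hz s')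

variable [CompactSpace S] [PreconnectedSpace S]

/-- An infinite subset of the compact `S` accumulates, and the identity theorem spreads membership
over the connected `S`. -/
lemma finite_or_forall_mem (hE : IsEllipticCurveFamily E) (x : X) :
    {s | x ∈ E s}.Finite ∨ ∀ s, x ∈ E s := by
  refine or_iff_not_imp_left.2 fun hinf ↦ ?_
  obtain ⟨s₁, hs₁⟩ := Set.Infinite.exists_accPt_principal hinf
  rw [accPt_iff_frequently_nhdsNE] at hs₁
  have : {s | x ∈ E s} = univ :=
    eq_univ_of_eventually_dichotomy (fun s ↦ hE.eventually_mem_or_param x s) ⟨s₁, hs₁⟩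
  exact fun s ↦ (this ▸ mem_univ s : s ∈ {s | x ∈ E s})

/-- Such members equal `E s₀`. Infinitely many of them would put every point of `E s₀` on infinitely
many members, hence on all. -/
lemma finite_subset_member (hE : IsEllipticCurveFamily E) {s₀ : S}
    (hs₀ : IsEllipticCurveIn (E s₀)) :
    {s | IsEllipticCurveIn (E s) ∧ E s ⊆ E s₀}.Finite := by
  by_contra hinf
  refine hE.not_forall_subset hs₀ fun s' x hx ↦ ?_
  refine (hE.finite_or_forall_mem x).resolve_left (fun hfin ↦ hinf (hfin.subset ?_)) s'
  rintro s ⟨hs, hsub⟩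
  rw [mem_ofPred_eq, hE.eq_of_subset hs hs₀ hsub]
  exact hx

end IsEllipticCurveFamily

end Families

/-! ### Exceptional parameters, and finite coordinate covers adapted to the family -/

section Patches

open Metric Set Filter Topology

variable {X : Type*} [TopologicalSpace X] [ChartedSpace ComplexPlane X]
  [IsManifold 𝓘(ℂ, ComplexPlane) ω X]
  {S : Type*} [TopologicalSpace S] [ChartedSpace ℂ S] [IsManifold 𝓘(ℂ) ω S]
  {E : S → Set X}

/-- Elliptic members contain arcs of a given proper analytic subset only for countably many
parameters. -/
lemma IsEllipticCurveFamily.exists_countable_exceptional [CompactSpace X]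
    [CompactSpace S] [PreconnectedSpace S]
    (hE : IsEllipticCurveFamily E) {U : Set X} (hU : IsOpen U) {Δ : X → ℂ}
    (hΔ : ∀ x ∈ U, HolAt Δ x) :
    ∃ bad : Set S, bad.Countable ∧ ∀ s ∉ bad, IsEllipticCurveIn (E s) → ∀ L γ K,
      IsTorusParam L γ (E s) K → ∀ z₀, γ z₀ ∈ U → (∀ᶠ z in 𝓝 z₀, Δ (γ z) = 0) →
        ∀ᶠ x in 𝓝 (γ z₀), Δ x = 0 := by
  obtain ⟨T, hT⟩ := isCompact_univ.elim_finite_subcover (fun p : X ↦ (coord p).source)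
    (fun p ↦ (coord p).open_source) fun x _ ↦ mem_iUnion.2 ⟨x, mem_coord_source x⟩
  have hQ : ∀ p : X, ∃ Q : Set (ℂ × ℂ), Q.Countable ∧
      ∀ (n : ℂ → ℂ × ℂ) (z₀ : ℂ), AnalyticAt ℂ n z₀ →
        n z₀ ∈ (coord p).target ∩ (coord p).symm ⁻¹' U →
        (¬ ∀ᶠ z in 𝓝 z₀, n z = n z₀) → (∀ᶠ z in 𝓝 z₀, Δ ((coord p).symm (n z)) = 0) →
        (¬ ∀ᶠ y in 𝓝 (n z₀), Δ ((coord p).symm y) = 0) → ∃ᶠ z in 𝓝[≠] z₀, n z ∈ Q := fun p ↦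
    exists_countable_meets_zero_arcs ((coord p).symm.isOpen_inter_preimage hU)
      fun y hy ↦ (hΔ _ hy.2).analyticAt_comp_coord_symm hy.1
  choose Q hQc hQ using hQ
  -- `Q p` is a countable set met by all arcs in the zero set of `Δ`. Each of its points outside the
  -- base locus lies on finitely many members, so the parameters of these members form a countable
  -- set.
  refine ⟨⋃ p ∈ T, ⋃ q ∈ Q p, ⋃ (_ : ∃ s', (coord p).symm q ∉ E s'), {s | (coord p).symm q ∈ E s},
    ?_, ?_⟩
  · refine T.countable_toSet.biUnion fun p _ ↦ (hQc p).biUnion fun q _ ↦ countable_iUnion ?_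
    rintro ⟨s', hs'⟩
    exact ((hE.finite_or_forall_mem _).resolve_right fun h ↦ hs' (h s')).countable
  · intro s hs hell L γ K hγ z₀ hz₀ hzero
    by_contra hne
    obtain ⟨p, hpT, hp⟩ := mem_iUnion₂.1 (hT (mem_univ (γ z₀)))
    have hsrc : ∀ᶠ z in 𝓝 z₀, γ z ∈ (coord p).source :=
      (hγ.contMDiff.continuous.continuousAt).eventually ((coord p).open_source.eventually_mem hp)
    have hfreq := hQ p (fun z ↦ coord p (γ z)) z₀ (analyticAt_coord_comp hγ.contMDiff hp)
      ⟨(coord p).map_source hp, by rwa [mem_preimage, (coord p).left_inv hp]⟩ (fun h ↦ ?_) ?_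
      fun h ↦ hne ?_
    -- The arc meets `Q p` arbitrarily close to `z₀`, while base points on an elliptic member are
    -- isolated. So some meeting point is not a base point, and `s` is exceptional.
    · obtain ⟨z, hz1, hz2, hz3⟩ := (hfreq.and_eventually
        ((hE.eventually_exists_notMem hell hγ z₀).and (nhdsWithin_le_nhds hsrc))).exists
      refine hs ?_
      simp only [mem_iUnion]
      refine ⟨p, hpT, _, hz1, by rwa [(coord p).left_inv hz3], ?_⟩
      rw [mem_ofPred_eq, (coord p).left_inv hz3, ← hγ.range_eq]
      exact mem_range_self z
    · refine hγ.not_eventually_eq z₀ (γ z₀) ?_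
      filter_upwards [h, hsrc] with z h1 h2 using (coord p).injOn h2 hp h1
    · filter_upwards [hzero, hsrc] with z h1 h2
      rwa [(coord p).left_inv h2]
    · filter_upwards [((coord p).continuousAt hp).eventually h,
        (coord p).open_source.eventually_mem hp] with x h1 h2
      rwa [(coord p).left_inv h2] at h1

/-- Finitely many coordinate patches on which the family over a disc is given by bounded equations
over a fourfold larger disc. -/
structure IsPatching (E : S → Set X) (s₀ : S) (r : ℝ) (T : Finset X) (V : X → Set (ℂ × ℂ))
    (F : X → (ℂ × ℂ) × ℂ → ℂ) : Prop where
  pos : 0 < r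
  ball_subset : ball (chartAt ℂ s₀ s₀) (4 * r) ⊆ (chartAt ℂ s₀).target
  isOpen : ∀ p, IsOpen (V p)
  isBounded : ∀ p, Bornology.IsBounded (V p)
  subset_target : ∀ p, V p ⊆ (coord p).target
  analytic : ∀ p ∈ T, AnalyticOnNhd ℂ (F p) (V p ×ˢ ball (chartAt ℂ s₀ s₀) (4 * r))
  norm_le : ∀ p ∈ T, ∀ y ∈ V p, ∀ t ∈ ball (chartAt ℂ s₀ s₀) (4 * r), ‖F p (y, t)‖ ≤ 1
  zero_iff : ∀ p ∈ T, ∀ y ∈ V p, ∀ t ∈ ball (chartAt ℂ s₀ s₀) (4 * r),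
    F p (y, t) = 0 ↔ (coord p).symm y ∈ E ((chartAt ℂ s₀).symm t)
  cover : ∀ x, ∃ p ∈ T, x ∈ (coord p).source ∧ coord p x ∈ V p

lemma IsEllipticCurveFamily.exists_isPatching [CompactSpace X]
    (hE : IsEllipticCurveFamily E) (s₀ : S)
    {κ : X → ℂ × ℂ → ℂ} (hκ : ∀ p, ContinuousOn (κ p) (coord p).target) :
    ∃ (r : ℝ) (T : Finset X) (V : X → Set (ℂ × ℂ)) (F : X → (ℂ × ℂ) × ℂ → ℂ) (M : X → ℝ),
      IsPatching E s₀ r T V F ∧ ∀ p, ∀ y ∈ V p, ‖κ p y‖ ≤ M p := by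
  set e := chartAt ℂ s₀
  have hs₀ : s₀ ∈ e.source := mem_chart_source ℂ s₀
  have hloc : ∀ p : X, ∃ F : (ℂ × ℂ) × ℂ → ℂ, ∃ ε > 0, ball (e s₀) ε ⊆ e.target ∧
      ball (coord p p) ε ⊆ (coord p).target ∧
      (∀ y ∈ ball (coord p p) ε, ‖κ p y‖ ≤ ‖κ p (coord p p)‖ + 1) ∧
      ∀ q ∈ ball (coord p p) ε ×ˢ ball (e s₀) ε, AnalyticAt ℂ F q ∧ ‖F q‖ ≤ 1 ∧
        (F q = 0 ↔ (coord p).symm q.1 ∈ E (e.symm q.2)) := by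
    intro p
    obtain ⟨F, hF, hev⟩ := hE.graph_analytic.exists_analyticAt_coord s₀ s₀ p p hs₀
      (mem_coord_source p)
    set q₀ : (ℂ × ℂ) × ℂ := (coord p p, e s₀) with hq₀
    have hpt : coord p p ∈ (coord p).target := (coord p).map_source (mem_coord_source p)
    -- Rescaling the equation makes it bounded by `1`, as zero counting requires, without changing
    -- its zero set.
    set c : ℂ := ((‖F q₀‖ + 1 : ℝ) : ℂ)⁻¹ with hc
    have hpos : 0 < ‖F q₀‖ + 1 := by positivity
    have hc0 : c ≠ 0 := inv_ne_zero (by exact_mod_cast hpos.ne')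
    have hb : ∀ᶠ q in 𝓝 q₀, ‖F q‖ ≤ ‖F q₀‖ + 1 :=
      (hF.continuousAt.norm.eventually_lt continuousAt_const (by linarith)).mono fun _ h ↦ h.le
    have hk : ∀ᶠ y in 𝓝 (coord p p), ‖κ p y‖ ≤ ‖κ p (coord p p)‖ + 1 :=
      ((((hκ p).continuousAt ((coord p).open_target.mem_nhds hpt)).norm.eventually_lt
        continuousAt_const (by linarith)).mono fun _ h ↦ h.le)
    have h1 : ∀ᶠ q in 𝓝 q₀, q.2 ∈ e.target ∧ q.1 ∈ (coord p).target ∧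
        ‖κ p q.1‖ ≤ ‖κ p (coord p p)‖ + 1 :=
      (continuousAt_snd.eventually (e.open_target.eventually_mem (e.map_source hs₀))).and
        (((continuous_fst.tendsto q₀).eventually ((coord p).open_target.eventually_mem hpt)).and
          ((continuous_fst.tendsto q₀).eventually hk))
    obtain ⟨ε, hε, hball⟩ := Metric.eventually_nhds_iff_ball.1
      (h1.and (hF.eventually_analyticAt.and (hb.and hev)))
    rw [← ball_prod_same] at hball
    have hm1 : coord p p ∈ ball (coord p p) ε := mem_ball_self hε
    have hm2 : e s₀ ∈ ball (e s₀) ε := mem_ball_self hε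
    refine ⟨fun q ↦ c * F q, ε, hε, fun t ht ↦ (hball (_, t) ⟨hm1, ht⟩).1.1,
      fun y hy ↦ (hball (y, _) ⟨hy, hm2⟩).1.2.1, fun y hy ↦ (hball (y, _) ⟨hy, hm2⟩).1.2.2,
      fun q hq ↦ ?_⟩
    obtain ⟨-, h2, h3, h4⟩ := hball q hq
    refine ⟨analyticAt_const.mul h2, ?_, ?_⟩
    · rw [norm_mul, hc, norm_inv, Complex.norm_real, Real.norm_of_nonneg hpos.le,
        inv_mul_le_iff₀ hpos]
      simpa using h3
    · rw [mul_eq_zero, or_iff_right hc0, h4]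
      rfl
  choose F ε hε hεt hεc hεκ hFε using hloc
  obtain ⟨T, hT⟩ := isCompact_univ.elim_finite_subcover
    (fun p : X ↦ (coord p).source ∩ coord p ⁻¹' ball (coord p p) (ε p))
    (fun p ↦ (coord p).isOpen_inter_preimage isOpen_ball)
    fun x _ ↦ mem_iUnion.2 ⟨x, mem_coord_source x, mem_ball_self (hε x)⟩
  obtain ⟨ρ₀, hρ₀, hρ₀t⟩ := Metric.isOpen_iff.1 e.open_target _ (e.map_source hs₀)
  obtain ⟨ρ, hρ, hρε⟩ : ∃ ρ > 0, ∀ p ∈ T, ρ ≤ ε p := by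
    rcases T.eq_empty_or_nonempty with rfl | hne
    · exact ⟨1, one_pos, by simp⟩
    · exact ⟨T.inf' hne ε, (Finset.lt_inf'_iff hne).2 fun p _ ↦ hε p,
        fun p hp ↦ Finset.inf'_le _ hp⟩
  have h4 : 4 * (min ρ₀ ρ / 4) = min ρ₀ ρ := by ring
  have hsub : ∀ p ∈ T, ball (e s₀) (min ρ₀ ρ) ⊆ ball (e s₀) (ε p) := fun p hp ↦
    ball_subset_ball ((min_le_right _ _).trans (hρε p hp))
  refine ⟨min ρ₀ ρ / 4, T, fun p ↦ ball (coord p p) (ε p), F, fun p ↦ ‖κ p (coord p p)‖ + 1,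
    ⟨by positivity, ?_, fun p ↦ isOpen_ball, fun p ↦ isBounded_ball, hεc, ?_, ?_, ?_, ?_⟩, hεκ⟩
  · rw [h4]
    exact (ball_subset_ball (min_le_left _ _)).trans hρ₀t
  · rw [h4]
    exact fun p hp q hq ↦ (hFε p q ⟨hq.1, hsub p hp hq.2⟩).1
  · rw [h4]
    exact fun p hp y hy t ht ↦ (hFε p (y, t) ⟨hy, hsub p hp ht⟩).2.1
  · rw [h4]
    exact fun p hp y hy t ht ↦ (hFε p (y, t) ⟨hy, hsub p hp ht⟩).2.2
  · intro x
    obtain ⟨p, hp, h1, h2⟩ := mem_iUnion₂.1 (hT (mem_univ x))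
    exact ⟨p, hp, h1, h2⟩

/-- Countably many graph charts and analytic subsets adapted to a patching. -/
structure IsAdapted (E : S → Set X) (s₀ : S) (r : ℝ) (T : Finset X) (V : X → Set (ℂ × ℂ))
    (F : X → (ℂ × ℂ) × ℂ → ℂ) (Θ : X → ℕ → OpenPartialHomeomorph (ℂ × ℂ) (ℂ × ℂ))
    (ℓ : X → ℕ → ℂ × ℂ →L[ℂ] ℂ) (B : X → Set (Set (ℂ × ℂ) × (ℂ × ℂ → ℂ))) : Prop where
  isGraphChart : ∀ p ∈ T, ∀ j, IsGraphChart (F p) (V p) (ball (chartAt ℂ s₀ s₀) r) (Θ p j) (ℓ p j)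
  countable : ∀ p ∈ T, (B p).Countable
  proper : ∀ p ∈ T, ∀ b ∈ B p, IsOpen b.1 ∧ b.1 ⊆ V p ∧ AnalyticOnNhd ℂ b.2 b.1 ∧
    ∀ y ∈ b.1, ¬ ∀ᶠ y' in 𝓝 y, b.2 y' = 0
  cover : ∀ p ∈ T, ∀ y ∈ V p, ∀ t ∈ ball (chartAt ℂ s₀ s₀) r,
    (coord p).symm y ∈ E ((chartAt ℂ s₀).symm t) →
    (∀ s, (coord p).symm y ∈ E s) ∨ (∃ j, y ∈ (Θ p j).source ∧ (Θ p j y).1 = t) ∨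
      ∃ b ∈ B p, y ∈ b.1 ∧ b.2 y = 0

lemma IsPatching.exists_isAdapted [CompactSpace S] [PreconnectedSpace S]
    (hE : IsEllipticCurveFamily E) {s₀ : S} {r : ℝ} {T : Finset X} {V : X → Set (ℂ × ℂ)}
    {F : X → (ℂ × ℂ) × ℂ → ℂ} (hP : IsPatching E s₀ r T V F) :
    ∃ Θ ℓ B, IsAdapted E s₀ r T V F Θ ℓ B := by
  set e := chartAt ℂ s₀
  have hsub : ball (e s₀) r ⊆ ball (e s₀) (4 * r) := ball_subset_ball (by linarith [hP.pos])
  have hp : ∀ p : X, ∃ (Θ : ℕ → OpenPartialHomeomorph (ℂ × ℂ) (ℂ × ℂ)) (ℓ : ℕ → ℂ × ℂ →L[ℂ] ℂ)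
      (B : Set (Set (ℂ × ℂ) × (ℂ × ℂ → ℂ))), p ∈ T →
      (∀ j, IsGraphChart (F p) (V p) (ball (e s₀) r) (Θ j) (ℓ j)) ∧ B.Countable ∧
      (∀ b ∈ B, IsOpen b.1 ∧ b.1 ⊆ V p ∧ AnalyticOnNhd ℂ b.2 b.1 ∧
        ∀ y ∈ b.1, ¬ ∀ᶠ y' in 𝓝 y, b.2 y' = 0) ∧
      ∀ y ∈ V p, ∀ t ∈ ball (e s₀) r, (coord p).symm y ∈ E (e.symm t) →
        (∀ s, (coord p).symm y ∈ E s) ∨ (∃ j, y ∈ (Θ j).source ∧ (Θ j y).1 = t) ∨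
          ∃ b ∈ B, y ∈ b.1 ∧ b.2 y = 0 := by
    intro p
    by_cases hpT : p ∈ T
    swap
    · exact ⟨fun _ ↦ OpenPartialHomeomorph.refl _, fun _ ↦ 0, ∅, fun h ↦ absurd h hpT⟩
    -- Otherwise a member would have nonempty interior.
    have hne : ∀ t ∈ ball (e s₀) r, ∀ y ∈ V p, ¬ ∀ᶠ y' in 𝓝 y, F p (y', t) = 0 := by
      intro t ht y hy hev
      have hyt := hP.subset_target p hy
      have h1 : ∀ᶠ y' in 𝓝 y, (coord p).symm y' ∈ E (e.symm t) := by
        filter_upwards [hev, (hP.isOpen p).eventually_mem hy] with y' h2 h3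
        exact (hP.zero_iff p hpT y' h3 t (hsub ht)).1 h2
      have h2 : ∀ᶠ x in 𝓝 ((coord p).symm y), x ∈ E (e.symm t) := by
        have hsrc := (coord p).map_target hyt
        have hc := ((coord p).continuousAt hsrc)
        rw [ContinuousAt, (coord p).right_inv hyt] at hc
        filter_upwards [hc.eventually h1, (coord p).open_source.eventually_mem hsrc] with x h3 h4
        rwa [(coord p).left_inv h4] at h3
      have h3 := hE.interior_eq_empty (e.symm t)
      exact (h3 ▸ mem_interior_iff_mem_nhds.2 h2 : _ ∈ (∅ : Set X))
    obtain ⟨C, B, hC, hB, hCc, hBc, hcov⟩ := exists_countable_graph_cover (hP.isOpen p)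
      (isOpen_ball : IsOpen (ball (e s₀) r))
      ((hP.analytic p hpT).mono (prod_mono le_rfl hsub)) hne
    -- The empty chart is vacuously a graph chart; adding it lets the countable, possibly empty
    -- family of charts be enumerated by `ℕ`.
    set c₀ : OpenPartialHomeomorph (ℂ × ℂ) (ℂ × ℂ) × (ℂ × ℂ →L[ℂ] ℂ) :=
      (OpenPartialHomeomorph.ofSet ∅ isOpen_empty, 0)
    have hc₀ : IsGraphChart (F p) (V p) (ball (e s₀) r) c₀.1 c₀.2 :=
      ⟨empty_subset _, fun y hy ↦ hy.elim, fun y hy ↦ hy.elim, fun y hy ↦ hy.elim,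
        fun y hy ↦ hy.elim, fun y hy ↦ hy.elim⟩
    obtain ⟨c, hc⟩ := (hC.insert c₀).exists_eq_range (insert_nonempty _ _)
    refine ⟨fun j ↦ (c j).1, fun j ↦ (c j).2, B, fun _ ↦ ⟨fun j ↦ ?_, hB, hBc, ?_⟩⟩
    · have : c j ∈ insert c₀ C := hc ▸ mem_range_self j
      rcases this with h | h
      · simp only [h]; exact hc₀
      · exact hCc _ h
    · intro y hy t ht hmem
      -- If the equation vanishes identically in the parameter, the point lies on infinitely many
      -- members and is a base point.
      by_cases hev : ∀ᶠ t' in 𝓝 t, F p (y, t') = 0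
      · refine Or.inl ((hE.finite_or_forall_mem _).resolve_left fun hfin ↦ ?_)
        have h1 : (e.symm ⁻¹' {s | (coord p).symm y ∈ E s} ∩ e.target).Countable := by
          have : InjOn e.symm (e.symm ⁻¹' {s | (coord p).symm y ∈ E s} ∩ e.target) :=
            e.symm.injOn.mono inter_subset_right
          exact countable_of_injective_of_countable_image this
            (hfin.countable.mono (by rintro _ ⟨t', ht', rfl⟩; exact ht'.1))
        refine h1.not_mem_nhds t ?_
        filter_upwards [hev, isOpen_ball.mem_nhds (hsub ht)] with t' h2 h3
        exact ⟨(hP.zero_iff p hpT y hy t' h3).1 h2, hP.ball_subset h3⟩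
      · rcases hcov y hy t ht ((hP.zero_iff p hpT y hy t (hsub ht)).2 hmem) hev with
          ⟨d, hd, h⟩ | h
        · have : d ∈ range c := hc ▸ mem_insert_of_mem _ hd
          obtain ⟨j, rfl⟩ := this
          exact Or.inr (Or.inl ⟨j, h⟩)
        · exact Or.inr (Or.inr h)
  choose Θ ℓ B h using hp
  exact ⟨Θ, ℓ, B, fun p hp ↦ (h p hp).1, fun p hp ↦ (h p hp).2.1, fun p hp ↦ (h p hp).2.2.1,
    fun p hp ↦ (h p hp).2.2.2⟩

end Patches

/-! ### Two-forms, velocities and differentials in coordinates -/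

section FormCoordinates

open Metric Set Filter Topology

lemma LinearMap.wedge_apply_eq_det_mul (T : ℂ × ℂ →ₗ[ℂ] ℂ × ℂ) (v w : ℂ × ℂ) :
    (T v).1 * (T w).2 - (T v).2 * (T w).1 = LinearMap.det T * (v.1 * w.2 - v.2 * w.1) := by
  have h : ∀ v : ℂ × ℂ, T v = v.1 • T (1, 0) + v.2 • T (0, 1) := fun v ↦ by
    rw [← map_smul, ← map_smul, ← map_add]
    simp
  rw [h v, h w, ← LinearMap.det_toMatrix (Module.Basis.finTwoProd ℂ), Matrix.det_fin_two]
  simp [LinearMap.toMatrix_apply]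
  ring

lemma ContinuousAlternatingMap.apply_prod_eq {G : Type*} [NormedAddCommGroup G] [NormedSpace ℂ G]
    (A : G [⋀^Fin 2]→L[ℂ] ℂ) (D : ℂ × ℂ →L[ℂ] G) (a b : ℂ × ℂ) :
    A ![D a, D b] = A ![D (1, 0), D (0, 1)] * (a.1 * b.2 - a.2 * b.1) := by
  have h := congrArg (fun f ↦ f ![a, b])
    ((A.compContinuousLinearMap D).toAlternatingMap.eq_smul_basis_det (Module.Basis.finTwoProd ℂ))
  simp only [AlternatingMap.smul_apply, Module.Basis.det_apply, Matrix.det_fin_two,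
    Module.Basis.toMatrix_apply] at h
  have h1 : ∀ u v : ℂ × ℂ, (A.compContinuousLinearMap D).toAlternatingMap ![u, v] =
      A ![D u, D v] := fun u v ↦ by
    show A (D ∘ ![u, v]) = _
    congr 1
    ext i
    fin_cases i <;> rfl
  have h2 : (Module.Basis.finTwoProd ℂ : Fin 2 → ℂ × ℂ) = ![(1, 0), (0, 1)] := by
    ext i <;> fin_cases i <;> simp
  rw [h2, h1, h1] at h
  rw [h]
  simp [mul_comm]

variable {X : Type} [TopologicalSpace X] [ChartedSpace ComplexPlane X]

/-- The derivative of the inverse of the coordinates around `p` at the coordinates of `x`. -/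
noncomputable def coordFrame (p x : X) : ℂ × ℂ →L[ℂ] ComplexPlane :=
  mfderiv 𝓘(ℂ, ℂ × ℂ) 𝓘(ℂ, ComplexPlane) (coord p).symm (coord p x)

/-- The coefficient of a two-form in the coordinates around `p`. -/
noncomputable def TwoFormField.coeff (σ : TwoFormField X) (p : X) (y : ℂ × ℂ) : ℂ :=
  σ.inChart p (planeEquiv.symm y) ![planeEquiv.symm (1, 0), planeEquiv.symm (0, 1)]

/-- The derivative of a curve in a complex surface. -/
noncomputable def velocity (γ : ℂ → X) (z : ℂ) : ComplexPlane :=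
  mfderiv 𝓘(ℂ) 𝓘(ℂ, ComplexPlane) γ z (1 : ℂ)

/-- The differential of a function on a complex surface. -/
noncomputable def differential (g : X → ℂ) (x : X) : ComplexPlane →L[ℂ] ℂ :=
  mfderiv 𝓘(ℂ, ComplexPlane) 𝓘(ℂ) g x

/-- The value of a two-form at a point, as a form on the model space. -/
def TwoFormField.val (σ : TwoFormField X) (x : X) : ComplexPlane [⋀^Fin 2]→L[ℂ] ℂ := σ x

lemma TwoFormField.IsHolomorphic.analyticOnNhd_coeff {σ : TwoFormField X} (hσ : σ.IsHolomorphic)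
    (p : X) : AnalyticOnNhd ℂ (σ.coeff p) (coord p).target := by
  intro y hy
  have h1 : AnalyticAt ℂ (fun y ↦ σ.inChart p (planeEquiv.symm y)) y :=
    AnalyticAt.comp (g := σ.inChart p) (hσ p (planeEquiv.symm y) hy)
      ((planeEquiv.symm : ℂ × ℂ →L[ℂ] ComplexPlane).analyticAt y)
  exact ((ContinuousAlternatingMap.apply ℂ ComplexPlane ℂ
    ![planeEquiv.symm (1, 0), planeEquiv.symm (0, 1)]).analyticAt _).comp h1

variable [IsManifold 𝓘(ℂ, ComplexPlane) ω X]

lemma hasMFDerivAt_coord_symm {p x : X} (hx : x ∈ (coord p).source) :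
    HasMFDerivAt 𝓘(ℂ, ℂ × ℂ) 𝓘(ℂ, ComplexPlane) (coord p).symm (coord p x) (coordFrame p x) :=
  (((contMDiffOn_coord_symm p).contMDiffAt ((coord p).open_target.mem_nhds
    ((coord p).map_source hx))).mdifferentiableAt (by simp)).hasMFDerivAt

lemma val_apply_coordFrame (σ : TwoFormField X) {p x : X} (hx : x ∈ (coord p).source)
    (a b : ℂ × ℂ) :
    σ.val x ![coordFrame p x a, coordFrame p x b] =
      σ.coeff p (coord p x) * (a.1 * b.2 - a.2 * b.1) := by
  rw [(σ.val x).apply_prod_eq]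
  congr 1
  have hy : planeEquiv.symm (coord p x) ∈ (chartAt ComplexPlane p).target :=
    (coord p).map_source hx
  have h1 := ((contMDiffOn_chart_symm (I := 𝓘(ℂ, ComplexPlane)) (x := p) (n := ω)).contMDiffAt
    ((chartAt ComplexPlane p).open_target.mem_nhds hy)).mdifferentiableAt (by simp)
      |>.hasMFDerivAt
  have h2 := h1.comp (coord p x)
    (planeEquiv.symm : ℂ × ℂ →L[ℂ] ComplexPlane).hasMFDerivAt
  have h3 : coordFrame p x = _ := h2.mfderiv
  have h4 : (chartAt ComplexPlane p).symm (planeEquiv.symm (coord p x)) = x :=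
    (coord p).left_inv hx
  have h5 : ∀ u v : ComplexPlane, σ.inChart p (planeEquiv.symm (coord p x)) ![u, v] =
      σ.val ((chartAt ComplexPlane p).symm (planeEquiv.symm (coord p x)))
      ![mfderiv 𝓘(ℂ, ComplexPlane) 𝓘(ℂ, ComplexPlane) (chartAt ComplexPlane p).symm
        (planeEquiv.symm (coord p x)) u,
        mfderiv 𝓘(ℂ, ComplexPlane) 𝓘(ℂ, ComplexPlane) (chartAt ComplexPlane p).symm
        (planeEquiv.symm (coord p x)) v] := fun u v ↦ by
    rw [TwoFormField.inChart]
    refine congrArg (σ.val _) ?_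
    ext i : 1
    fin_cases i <;> rfl
  rw [TwoFormField.coeff, h5, h4, h3]
  rfl

lemma exists_coordFrame_eq {p x : X} (hx : x ∈ (coord p).source) (v : ComplexPlane) :
    ∃ a, coordFrame p x a = v := by
  have h1 := (((contMDiffOn_coord p).contMDiffAt ((coord p).open_source.mem_nhds
    hx)).mdifferentiableAt (by simp)).hasMFDerivAt
  have h2 := (hasMFDerivAt_coord_symm hx).comp x h1
  have h3 : HasMFDerivAt 𝓘(ℂ, ComplexPlane) 𝓘(ℂ, ComplexPlane) ((coord p).symm ∘ coord p) x
      (ContinuousLinearMap.id ℂ (TangentSpace 𝓘(ℂ, ComplexPlane) x)) := by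
    refine (hasMFDerivAt_id x).congr_of_eventuallyEq ?_
    filter_upwards [(coord p).open_source.mem_nhds hx] with x' hx' using (coord p).left_inv hx'
  have h4 := h2.mfderiv.symm.trans h3.mfderiv
  exact ⟨_, DFunLike.congr_fun h4 v⟩

lemma coeff_ne_zero {σ : TwoFormField X} {p x : X} (hx : x ∈ (coord p).source) (h : σ x ≠ 0) :
    σ.coeff p (coord p x) ≠ 0 := by
  intro h0
  refine h ?_
  have : σ.val x = 0 := by
    ext v
    obtain ⟨a, ha⟩ := exists_coordFrame_eq hx (v 0)
    obtain ⟨b, hb⟩ := exists_coordFrame_eq hx (v 1)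
    have hv : v = ![coordFrame p x a, coordFrame p x b] := by
      ext i : 1
      fin_cases i
      · exact ha.symm
      · exact hb.symm
    rw [hv, val_apply_coordFrame σ hx, h0]
    simp
  exact this

lemma velocity_eq {γ : ℂ → X} (hγ : ContMDiff 𝓘(ℂ) 𝓘(ℂ, ComplexPlane) ω γ) {p : X} {z : ℂ}
    (hz : γ z ∈ (coord p).source) :
    velocity γ z = coordFrame p (γ z) (deriv (fun z ↦ coord p (γ z)) z) := by
  have h1 := (analyticAt_coord_comp hγ hz).differentiableAt.hasFDerivAt.hasMFDerivAt
  have h2 := (hasMFDerivAt_coord_symm hz).comp z h1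
  have h3 : γ =ᶠ[𝓝 z] (coord p).symm ∘ fun z ↦ coord p (γ z) := by
    filter_upwards [hγ.continuous.continuousAt.eventually
      ((coord p).open_source.eventually_mem hz)] with z' hz' using ((coord p).left_inv hz').symm
  have h4 := (h2.congr_of_eventuallyEq h3).mfderiv
  exact DFunLike.congr_fun h4 (1 : ℂ)

lemma differential_coordFrame {p x : X} (hx : x ∈ (coord p).source) {h : ℂ × ℂ → ℂ}
    (hh : AnalyticAt ℂ h (coord p x)) (a : ℂ × ℂ) :
    differential (fun x ↦ h (coord p x)) x (coordFrame p x a) = fderiv ℂ h (coord p x) a := by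
  have h0 : MDifferentiableAt 𝓘(ℂ, ComplexPlane) 𝓘(ℂ) (fun x ↦ h (coord p x))
      ((coord p).symm (coord p x)) := by
    rw [(coord p).left_inv hx]
    exact (holAt_comp_coord hx hh).mdifferentiableAt (by simp)
  have h1 := h0.hasMFDerivAt.comp _ (hasMFDerivAt_coord_symm hx)
  have h2 : (fun x ↦ h (coord p x)) ∘ (coord p).symm =ᶠ[𝓝 (coord p x)] h := by
    filter_upwards [(coord p).open_target.mem_nhds ((coord p).map_source hx)] with y hy
    simp [(coord p).right_inv hy]
  have h3 := h2.mfderiv_eq (I := 𝓘(ℂ, ℂ × ℂ)) (I' := 𝓘(ℂ))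
  rw [h1.mfderiv, mfderiv_eq_fderiv] at h3
  have h4 : differential (fun x ↦ h (coord p x)) ((coord p).symm (coord p x)) (coordFrame p x a) =
    fderiv ℂ h (coord p x) a := DFunLike.congr_fun h3 a
  rwa [(coord p).left_inv hx] at h4

lemma fst_fderiv_deriv_eq_zero {γ : ℂ → X} (hγ : ContMDiff 𝓘(ℂ) 𝓘(ℂ, ComplexPlane) ω γ) {p : X}
    {z : ℂ} (hz : γ z ∈ (coord p).source) {Θ : ℂ × ℂ → ℂ × ℂ} (hΘ : AnalyticAt ℂ Θ (coord p (γ z)))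
    {t : ℂ} (ht : ∀ᶠ z' in 𝓝 z, (Θ (coord p (γ z'))).1 = t) :
    (fderiv ℂ Θ (coord p (γ z)) (deriv (fun z ↦ coord p (γ z)) z)).1 = 0 := by
  have hfst : HasFDerivAt (fun y ↦ (Θ y).1) ((ContinuousLinearMap.fst ℂ ℂ ℂ).comp
    (fderiv ℂ Θ (coord p (γ z)))) (coord p (γ z)) :=
    (ContinuousLinearMap.fst ℂ ℂ ℂ).hasFDerivAt.comp _
      hΘ.differentiableAt.hasFDerivAt
  have h1 := hfst.comp_hasDerivAt (f := fun z ↦ coord p (γ z)) z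
    (analyticAt_coord_comp hγ hz).differentiableAt.hasDerivAt
  exact h1.unique ((hasDerivAt_const z t).congr_of_eventuallyEq ht)

/-- The contraction of a two-form with the velocity of a curve in a level set of the first component
of a chart, in terms of the second component. -/
lemma val_apply_velocity (σ : TwoFormField X) {γ : ℂ → X}
    (hγ : ContMDiff 𝓘(ℂ) 𝓘(ℂ, ComplexPlane) ω γ) {p : X} {z : ℂ} (hz : γ z ∈ (coord p).source)
    {Θ : ℂ × ℂ → ℂ × ℂ} (hΘ : AnalyticAt ℂ Θ (coord p (γ z)))
    (hdet : LinearMap.det (fderiv ℂ Θ (coord p (γ z)) : ℂ × ℂ →ₗ[ℂ] ℂ × ℂ) ≠ 0) {t : ℂ}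
    (ht : ∀ᶠ z' in 𝓝 z, (Θ (coord p (γ z'))).1 = t) (v : ComplexPlane) :
    σ.val (γ z) ![v, velocity γ z] =
      σ.coeff p (coord p (γ z)) *
        (fderiv ℂ Θ (coord p (γ z)) (deriv (fun z ↦ coord p (γ z)) z)).2 /
        LinearMap.det (fderiv ℂ Θ (coord p (γ z)) : ℂ × ℂ →ₗ[ℂ] ℂ × ℂ) *
        differential (fun x ↦ (Θ (coord p x)).1) (γ z) v := by
  obtain ⟨a, rfl⟩ := exists_coordFrame_eq hz v
  set T := fderiv ℂ Θ (coord p (γ z)) with hT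
  set n' := deriv (fun z ↦ coord p (γ z)) z with hn'
  have hfst : HasFDerivAt (fun y ↦ (Θ y).1) ((ContinuousLinearMap.fst ℂ ℂ ℂ).comp T)
    (coord p (γ z)) := (ContinuousLinearMap.fst ℂ ℂ ℂ).hasFDerivAt.comp _
      hΘ.differentiableAt.hasFDerivAt
  have hfa : AnalyticAt ℂ (fun y ↦ (Θ y).1) (coord p (γ z)) :=
    ((ContinuousLinearMap.fst ℂ ℂ ℂ).analyticAt _).comp hΘ
  have h0 : (T n').1 = 0 := fst_fderiv_deriv_eq_zero hγ hz hΘ ht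
  rw [velocity_eq hγ hz, val_apply_coordFrame σ hz, differential_coordFrame hz hfa, hfst.fderiv]
  -- The derivative of `Θ` scales the area form by its determinant. Since `T n'` has first component
  -- `0`, the area of `T a` and `T n'` is the product `(T a).1 * (T n').2`.
  have h3 := LinearMap.wedge_apply_eq_det_mul (T : ℂ × ℂ →ₗ[ℂ] ℂ × ℂ) a n'
  simp only [ContinuousLinearMap.coe_coe, h0, mul_zero, sub_zero] at h3
  rw [ContinuousLinearMap.comp_apply, ContinuousLinearMap.coe_fst']
  field_simp
  linear_combination (-σ.coeff p (coord p (γ z))) * h3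

lemma exists_differential_ne_zero {p x : X} (hx : x ∈ (coord p).source)
    {Θ : ℂ × ℂ → ℂ × ℂ} (hΘ : AnalyticAt ℂ Θ (coord p x))
    (hdet : LinearMap.det (fderiv ℂ Θ (coord p x) : ℂ × ℂ →ₗ[ℂ] ℂ × ℂ) ≠ 0) :
    ∃ v, differential (fun x ↦ (Θ (coord p x)).1) x v ≠ 0 := by
  have hfst : HasFDerivAt (fun y ↦ (Θ y).1) ((ContinuousLinearMap.fst ℂ ℂ ℂ).comp
    (fderiv ℂ Θ (coord p x))) (coord p x) := (ContinuousLinearMap.fst ℂ ℂ ℂ).hasFDerivAt.comp _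
      hΘ.differentiableAt.hasFDerivAt
  have hfa : AnalyticAt ℂ (fun y ↦ (Θ y).1) (coord p x) :=
    ((ContinuousLinearMap.fst ℂ ℂ ℂ).analyticAt _).comp hΘ
  obtain ⟨a, ha⟩ := (LinearMap.equivOfDetNeZero _ hdet).surjective (1, 0)
  refine ⟨coordFrame p x a, ?_⟩
  rw [differential_coordFrame hx hfa, hfst.fderiv]
  have h1 : fderiv ℂ Θ (coord p x) a = (1, 0) := ha
  simp [h1]

end FormCoordinates

/-! ### The weight on the surface and its restriction to curves -/

section Weights

open Metric Set Filter Topology MeasureTheory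

/-- The exponent `2` is smaller than the real dimension `4`. -/
lemma lintegral_ball_inv_sq_lt_top (c : ℂ × ℂ) (R : ℝ) :
    ∫⁻ y in ball c R, ENNReal.ofReal ((‖y - c‖ ^ 2)⁻¹) < ⊤ := by
  have : (volume : Measure (ℂ × ℂ)).IsAddHaarMeasure := Measure.prod.instIsAddHaarMeasure _ _
  have htr : ∫⁻ y in ball c R, ENNReal.ofReal ((‖y - c‖ ^ 2)⁻¹) =
      ∫⁻ y in ball (0 : ℂ × ℂ) R, ENNReal.ofReal ((‖y‖ ^ 2)⁻¹) := by
    rw [← lintegral_indicator measurableSet_ball, ← lintegral_indicator measurableSet_ball,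
      ← lintegral_sub_right_eq_self ((ball (0 : ℂ × ℂ) R).indicator _) c]
    congr 1 with y
    simp [indicator, dist_eq_norm]
  rw [htr]
  have hrank : Module.finrank ℝ (ℂ × ℂ) = 4 := by
    rw [Module.finrank_prod, Complex.finrank_real_complex]
  have hmeas : Measurable fun y : ℂ × ℂ ↦ (‖y‖ ^ 2)⁻¹ := (measurable_norm.pow_const 2).inv
  have h := integrableOn_ball_of_norm_le_rpow (μ := (volume : Measure (ℂ × ℂ)))
    (f := fun y : ℂ × ℂ ↦ (‖y‖ ^ 2)⁻¹) (C := 1) (α := 2) (r := R) (by rw [hrank]; norm_num)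
    (by rw [hrank]; norm_num) (ae_of_all _ fun y ↦ by
      rw [one_mul, Real.norm_of_nonneg (by positivity), Real.rpow_neg (norm_nonneg _)]
      norm_cast) hmeas.aestronglyMeasurable
  refine lt_of_eq_of_lt (lintegral_congr fun y ↦ ?_) h.2
  rw [Real.enorm_of_nonneg (by positivity)]

/-- The logarithmic factor pays for the number of sheets, which leaves twice the integral of `‖y -
c‖⁻²` over a bounded set. -/
lemma exists_weight {F : (ℂ × ℂ) × ℂ → ℂ} {V : Set (ℂ × ℂ)} {s₀ : ℂ} {r : ℝ} (hr : 0 < r)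
    (hV : IsOpen V) (hVb : Bornology.IsBounded V)
    (hF : AnalyticOnNhd ℂ F (V ×ˢ ball s₀ (4 * r)))
    (hF1 : ∀ y ∈ V, ∀ s ∈ ball s₀ (4 * r), ‖F (y, s)‖ ≤ 1)
    {Θ : ℕ → OpenPartialHomeomorph (ℂ × ℂ) (ℂ × ℂ)} {ℓ : ℕ → ℂ × ℂ →L[ℂ] ℂ}
    (hΘ : ∀ j, IsGraphChart F V (ball s₀ r) (Θ j) (ℓ j)) (c : ℂ × ℂ) :
    ∃ W : ℂ × ℂ → ENNReal,
      (∀ y ∈ V, F (y, s₀) ≠ 0 →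
        W y = ENNReal.ofReal (logWeight ‖F (y, s₀)‖ * (‖y - c‖ ^ 2)⁻¹)) ∧
      ∀ᵐ s : ℂ, ∑' j, ∫⁻ t, sheetDensity Θ W j (s, t) < ⊤ := by
  classical
  have hs₀ : s₀ ∈ ball s₀ (4 * r) := mem_ball_self (by positivity)
  -- Extension by zero makes the weight measurable on the whole plane; where `a` vanishes, the
  -- weight is set to `0`.
  set a : ℂ × ℂ → ℂ := V.piecewise (fun y ↦ F (y, s₀)) 0 with ha
  have haV : ∀ y ∈ V, a y = F (y, s₀) := fun y hy ↦ piecewise_eq_of_mem _ _ _ hy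
  have ham : Measurable a := by
    refine ContinuousOn.measurable_piecewise (fun y hy ↦ ?_) continuousOn_const hV.measurableSet
    exact ((hF (y, s₀) ⟨hy, hs₀⟩).continuousAt.comp (f := fun y : ℂ × ℂ ↦ (y, s₀))
      (by fun_prop)).continuousWithinAt
  have hq : Measurable fun y : ℂ × ℂ ↦ ENNReal.ofReal ((‖y - c‖ ^ 2)⁻¹) :=
    (((measurable_id.sub_const c).norm.pow_const 2).inv).ennreal_ofReal
  have hlw : Measurable fun y ↦ ENNReal.ofReal (logWeight ‖a y‖) :=
    (measurable_logWeight.comp ham.norm).ennreal_ofReal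
  set W : ℂ × ℂ → ENNReal := {y | a y ≠ 0}.indicator
    (fun y ↦ ENNReal.ofReal (logWeight ‖a y‖) * ENNReal.ofReal ((‖y - c‖ ^ 2)⁻¹)) with hW
  have hWm : Measurable W :=
    (hlw.mul hq).indicator (ham (measurableSet_singleton (0 : ℂ)).compl)
  refine ⟨W, fun y hy hy0 ↦ ?_, ?_⟩
  · rw [hW, indicator_of_mem (by rwa [mem_ofPred_eq, haV y hy]), haV y hy, ENNReal.ofReal_mul]
    exact (logWeight_pos (norm_nonneg _) (hF1 y hy s₀ hs₀)).le
  · refine ae_tsum_lintegral_sheetDensity_lt_top hWm (fun j ↦ (hΘ j).analytic)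
      (fun j ↦ (hΘ j).det_ne_zero) ?_
    refine (tsum_lintegral_newSheet_le hr hV.measurableSet (fun y hy s hs ↦ ?_) hF1 hΘ hq hWm
      (fun y hy ↦ ?_)).trans_lt ?_
    · exact ((hF (y, s) ⟨hy, hs⟩).differentiableAt.comp (f := fun s : ℂ ↦ (y, s)) s
        (by fun_prop)).differentiableWithinAt
    · simp only [hW, indicator, mem_ofPred_eq, haV y hy]
      exact le_rfl
    · obtain ⟨R, hR⟩ := hVb.subset_ball c
      refine ENNReal.mul_lt_top (by simp) ((lintegral_mono_set hR).trans_lt ?_)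
      exact lintegral_ball_inv_sq_lt_top c R

/-- The logarithmic weight of an analytic function is bounded below by that of the distance. -/
lemma AnalyticAt.exists_mul_logWeight_le {a : ℂ → ℂ} {z₀ : ℂ} (ha : AnalyticAt ℂ a z₀)
    (hne : ¬ ∀ᶠ z in 𝓝 z₀, a z = 0) :
    ∃ c > 0, ∀ᶠ z in 𝓝[≠] z₀, a z ≠ 0 ∧
      (‖a z‖ ≤ 1 → c * logWeight ‖z - z₀‖ ≤ logWeight ‖a z‖) := by
  obtain ⟨k, h, hh, hh0, hev⟩ := ha.exists_eventuallyEq_pow_smul_nonzero_iff.2 hne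
  set m := ‖h z₀‖ / 2 with hm
  have hmpos : 0 < m := by positivity
  have h1 : ∀ᶠ z in 𝓝 z₀, m ≤ ‖h z‖ :=
    (hh.continuousAt.norm.eventually_const_lt (by rw [hm]; linarith [norm_pos_iff.2 hh0])).mono
      fun _ h ↦ h.le
  have h2 : ∀ᶠ z in 𝓝 z₀, ‖z - z₀‖ < 1 := by
    filter_upwards [ball_mem_nhds z₀ one_pos] with z hz
    rwa [← dist_eq_norm]
  -- From `‖a z‖ ≥ m ‖z - z₀‖ ^ k` follows `1 - log ‖a z‖ ≤ 1 - k log ‖z - z₀‖ + |log m| ≤ C (1 -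
  -- log ‖z - z₀‖)`.
  set C : ℝ := 1 + k + |Real.log m| with hC
  have hCpos : 0 < C := by positivity
  refine ⟨C⁻¹, inv_pos.2 hCpos, ?_⟩
  filter_upwards [nhdsWithin_le_nhds h1, nhdsWithin_le_nhds h2, nhdsWithin_le_nhds hev,
    self_mem_nhdsWithin] with z hz1 hz2 hz3 hz4
  have hρ : 0 < ‖z - z₀‖ := norm_pos_iff.2 (sub_ne_zero.2 hz4)
  have hlow : ‖z - z₀‖ ^ k * m ≤ ‖a z‖ := by
    rw [hz3, norm_smul, norm_pow]
    gcongr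
  have hapos : 0 < ‖a z‖ := lt_of_lt_of_le (by positivity) hlow
  refine ⟨norm_pos_iff.1 hapos, fun hle ↦ ?_⟩
  have hl1 := Real.log_le_log (by positivity) hlow
  rw [Real.log_mul (by positivity) hmpos.ne', Real.log_pow] at hl1
  have hl2 : Real.log ‖z - z₀‖ < 0 := Real.log_neg hρ hz2
  have hl3 : Real.log ‖a z‖ ≤ 0 := Real.log_nonpos hapos.le hle
  have hl4 := neg_abs_le (Real.log m)
  have hl5 := abs_nonneg (Real.log m)
  have hk : (0 : ℝ) ≤ k := Nat.cast_nonneg k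
  rw [logWeight, logWeight, ← mul_inv]
  refine inv_anti₀ (by linarith) ?_
  rw [hC]
  nlinarith

/-- The logarithmic factor is handled by the finite order of vanishing of `F (n z, s₀)`. The factor
`‖n z - c‖⁻²` is bounded below because `V` is bounded; if `n z₀ = c`, then `n z - c = O(z - z₀)`
gives `‖z - z₀‖⁻²`. -/
lemma exists_le_weight {F : (ℂ × ℂ) × ℂ → ℂ} {V : Set (ℂ × ℂ)} {s₀ : ℂ} (hV : IsOpen V)
    (hVb : Bornology.IsBounded V) (hF : ∀ y ∈ V, AnalyticAt ℂ F (y, s₀))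
    (hF1 : ∀ y ∈ V, ‖F (y, s₀)‖ ≤ 1) {c : ℂ × ℂ} {W : ℂ × ℂ → ENNReal}
    (hW : ∀ y ∈ V, F (y, s₀) ≠ 0 →
      W y = ENNReal.ofReal (logWeight ‖F (y, s₀)‖ * (‖y - c‖ ^ 2)⁻¹))
    {n : ℂ → ℂ × ℂ} {z₀ : ℂ} (hn : AnalyticAt ℂ n z₀) (hnV : n z₀ ∈ V)
    (hF0 : ¬ ∀ᶠ z in 𝓝 z₀, F (n z, s₀) = 0) (hnc : ¬ ∀ᶠ z in 𝓝 z₀, n z = c) :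
    (∃ m > 0, ∀ᶠ z in 𝓝[≠] z₀, ENNReal.ofReal (m * logWeight ‖z - z₀‖) ≤ W (n z)) ∧
    (n z₀ = c → ∃ m > 0, ∀ᶠ z in 𝓝[≠] z₀,
      ENNReal.ofReal (m * ((‖z - z₀‖ ^ 2)⁻¹ * logWeight ‖z - z₀‖)) ≤ W (n z)) := by
  obtain ⟨m, hm, hev⟩ := AnalyticAt.exists_mul_logWeight_le
    ((hF _ hnV).comp_of_eq (f := fun z ↦ (n z, s₀)) (hn.prod analyticAt_const) rfl) hF0
  have hnV' : ∀ᶠ z in 𝓝[≠] z₀, n z ∈ V :=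
    nhdsWithin_le_nhds (hn.continuousAt.eventually (hV.eventually_mem hnV))
  have hnc' : ∀ᶠ z in 𝓝[≠] z₀, n z - c ≠ 0 := by
    refine (hn.sub analyticAt_const).eventually_eq_zero_or_eventually_ne_zero.resolve_left ?_
    simpa [sub_eq_zero] using hnc
  have h1 : ∀ᶠ z in 𝓝[≠] z₀, ‖z - z₀‖ ≤ 1 := by
    filter_upwards [nhdsWithin_le_nhds (closedBall_mem_nhds z₀ one_pos)] with z hz
    rwa [← dist_eq_norm]
  have key : ∀ R > 0, ∀ z, n z ∈ V → n z - c ≠ 0 → ‖z - z₀‖ ≤ 1 → F (n z, s₀) ≠ 0 →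
      (‖F (n z, s₀)‖ ≤ 1 → m * logWeight ‖z - z₀‖ ≤ logWeight ‖F (n z, s₀)‖) →
      ‖n z - c‖ ≤ R → ENNReal.ofReal (m * (R ^ 2)⁻¹ * logWeight ‖z - z₀‖) ≤ W (n z) := by
    intro R hR z hzV hzc hz1 hz0 hle hzR
    rw [hW _ hzV hz0]
    refine ENNReal.ofReal_le_ofReal ?_
    have hpos := logWeight_pos (norm_nonneg (z - z₀)) hz1
    have hcpos := norm_pos_iff.2 hzc
    calc m * (R ^ 2)⁻¹ * logWeight ‖z - z₀‖ = m * logWeight ‖z - z₀‖ * (R ^ 2)⁻¹ := by ring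
      _ ≤ _ := mul_le_mul (hle (hF1 _ hzV)) (inv_anti₀ (by positivity) (by gcongr))
        (by positivity) ((mul_pos hm hpos).le.trans (hle (hF1 _ hzV)))
  constructor
  · obtain ⟨R, hR0, hR⟩ := hVb.subset_ball_lt 0 c
    refine ⟨m * (R ^ 2)⁻¹, by positivity, ?_⟩
    filter_upwards [hev, hnV', hnc', h1] with z h2 h3 h4 h5
    refine key R hR0 z h3 h4 h5 h2.1 h2.2 ?_
    rw [← dist_eq_norm]
    exact (hR h3).le
  · intro hc
    obtain ⟨C, hC0, hC⟩ := hn.differentiableAt.isBigO_sub.exists_pos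
    have hC' := hC.bound
    rw [hc] at hC'
    refine ⟨m * (C ^ 2)⁻¹, by positivity, ?_⟩
    filter_upwards [hev, hnV', hnc', h1, nhdsWithin_le_nhds hC', self_mem_nhdsWithin]
      with z h2 h3 h4 h5 h6 h7
    have hρ : 0 < ‖z - z₀‖ := norm_pos_iff.2 (sub_ne_zero.2 h7)
    have := key (C * ‖z - z₀‖) (by positivity) z h3 h4 h5 h2.1 h2.2 h6
    rw [mul_pow, mul_inv] at this
    simpa only [mul_assoc] using this

/-- Liouville: all values are attained on a compact fundamental domain. -/
lemma Differentiable.exists_eq_const_of_lattice_periodic {g : ℂ → ℂ} (hg : Differentiable ℂ g)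
    {L : PeriodPair} (h : ∀ z, ∀ l ∈ L.lattice, g (z + l) = g z) : ∃ c, ∀ z, g z = c := by
  refine ⟨g 0, fun z ↦ hg.apply_eq_apply_of_bounded ?_ z 0⟩
  have hb := (ZSpan.fundamentalDomain_isBounded L.basis).closure
  have hc : IsCompact (closure (ZSpan.fundamentalDomain L.basis)) :=
    Metric.isCompact_of_isClosed_isBounded isClosed_closure hb
  refine (hc.image hg.continuous).isBounded.subset ?_
  rintro _ ⟨z, rfl⟩
  refine ⟨ZSpan.fract L.basis z, subset_closure (ZSpan.fract_mem_fundamentalDomain _ z), ?_⟩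
  have h1 : (ZSpan.floor L.basis z : ℂ) ∈ L.lattice := by
    rw [L.lattice_eq_span_range_basis]
    exact (ZSpan.floor L.basis z).2
  rw [← h _ _ h1, ZSpan.fract_apply, sub_add_cancel]

end Weights

/-! ### Members in general position -/

section GenericMembers

open Metric Set Filter Topology MeasureTheory

variable {X : Type} [TopologicalSpace X] [ChartedSpace ComplexPlane X]

/-- The first component of a chart as a function on the surface. -/
noncomputable def sheetFun (Θ : X → ℕ → OpenPartialHomeomorph (ℂ × ℂ) (ℂ × ℂ)) (p : X) (j : ℕ)
    (x : X) : ℂ :=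
  (Θ p j (coord p x)).1

/-- The domain of a chart as a subset of the surface. -/
def sheetSet (Θ : X → ℕ → OpenPartialHomeomorph (ℂ × ℂ) (ℂ × ℂ)) (p : X) (j : ℕ) : Set X :=
  (coord p).source ∩ coord p ⁻¹' (Θ p j).source

lemma isOpen_sheetSet (Θ : X → ℕ → OpenPartialHomeomorph (ℂ × ℂ) (ℂ × ℂ)) (p : X) (j : ℕ) :
    IsOpen (sheetSet Θ p j) :=
  (coord p).isOpen_inter_preimage (Θ p j).open_source

variable [IsManifold 𝓘(ℂ, ComplexPlane) ω X]
  {S : Type*} [TopologicalSpace S] [ChartedSpace ℂ S]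
  {E : S → Set X} {s₀ : S} {r : ℝ} {T : Finset X} {V : X → Set (ℂ × ℂ)}
  {F : X → (ℂ × ℂ) × ℂ → ℂ} {Θ : X → ℕ → OpenPartialHomeomorph (ℂ × ℂ) (ℂ × ℂ)}
  {ℓ : X → ℕ → ℂ × ℂ →L[ℂ] ℂ} {B : X → Set (Set (ℂ × ℂ) × (ℂ × ℂ → ℂ))}

lemma IsAdapted.holAt_sheetFun (hA : IsAdapted E s₀ r T V F Θ ℓ B) {p : X} (hp : p ∈ T) {j : ℕ}
    {x : X} (hx : x ∈ sheetSet Θ p j) : HolAt (sheetFun Θ p j) x :=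
  holAt_comp_coord (h := fun y ↦ (Θ p j y).1) hx.1 <|
    ((ContinuousLinearMap.fst ℂ ℂ ℂ).analyticAt _).comp
      ((hA.isGraphChart p hp j).analytic _ hx.2)

/-- A parametrized member of the family in general position with respect to given charts and
analytic subsets. -/
structure IsGenericMember (E : S → Set X) (s₀ : S) (r : ℝ) (T : Finset X)
    (Θ : X → ℕ → OpenPartialHomeomorph (ℂ × ℂ) (ℂ × ℂ))
    (B : X → Set (Set (ℂ × ℂ) × (ℂ × ℂ → ℂ))) (t : ℂ) (L : PeriodPair) (γ : ℂ → X) (K : Set ℂ) :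
    Prop where
  mem_ball : t ∈ ball (chartAt ℂ s₀ s₀) r
  param : IsTorusParam L γ (E ((chartAt ℂ s₀).symm t)) K
  elliptic : IsEllipticCurveIn (E ((chartAt ℂ s₀).symm t))
  not_subset : ¬ range γ ⊆ E s₀
  proper : ∀ p ∈ T, ∀ b ∈ B p, ∀ z, γ z ∈ (coord p).source → coord p (γ z) ∈ b.1 →
    ¬ ∀ᶠ z' in 𝓝 z, b.2 (coord p (γ z')) = 0
  coherent : ∀ p ∈ T, ∀ q ∈ T, ∀ j k z, γ z ∈ sheetSet Θ p j → γ z ∈ sheetSet Θ q k →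
    (∀ᶠ z' in 𝓝 z, sheetFun Θ p j (γ z') = t) → (∀ᶠ z' in 𝓝 z, sheetFun Θ q k (γ z') = t) →
    sheetFun Θ p j =ᶠ[𝓝 (γ z)] sheetFun Θ q k

/-- Each requirement fails for countably many parameters only, a null set in the disc, so it is
compatible with any property of almost every `t`. Coherence comes from applying the
exceptional-parameter lemma to differences of sheet functions. -/
lemma IsAdapted.exists_isGenericMember [IsManifold 𝓘(ℂ) ω S] [CompactSpace X] [CompactSpace S]
    [PreconnectedSpace S] (hE : IsEllipticCurveFamily E) (hs₀ : IsEllipticCurveIn (E s₀))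
    (hP : IsPatching E s₀ r T V F) (hA : IsAdapted E s₀ r T V F Θ ℓ B) {P : ℂ → Prop}
    (hPae : ∀ᵐ t, P t) :
    ∃ t L γ K, P t ∧ IsGenericMember E s₀ r T Θ B t L γ K := by
  set e := chartAt ℂ s₀
  have h1 : ∀ (p : X) (b : Set (ℂ × ℂ) × (ℂ × ℂ → ℂ)), ∃ bad : Set S, p ∈ T → b ∈ B p →
      bad.Countable ∧ ∀ s ∉ bad, IsEllipticCurveIn (E s) → ∀ L γ K, IsTorusParam L γ (E s) K →
        ∀ z, γ z ∈ (coord p).source → coord p (γ z) ∈ b.1 →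
          ¬ ∀ᶠ z' in 𝓝 z, b.2 (coord p (γ z')) = 0 := by
    intro p b
    by_cases hpb : p ∈ T ∧ b ∈ B p
    swap
    · exact ⟨∅, fun h h' ↦ absurd ⟨h, h'⟩ hpb⟩
    obtain ⟨ho, -, hb, hne⟩ := hA.proper p hpb.1 b hpb.2
    obtain ⟨bad, hbad, h⟩ := hE.exists_countable_exceptional
      ((coord p).isOpen_inter_preimage ho) (Δ := fun x ↦ b.2 (coord p x))
      fun x hx ↦ holAt_comp_coord hx.1 (hb _ hx.2)
    refine ⟨bad, fun _ _ ↦ ⟨hbad, fun s hs hell L γ K hγ z hz hzb hzero ↦ ?_⟩⟩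
    refine hne _ hzb ?_
    have h2 := h s hs hell L γ K hγ z ⟨hz, hzb⟩ hzero
    have hc := (coord p).symm.continuousAt ((coord p).map_source hz)
    rw [ContinuousAt, (coord p).left_inv hz] at hc
    filter_upwards [hc.eventually h2,
      (coord p).open_target.eventually_mem ((coord p).map_source hz)] with y h3 h4
    rwa [(coord p).right_inv h4] at h3
  have h2 : ∀ (p q : X) (j k : ℕ), ∃ bad : Set S, p ∈ T → q ∈ T →
      bad.Countable ∧ ∀ s ∉ bad, IsEllipticCurveIn (E s) → ∀ L γ K, IsTorusParam L γ (E s) K →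
        ∀ z, γ z ∈ sheetSet Θ p j → γ z ∈ sheetSet Θ q k →
          (∀ᶠ z' in 𝓝 z, sheetFun Θ p j (γ z') = sheetFun Θ q k (γ z')) →
          sheetFun Θ p j =ᶠ[𝓝 (γ z)] sheetFun Θ q k := by
    intro p q j k
    by_cases hpq : p ∈ T ∧ q ∈ T
    swap
    · exact ⟨∅, fun h h' ↦ absurd ⟨h, h'⟩ hpq⟩
    obtain ⟨bad, hbad, h⟩ := hE.exists_countable_exceptional
      ((isOpen_sheetSet Θ p j).inter (isOpen_sheetSet Θ q k))
      (Δ := fun x ↦ sheetFun Θ p j x - sheetFun Θ q k x)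
      fun x hx ↦ ContMDiffAt.sub (hA.holAt_sheetFun hpq.1 hx.1) (hA.holAt_sheetFun hpq.2 hx.2)
    refine ⟨bad, fun _ _ ↦ ⟨hbad, fun s hs hell L γ K hγ z hz hz' hzero ↦ ?_⟩⟩
    exact (h s hs hell L γ K hγ z ⟨hz, hz'⟩ (hzero.mono fun _ h ↦ sub_eq_zero.2 h)).mono
      fun _ h ↦ sub_eq_zero.1 h
  choose bad₁ h1 using h1
  choose bad₂ h2 using h2
  set bad : Set S := {s | ¬ IsEllipticCurveIn (E s)} ∪ {s | IsEllipticCurveIn (E s) ∧ E s ⊆ E s₀} ∪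
    (⋃ p ∈ T, ⋃ b ∈ B p, bad₁ p b) ∪ ⋃ p ∈ T, ⋃ q ∈ T, ⋃ j, ⋃ k, bad₂ p q j k with hbad
  have hbadc : bad.Countable := by
    refine ((Countable.union ?_ (hE.finite_subset_member hs₀).countable).union ?_).union ?_
    · exact (Filter.eventually_cofinite.1 hE.general_elliptic).countable
    · exact T.countable_toSet.biUnion fun p hp ↦ (hA.countable p hp).biUnion fun b hb ↦
        (h1 p b hp hb).1
    · exact T.countable_toSet.biUnion fun p hp ↦ T.countable_toSet.biUnion fun q hq ↦
        countable_iUnion fun j ↦ countable_iUnion fun k ↦ (h2 p q j k hp hq).1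
  have hbadc' : (e.symm ⁻¹' bad ∩ e.target).Countable :=
    countable_of_injective_of_countable_image (e.symm.injOn.mono inter_subset_right)
      (hbadc.mono (by rintro _ ⟨t', ht', rfl⟩; exact ht'.1))
  have hae : ∀ᵐ t : ℂ, t ∉ e.symm ⁻¹' bad ∩ e.target := measure_eq_zero_iff_ae_notMem.1
    (hbadc'.measure_zero volume)
  obtain ⟨t, ⟨htbad, htP⟩, ht⟩ := (Measure.dense_of_ae (hae.and hPae)).exists_mem_open
    (isOpen_ball (x := e s₀) (ε := r)) ⟨_, mem_ball_self hP.pos⟩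
  have htt : t ∈ e.target := hP.ball_subset (ball_subset_ball (by linarith [hP.pos]) ht)
  have hs : e.symm t ∉ bad := fun h ↦ htbad ⟨h, htt⟩
  simp only [hbad, mem_union, mem_iUnion, not_or, not_exists] at hs
  obtain ⟨⟨⟨hs1, hs2⟩, hs3⟩, hs4⟩ := hs
  have hell : IsEllipticCurveIn (E (e.symm t)) := not_not.1 hs1
  obtain ⟨L, γ, K, hγ⟩ := hell.exists_isTorusParam
  refine ⟨t, L, γ, K, htP, ht, hγ, hell, ?_, ?_, ?_⟩
  · rw [hγ.range_eq]
    exact fun h ↦ hs2 ⟨hell, h⟩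
  · exact fun p hp b hb ↦ (h1 p b hp hb).2 _ (hs3 p hp b hb) hell L γ K hγ
  · intro p hp q hq j k z hz hz' ht1 ht2
    refine (h2 p q j k hp hq).2 _ (hs4 p hp q hq j k) hell L γ K hγ z hz hz' ?_
    filter_upwards [ht1, ht2] with z' h3 h4 using h3.trans h4.symm

end GenericMembers

/-! ### The coefficient of the form along a generic member -/

section Coefficient

open Metric Set Filter Topology MeasureTheory

variable {X : Type} [TopologicalSpace X] [ChartedSpace ComplexPlane X]

/-- The coefficient of a two-form, divided by the differential of the parameter, along a curve in a
level set of the first component of a chart. -/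
noncomputable def sheetCoeff (σ : TwoFormField X)
    (Θ : X → ℕ → OpenPartialHomeomorph (ℂ × ℂ) (ℂ × ℂ)) (γ : ℂ → X) (p : X) (j : ℕ) (z : ℂ) : ℂ :=
  σ.coeff p (coord p (γ z)) *
    (fderiv ℂ (Θ p j) (coord p (γ z)) (deriv (fun z ↦ coord p (γ z)) z)).2 /
    LinearMap.det (fderiv ℂ (Θ p j) (coord p (γ z)) : ℂ × ℂ →ₗ[ℂ] ℂ × ℂ)

/-- Near `z`, the curve `γ` lies in the level set of value `t` of the first component of a chart. -/
structure IsSheetAt (T : Finset X) (Θ : X → ℕ → OpenPartialHomeomorph (ℂ × ℂ) (ℂ × ℂ)) (t : ℂ)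
    (γ : ℂ → X) (p : X) (j : ℕ) (z : ℂ) : Prop where
  mem : p ∈ T
  mem_sheetSet : γ z ∈ sheetSet Θ p j
  eventually : ∀ᶠ z' in 𝓝 z, sheetFun Θ p j (γ z') = t

variable {S : Type*} [TopologicalSpace S] [ChartedSpace ℂ S]
  {E : S → Set X} {s₀ : S} {r : ℝ} {T : Finset X} {V : X → Set (ℂ × ℂ)}
  {F : X → (ℂ × ℂ) × ℂ → ℂ} {Θ : X → ℕ → OpenPartialHomeomorph (ℂ × ℂ) (ℂ × ℂ)}
  {ℓ : X → ℕ → ℂ × ℂ →L[ℂ] ℂ} {B : X → Set (Set (ℂ × ℂ) × (ℂ × ℂ → ℂ))}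
  {t : ℂ} {L : PeriodPair} {γ : ℂ → X} {K : Set ℂ} {σ : TwoFormField X}

lemma IsSheetAt.eventually_isSheetAt {p : X} {j : ℕ} {z : ℂ} (hγ : Continuous γ)
    (h : IsSheetAt T Θ t γ p j z) : ∀ᶠ z' in 𝓝 z, IsSheetAt T Θ t γ p j z' := by
  filter_upwards [h.eventually.eventually_nhds, hγ.continuousAt.eventually
    ((isOpen_sheetSet Θ p j).eventually_mem h.mem_sheetSet)] with z' h1 h2
  exact ⟨h.mem, h2, h1⟩

lemma IsSheetAt.add {p : X} {j : ℕ} {z l : ℂ} (hl : ∀ z, γ (z + l) = γ z)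
    (h : IsSheetAt T Θ t γ p j z) : IsSheetAt T Θ t γ p j (z + l) := by
  refine ⟨h.mem, by rw [hl]; exact h.mem_sheetSet, ?_⟩
  rw [← map_add_right_nhds l z, eventually_map]
  simpa only [hl] using h.eventually

lemma sheetCoeff_add (σ : TwoFormField X) (p : X) (j : ℕ) {z l : ℂ} (hl : ∀ z, γ (z + l) = γ z) :
    sheetCoeff σ Θ γ p j (z + l) = sheetCoeff σ Θ γ p j z := by
  have : deriv (fun z ↦ coord p (γ z)) (z + l) = deriv (fun z ↦ coord p (γ z)) z := by
    rw [← deriv_comp_add_const]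
    simp only [hl]
  rw [sheetCoeff, sheetCoeff, hl, this]

variable [IsManifold 𝓘(ℂ, ComplexPlane) ω X]

/-- Both sides are the ratio of `σ (v, γ')` to the differential of the sheet function at `v`.
Coherence makes the two sheet functions, hence their differentials, agree. -/
lemma IsGenericMember.sheetCoeff_eq (hA : IsAdapted E s₀ r T V F Θ ℓ B)
    (hG : IsGenericMember E s₀ r T Θ B t L γ K) {p q : X} {j k : ℕ} {z : ℂ}
    (h : IsSheetAt T Θ t γ p j z) (h' : IsSheetAt T Θ t γ q k z) :
    sheetCoeff σ Θ γ p j z = sheetCoeff σ Θ γ q k z := by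
  obtain ⟨v, hv⟩ := exists_differential_ne_zero h.mem_sheetSet.1
    ((hA.isGraphChart p h.mem j).analytic _ h.mem_sheetSet.2)
    ((hA.isGraphChart p h.mem j).det_ne_zero _ h.mem_sheetSet.2)
  have h1 := val_apply_velocity σ hG.param.contMDiff h.mem_sheetSet.1
    ((hA.isGraphChart p h.mem j).analytic _ h.mem_sheetSet.2)
    ((hA.isGraphChart p h.mem j).det_ne_zero _ h.mem_sheetSet.2) h.eventually v
  have h2 := val_apply_velocity σ hG.param.contMDiff h'.mem_sheetSet.1
    ((hA.isGraphChart q h'.mem k).analytic _ h'.mem_sheetSet.2)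
    ((hA.isGraphChart q h'.mem k).det_ne_zero _ h'.mem_sheetSet.2) h'.eventually v
  have h3 : differential (sheetFun Θ p j) (γ z) = differential (sheetFun Θ q k) (γ z) :=
    (hG.coherent p h.mem q h'.mem j k z h.mem_sheetSet h'.mem_sheetSet h.eventually
      h'.eventually).mfderiv_eq
  have h4 : differential (fun x ↦ (Θ p j (coord p x)).1) (γ z) v =
    differential (fun x ↦ (Θ q k (coord q x)).1) (γ z) v := DFunLike.congr_fun h3 v
  rw [← h4] at h2
  exact mul_right_cancel₀ hv (h1.symm.trans h2)

lemma IsAdapted.differentiableAt_sheetCoeff (hA : IsAdapted E s₀ r T V F Θ ℓ B)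
    (hσ : σ.IsHolomorphic) (hγ : ContMDiff 𝓘(ℂ) 𝓘(ℂ, ComplexPlane) ω γ) {p : X} (hp : p ∈ T)
    {j : ℕ} {z : ℂ} (hz : γ z ∈ sheetSet Θ p j) :
    DifferentiableAt ℂ (sheetCoeff σ Θ γ p j) z := by
  have hn := analyticAt_coord_comp hγ hz.1
  have hT : AnalyticAt ℂ (fun z ↦ fderiv ℂ (Θ p j) (coord p (γ z))) z :=
    ((hA.isGraphChart p hp j).analytic _ hz.2).fderiv.comp_of_eq hn rfl
  have hTv : ∀ v : ℂ → ℂ × ℂ, AnalyticAt ℂ v z →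
      AnalyticAt ℂ (fun z ↦ fderiv ℂ (Θ p j) (coord p (γ z)) (v z)) z := fun v hv ↦
    (hT.contDiffAt.clm_apply hv.contDiffAt : ContDiffAt ℂ ω _ z).analyticAt
  have hfst : ∀ w : ℂ → ℂ × ℂ, AnalyticAt ℂ w z → AnalyticAt ℂ (fun z ↦ (w z).1) z := fun w hw ↦
    ((ContinuousLinearMap.fst ℂ ℂ ℂ).analyticAt _).comp hw
  have hsnd : ∀ w : ℂ → ℂ × ℂ, AnalyticAt ℂ w z → AnalyticAt ℂ (fun z ↦ (w z).2) z := fun w hw ↦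
    ((ContinuousLinearMap.snd ℂ ℂ ℂ).analyticAt _).comp hw
  have hdet : ∀ A : ℂ × ℂ →L[ℂ] ℂ × ℂ, LinearMap.det (A : ℂ × ℂ →ₗ[ℂ] ℂ × ℂ) =
      (A (1, 0)).1 * (A (0, 1)).2 - (A (1, 0)).2 * (A (0, 1)).1 := fun A ↦ by
    have := LinearMap.wedge_apply_eq_det_mul (A : ℂ × ℂ →ₗ[ℂ] ℂ × ℂ) (1, 0) (0, 1)
    simpa using this.symm
  have hd0 := (hA.isGraphChart p hp j).det_ne_zero _ hz.2
  simp only [hdet] at hd0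
  refine AnalyticAt.differentiableAt ?_
  show AnalyticAt ℂ (fun z ↦ _ / _) z
  simp only [hdet]
  refine AnalyticAt.div (AnalyticAt.mul ?_ (hsnd _ (hTv _ hn.deriv))) ?_ hd0
  · exact (hσ.analyticOnNhd_coeff p _ ((coord p).map_source hz.1)).comp_of_eq hn rfl
  · exact ((hfst _ (hTv _ analyticAt_const)).mul (hsnd _ (hTv _ analyticAt_const))).sub
      ((hsnd _ (hTv _ analyticAt_const)).mul (hfst _ (hTv _ analyticAt_const)))

lemma IsGenericMember.exists_coefficient (hA : IsAdapted E s₀ r T V F Θ ℓ B)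
    (hG : IsGenericMember E s₀ r T Θ B t L γ K) (hσ : σ.IsHolomorphic) :
    ∃ φ : ℂ → ℂ, ∀ p j z, IsSheetAt T Θ t γ p j z →
      φ z = sheetCoeff σ Θ γ p j z ∧ DifferentiableAt ℂ φ z := by
  classical
  set φ : ℂ → ℂ := fun z ↦ if h : ∃ i : X × ℕ, IsSheetAt T Θ t γ i.1 i.2 z then
    sheetCoeff σ Θ γ h.choose.1 h.choose.2 z else 0
  have hφ : ∀ p j z, IsSheetAt T Θ t γ p j z → φ z = sheetCoeff σ Θ γ p j z := by
    intro p j z h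
    have hex : ∃ i : X × ℕ, IsSheetAt T Θ t γ i.1 i.2 z := ⟨(p, j), h⟩
    simp only [φ, dif_pos hex]
    exact hG.sheetCoeff_eq hA hex.choose_spec h
  refine ⟨φ, fun p j z h ↦ ⟨hφ p j z h, ?_⟩⟩
  refine (hA.differentiableAt_sheetCoeff hσ hG.param.contMDiff h.mem
    h.mem_sheetSet).congr_of_eventuallyEq ?_
  filter_upwards [h.eventually_isSheetAt hG.param.contMDiff.continuous] with z' h'
  exact hφ p j z' h'

/-- Three countable sets are removed, each consisting of isolated points: base points, points where
a sheet function takes the value `t` but not along an arc, and zeros of the proper analytic subsets.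
-/
lemma IsGenericMember.exists_countable_isSheetAt (hE : IsEllipticCurveFamily E)
    [IsManifold 𝓘(ℂ) ω S]
    (hA : IsAdapted E s₀ r T V F Θ ℓ B) (hG : IsGenericMember E s₀ r T Θ B t L γ K) :
    ∃ N : Set ℂ, N.Countable ∧ ∀ z ∉ N, ∀ p ∈ T, γ z ∈ (coord p).source → coord p (γ z) ∈ V p →
      (∃ j, IsSheetAt T Θ t γ p j z) ∧
      ∀ j, coord p (γ z) ∈ (Θ p j).source → (Θ p j (coord p (γ z))).1 = t →
        IsSheetAt T Θ t γ p j z := by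
  have hγ := hG.param.contMDiff
  set N₁ : Set ℂ := {z | ∀ s, γ z ∈ E s}
  set N₂ : X → ℕ → Set ℂ := fun p j ↦ {z | γ z ∈ sheetSet Θ p j ∧ sheetFun Θ p j (γ z) = t ∧
    ¬ ∀ᶠ z' in 𝓝 z, sheetFun Θ p j (γ z') = t}
  set N₃ : X → Set (ℂ × ℂ) × (ℂ × ℂ → ℂ) → Set ℂ := fun p b ↦
    {z | γ z ∈ (coord p).source ∧ coord p (γ z) ∈ b.1 ∧ b.2 (coord p (γ z)) = 0}
  have hN₁ : N₁.Countable := countable_of_forall_isolated fun z _ ↦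
    (hE.eventually_exists_notMem hG.elliptic hG.param z).mono fun z' h h' ↦
      h.elim fun s hs ↦ hs (h' s)
  have hN₂ : ∀ p ∈ T, ∀ j, (N₂ p j).Countable := fun p hp j ↦
    countable_of_forall_isolated fun z hz ↦ by
      have h1 : AnalyticAt ℂ (fun z ↦ sheetFun Θ p j (γ z) - t) z :=
        ((hA.holAt_sheetFun hp hz.1).analyticAt_comp_curve hγ).sub analyticAt_const
      have h2 := h1.eventually_eq_zero_or_eventually_ne_zero.resolve_left
        (by simpa only [sub_eq_zero] using hz.2.2)
      exact h2.mono fun z' h h' ↦ h (sub_eq_zero.2 h'.2.1)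
  have hN₃ : ∀ p ∈ T, ∀ b ∈ B p, (N₃ p b).Countable := fun p hp b hb ↦
    countable_of_forall_isolated fun z hz ↦ by
      have h1 : AnalyticAt ℂ (fun z ↦ b.2 (coord p (γ z))) z :=
        ((hA.proper p hp b hb).2.2.1 _ hz.2.1).comp_of_eq (analyticAt_coord_comp hγ hz.1) rfl
      have h2 := h1.eventually_eq_zero_or_eventually_ne_zero.resolve_left
        (hG.proper p hp b hb z hz.1 hz.2.1)
      exact h2.mono fun z' h h' ↦ h h'.2.2
  refine ⟨N₁ ∪ (⋃ p ∈ T, ⋃ j, N₂ p j) ∪ ⋃ p ∈ T, ⋃ b ∈ B p, N₃ p b,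
    (hN₁.union ?_).union ?_, ?_⟩
  · exact T.countable_toSet.biUnion fun p hp ↦ countable_iUnion fun j ↦ hN₂ p hp j
  · exact T.countable_toSet.biUnion fun p hp ↦ (hA.countable p hp).biUnion fun b hb ↦ hN₃ p hp b hb
  · intro z hz p hp hzs hzV
    simp only [mem_union, mem_iUnion, not_or, not_exists] at hz
    obtain ⟨⟨hz1, hz2⟩, hz3⟩ := hz
    have hmain : ∀ j, coord p (γ z) ∈ (Θ p j).source → (Θ p j (coord p (γ z))).1 = t →
        IsSheetAt T Θ t γ p j z := fun j hj hjt ↦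
      ⟨hp, ⟨hzs, hj⟩, by_contra fun h ↦ hz2 p hp j ⟨⟨hzs, hj⟩, hjt, h⟩⟩
    refine ⟨?_, hmain⟩
    have hmem : γ z ∈ E ((chartAt ℂ s₀).symm t) := hG.param.range_eq ▸ mem_range_self z
    rw [← (coord p).left_inv hzs] at hmem
    rcases hA.cover p hp _ hzV t hG.mem_ball hmem with h | ⟨j, hj, hjt⟩ | ⟨b, hb, hb1, hb2⟩
    · rw [(coord p).left_inv hzs] at h
      exact absurd h hz1
    · exact ⟨j, hmain j hj hjt⟩
    · exact absurd ⟨hzs, hb1, hb2⟩ (hz3 p hp b hb)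

end Coefficient

/-! ### Contradiction at a base point -/

section NoBasePoint

open Metric Set Filter Topology MeasureTheory

lemma exists_lintegral_ball_lt_top_of_le_weight {f w : ℂ → ℝ} {W : ℂ → ENNReal} {z₀ : ℂ}
    (hW : ∃ m > 0, ∀ᶠ z in 𝓝[≠] z₀, ENNReal.ofReal (m * w z) ≤ W z)
    (h : ∃ δ > 0, ∫⁻ z in ball z₀ δ, ENNReal.ofReal (f z) * W z < ⊤) :
    ∃ δ > 0, ∫⁻ z in ball z₀ δ, ENNReal.ofReal (f z) * ENNReal.ofReal (w z) < ⊤ := by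
  obtain ⟨m, hm, hev⟩ := hW
  obtain ⟨δ, hδ, hfin⟩ := h
  rw [eventually_nhdsWithin_iff] at hev
  obtain ⟨ε, hε, hball⟩ := Metric.eventually_nhds_iff_ball.1 hev
  refine ⟨min ε δ, lt_min hε hδ, ?_⟩
  refine ENNReal.lt_top_of_mul_ne_top_right (a := ENNReal.ofReal m) ?_ (by simpa using hm)
  rw [← lintegral_const_mul' _ _ ENNReal.ofReal_ne_top]
  refine ((lintegral_mono_ae ?_).trans_lt ((lintegral_mono_set
    (ball_subset_ball (min_le_right ε δ))).trans_lt hfin)).ne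
  filter_upwards [ae_restrict_mem measurableSet_ball,
    ae_restrict_of_ae ((countable_singleton z₀).ae_notMem volume)] with z hz hz0
  have h1 := hball z (ball_subset_ball (min_le_left ε δ) hz) hz0
  rw [ENNReal.ofReal_mul hm.le] at h1
  rw [mul_left_comm]
  gcongr

variable {X : Type} [TopologicalSpace X] [ChartedSpace ComplexPlane X]
  {S : Type*} [TopologicalSpace S] [ChartedSpace ℂ S] {E : S → Set X}

/-- Without an elliptic member the cofinite filter would be trivial, and the family would count as
constant, equal to `∅`. -/
lemma IsEllipticCurveFamily.exists_isEllipticCurveIn (hE : IsEllipticCurveFamily E) :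
    ∃ s, IsEllipticCurveIn (E s) := by
  by_contra hne
  exact hE.not_constant ⟨∅, hE.general_elliptic.mono fun s hs ↦ absurd ⟨s, hs⟩ hne⟩

variable [IsManifold 𝓘(ℂ, ComplexPlane) ω X]
  {s₀ : S} {r : ℝ} {T : Finset X} {V : X → Set (ℂ × ℂ)}
  {F : X → (ℂ × ℂ) × ℂ → ℂ} {Θ : X → ℕ → OpenPartialHomeomorph (ℂ × ℂ) (ℂ × ℂ)}
  {ℓ : X → ℕ → ℂ × ℂ →L[ℂ] ℂ} {B : X → Set (Set (ℂ × ℂ) × (ℂ × ℂ → ℂ))}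
  {t : ℂ} {L : PeriodPair} {γ : ℂ → X} {K : Set ℂ} {σ : TwoFormField X}

/-- The slice integral applies with constant `M²`: by construction `φ` times the Jacobian
determinant is the bounded coefficient of `σ` times `ℓ (n')`. -/
lemma IsGenericMember.exists_lintegral_ball_lt_top (hP : IsPatching E s₀ r T V F)
    (hA : IsAdapted E s₀ r T V F Θ ℓ B) (hG : IsGenericMember E s₀ r T Θ B t L γ K)
    {φ : ℂ → ℂ} (hφ : ∀ p j z, IsSheetAt T Θ t γ p j z → φ z = sheetCoeff σ Θ γ p j z)
    {N : Set ℂ} (hNc : N.Countable)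
    (hN : ∀ z ∉ N, ∀ p ∈ T, γ z ∈ (coord p).source → coord p (γ z) ∈ V p →
      (∃ j, IsSheetAt T Θ t γ p j z) ∧
      ∀ j, coord p (γ z) ∈ (Θ p j).source → (Θ p j (coord p (γ z))).1 = t →
        IsSheetAt T Θ t γ p j z)
    {p : X} (hp : p ∈ T) {M : ℝ} (hM : ∀ y ∈ V p, ‖σ.coeff p y‖ ≤ M) {W : ℂ × ℂ → ENNReal}
    (hW : ∑' j, ∫⁻ u, sheetDensity (Θ p) W j (t, u) < ⊤) {z₀ : ℂ}
    (hz₀ : γ z₀ ∈ (coord p).source) (hz₀V : coord p (γ z₀) ∈ V p) :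
    ∃ δ > 0, ∫⁻ z in ball z₀ δ, ENNReal.ofReal (‖φ z‖ ^ 2) * W (coord p (γ z)) < ⊤ := by
  have hγ := hG.param.contMDiff
  obtain ⟨δ₁, hδ₁, hinj⟩ := hG.param.exists_injOn_ball z₀
  have hopen : ∀ᶠ z in 𝓝 z₀, γ z ∈ (coord p).source ∩ coord p ⁻¹' V p :=
    hγ.continuous.continuousAt.eventually
      (((coord p).isOpen_inter_preimage (hP.isOpen p)).eventually_mem ⟨hz₀, hz₀V⟩)
  obtain ⟨δ₂, hδ₂, hball⟩ := Metric.eventually_nhds_iff_ball.1 hopen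
  have hsub₁ : ball z₀ (min δ₁ δ₂) ⊆ ball z₀ δ₁ := ball_subset_ball (min_le_left _ _)
  have hsub₂ : ball z₀ (min δ₁ δ₂) ⊆ ball z₀ δ₂ := ball_subset_ball (min_le_right _ _)
  refine ⟨min δ₁ δ₂, lt_min hδ₁ hδ₂, lintegral_slice_lt_top (n := fun z ↦ coord p (γ z))
    (K := K ∪ N) (M := M ^ 2)
    (fun j ↦ (hA.isGraphChart p hp j).snd_eq) (fun j ↦ (hA.isGraphChart p hp j).det_ne_zero) hW
    isOpen_ball (fun z hz ↦ ?_) (hG.param.countable.union hNc) ?_ (sq_nonneg M) ?_ ?_⟩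
  · exact (analyticAt_coord_comp hγ (hball z (hsub₂ hz)).1).differentiableAt.differentiableWithinAt
  · intro z hz w hw hzw
    exact hinj ⟨hsub₁ hz.1, fun h ↦ hz.2 (Or.inl h)⟩ ⟨hsub₁ hw.1, fun h ↦ hw.2 (Or.inl h)⟩
      ((coord p).injOn (hball z (hsub₂ hz.1)).1 (hball w (hsub₂ hw.1)).1 hzw)
  · intro z hz
    obtain ⟨hs, hV⟩ := hball z (hsub₂ hz.1)
    have hzN : z ∉ N := fun h ↦ hz.2 (Or.inr h)
    obtain ⟨j, hj⟩ := (hN z hzN p hp hs hV).1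
    exact ⟨j, hj.mem_sheetSet.2, hj.eventually.self_of_nhds⟩
  · intro z hz j hj hjt
    obtain ⟨hs, hV⟩ := hball z (hsub₂ hz.1)
    have hzN : z ∉ N := fun h ↦ hz.2 (Or.inr h)
    have hc := hA.isGraphChart p hp j
    have hsnd : (fderiv ℂ (Θ p j) (coord p (γ z)) (deriv (fun z ↦ coord p (γ z)) z)).2 =
        ℓ p j (deriv (fun z ↦ coord p (γ z)) z) := by
      have h1 : HasFDerivAt (fun y ↦ (Θ p j y).2) ((ContinuousLinearMap.snd ℂ ℂ ℂ).comp
        (fderiv ℂ (Θ p j) (coord p (γ z)))) (coord p (γ z)) :=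
        (ContinuousLinearMap.snd ℂ ℂ ℂ).hasFDerivAt.comp _
          (hc.analytic _ hj).differentiableAt.hasFDerivAt
      have h2 : (fun y ↦ (Θ p j y).2) =ᶠ[𝓝 (coord p (γ z))] ℓ p j := by
        filter_upwards [(Θ p j).open_source.mem_nhds hj] with y hy using hc.snd_eq y hy
      exact DFunLike.congr_fun (h1.unique ((ℓ p j).hasFDerivAt.congr_of_eventuallyEq h2)) _
    have hd := norm_pos_iff.2 (hc.det_ne_zero _ hj)
    rw [hφ p j z ((hN z hzN p hp hs hV).2 j hj hjt), sheetCoeff, hsnd, norm_div, norm_mul,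
      ← mul_pow, div_mul_cancel₀ _ hd.ne', mul_pow]
    gcongr
    exact hM _ hV

/-- Vanishing would kill the second component of the velocity in the chart; the first vanishes on a
level set. So `γ` would be locally constant, although its fibres are countable. -/
lemma IsGenericMember.not_eventually_coefficient_eq_zero (hA : IsAdapted E s₀ r T V F Θ ℓ B)
    (hG : IsGenericMember E s₀ r T Θ B t L γ K) (hσ : ∀ x, σ x ≠ 0) {p : X} {j : ℕ} {z : ℂ}
    (h : IsSheetAt T Θ t γ p j z) : ¬ ∀ᶠ z' in 𝓝 z, sheetCoeff σ Θ γ p j z' = 0 := by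
  intro h0
  have hγ := hG.param.contMDiff
  have hd : ∀ᶠ z' in 𝓝 z, DifferentiableAt ℂ (fun z ↦ coord p (γ z)) z' ∧
      deriv (fun z ↦ coord p (γ z)) z' = 0 ∧ γ z' ∈ (coord p).source := by
    filter_upwards [h0, h.eventually_isSheetAt hγ.continuous] with z' h1 h2
    have hc := hA.isGraphChart p h2.mem j
    refine ⟨(analyticAt_coord_comp hγ h2.mem_sheetSet.1).differentiableAt, ?_, h2.mem_sheetSet.1⟩
    have hdet := hc.det_ne_zero _ h2.mem_sheetSet.2
    rw [sheetCoeff, div_eq_zero_iff, or_iff_left hdet, mul_eq_zero,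
      or_iff_right (coeff_ne_zero h2.mem_sheetSet.1 (hσ _))] at h1
    have h3 := fst_fderiv_deriv_eq_zero hγ h2.mem_sheetSet.1 (hc.analytic _ h2.mem_sheetSet.2)
      h2.eventually
    exact (LinearMap.equivOfDetNeZero _ hdet).map_eq_zero_iff.1 (Prod.ext h3 h1)
  obtain ⟨ε, hε, hball⟩ := Metric.eventually_nhds_iff_ball.1 hd
  refine hG.param.not_eventually_eq z (γ z) ?_
  filter_upwards [ball_mem_nhds z hε] with z' hz'
  refine (coord p).injOn (hball z' hz').2.2 (hball z (mem_ball_self hε)).2.2 ?_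
  exact isOpen_ball.is_const_of_deriv_eq_zero (convex_ball z ε).isPreconnected
    (fun w hw ↦ (hball w hw).1.differentiableWithinAt) (fun w hw ↦ (hball w hw).2.1) hz'
    (mem_ball_self hε)

lemma IsEllipticCurveFamily.exists_notMem [IsManifold 𝓘(ℂ) ω S] [CompactSpace X] [CompactSpace S]
    [PreconnectedSpace S] (hE : IsEllipticCurveFamily E) (hσ : σ.IsHolomorphic)
    (hσ₀ : ∀ x, σ x ≠ 0) (x : X) : ∃ s, x ∉ E s := by
  by_contra! hx
  obtain ⟨s₀, hs₀⟩ := hE.exists_isEllipticCurveIn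
  obtain ⟨r, T, V, F, M, hP, hM⟩ := hE.exists_isPatching s₀ (κ := σ.coeff)
    fun p ↦ (hσ.analyticOnNhd_coeff p).continuousOn
  obtain ⟨Θ, ℓ, B, hA⟩ := hP.exists_isAdapted hE
  set e := chartAt ℂ s₀
  have hes₀ : e s₀ ∈ ball (e s₀) (4 * r) := mem_ball_self (by linarith [hP.pos])
  -- If `x` is outside the domain of `coord p`, the centre `coord p x` is a junk value. This is
  -- harmless: the singularity of the weight is used only where `γ z₀ = x` lies in that domain.
  have hW : ∀ p, ∃ W : ℂ × ℂ → ENNReal, p ∈ T →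
      (∀ y ∈ V p, F p (y, e s₀) ≠ 0 →
        W y = ENNReal.ofReal (logWeight ‖F p (y, e s₀)‖ * (‖y - coord p x‖ ^ 2)⁻¹)) ∧
      ∀ᵐ t : ℂ, ∑' j, ∫⁻ u, sheetDensity (Θ p) W j (t, u) < ⊤ := by
    intro p
    by_cases hp : p ∈ T
    · obtain ⟨W, hW⟩ := exists_weight hP.pos (hP.isOpen p) (hP.isBounded p) (hP.analytic p hp)
        (hP.norm_le p hp) (hA.isGraphChart p hp) (coord p x)
      exact ⟨W, fun _ ↦ hW⟩
    · exact ⟨0, fun h ↦ absurd h hp⟩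
  choose W hW using hW
  obtain ⟨t, L, γ, K, htW, hG⟩ := hA.exists_isGenericMember hE hs₀ hP
    ((ae_ball_iff T.countable_toSet).2 fun p hp ↦ (hW p hp).2)
  have hγ := hG.param.contMDiff
  obtain ⟨φ, hφ⟩ := hG.exists_coefficient hA hσ
  obtain ⟨N, hNc, hN⟩ := hG.exists_countable_isSheetAt hE hA
  set R : Set ℂ := {z | ∃ p j, IsSheetAt T Θ t γ p j z} with hR
  have hRo : IsOpen R := isOpen_iff_mem_nhds.2 fun z ⟨p, j, h⟩ ↦
    (h.eventually_isSheetAt hγ.continuous).mono fun z' h' ↦ ⟨p, j, h'⟩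
  have hNR : ∀ z ∉ N, z ∈ R := fun z hz ↦ by
    obtain ⟨p, hp, hs, hV⟩ := hP.cover (γ z)
    obtain ⟨j, hj⟩ := (hN z hz p hp hs hV).1
    exact ⟨p, j, hj⟩
  have hRc : Rᶜ.Countable := hNc.mono fun z hz ↦ by_contra fun h ↦ hz (hNR z h)
  have hlocal : ∀ z₀, (∃ δ > 0, ∫⁻ z in ball z₀ δ,
        ENNReal.ofReal (‖φ z‖ ^ 2) * ENNReal.ofReal (logWeight ‖z - z₀‖) < ⊤) ∧
      (γ z₀ = x → ∃ δ > 0, ∫⁻ z in ball z₀ δ, ENNReal.ofReal (‖φ z‖ ^ 2) *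
        ENNReal.ofReal ((‖z - z₀‖ ^ 2)⁻¹ * logWeight ‖z - z₀‖) < ⊤) := by
    intro z₀
    obtain ⟨p, hp, hs, hV⟩ := hP.cover (γ z₀)
    have hsV : ∀ᶠ z in 𝓝 z₀, γ z ∈ (coord p).source ∩ coord p ⁻¹' V p :=
      hγ.continuous.continuousAt.eventually
        (((coord p).isOpen_inter_preimage (hP.isOpen p)).eventually_mem ⟨hs, hV⟩)
    have hfin := hG.exists_lintegral_ball_lt_top hP hA (fun p j z h ↦ (hφ p j z h).1) hNc hN hp
      (hM p) (htW p hp) hs hV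
    -- Otherwise an arc of the member, hence the whole member, would lie in `E s₀`.
    have hF0 : ¬ ∀ᶠ z in 𝓝 z₀, F p (coord p (γ z), e s₀) = 0 := fun h ↦ by
      refine hG.not_subset (hE.range_subset_of_frequently s₀ hγ (z₀ := z₀)
        (Eventually.frequently (nhdsWithin_le_nhds ?_)))
      filter_upwards [h, hsV] with z hz hzsV
      have := (hP.zero_iff p hp _ hzsV.2 _ hes₀).1 hz
      rwa [(coord p).left_inv hzsV.1, e.left_inv (mem_chart_source ℂ s₀)] at this
    have hnc : ¬ ∀ᶠ z in 𝓝 z₀, coord p (γ z) = coord p x := fun h ↦ by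
      refine hG.param.not_eventually_eq z₀ ((coord p).symm (coord p x)) ?_
      filter_upwards [h, hsV] with z hz hzsV
      rw [← hz, (coord p).left_inv hzsV.1]
    obtain ⟨h1, h2⟩ := exists_le_weight (hP.isOpen p) (hP.isBounded p)
      (fun y hy ↦ hP.analytic p hp _ ⟨hy, hes₀⟩) (fun y hy ↦ hP.norm_le p hp y hy _ hes₀)
      (hW p hp).1 (analyticAt_coord_comp hγ hs) hV hF0 hnc
    exact ⟨exists_lintegral_ball_lt_top_of_le_weight h1 hfin, fun hz₀ ↦
      exists_lintegral_ball_lt_top_of_le_weight (h2 (by rw [hz₀])) hfin⟩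
  obtain ⟨g, hg, hgφ⟩ := exists_entire_extension hRo.isClosed_compl hRc (f := φ)
    (by
      rw [compl_compl]
      exact fun z ⟨p, j, h⟩ ↦ (hφ p j z h).2.differentiableWithinAt) fun z₀ ↦ (hlocal z₀).1
  have hgφ' : ∀ z ∈ R, g z = φ z := fun z hz ↦ hgφ z (by simpa using hz)
  have hdense : Dense R := by simpa using hRc.dense_compl ℝ
  obtain ⟨c, hc⟩ := hg.exists_eq_const_of_lattice_periodic (L := L) fun z l hl ↦ by
    refine congrFun (Continuous.ext_on hdense (f := fun z ↦ g (z + l)) (g := g)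
      (hg.continuous.comp (continuous_add_const l)) hg.continuous ?_) z
    rintro z ⟨p, j, h⟩
    have hl' := fun z ↦ hG.param.periodic z l hl
    show g (z + l) = g z
    rw [hgφ' z ⟨p, j, h⟩, hgφ' (z + l) ⟨p, j, h.add hl'⟩, (hφ p j z h).1,
      (hφ p j _ (h.add hl')).1, sheetCoeff_add σ p j hl']
  obtain ⟨z₀, hz₀⟩ : x ∈ range γ := hG.param.range_eq ▸ hx _
  obtain ⟨δ, hδ, hfin⟩ := (hlocal z₀).2 hz₀
  -- A nonzero constant would make `‖z - z₀‖⁻² logWeight ‖z - z₀‖` integrable near the preimage `z₀`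
  -- of the base point.
  have hc0 : c = 0 := by
    by_contra hc0
    have h1 : ∫⁻ z in ball z₀ δ, ENNReal.ofReal (‖φ z‖ ^ 2) *
        ENNReal.ofReal ((‖z - z₀‖ ^ 2)⁻¹ * logWeight ‖z - z₀‖) =
        ∫⁻ z in ball z₀ δ, ENNReal.ofReal (‖c‖ ^ 2) *
          ENNReal.ofReal ((‖z - z₀‖ ^ 2)⁻¹ * logWeight ‖z - z₀‖) := by
      refine lintegral_congr_ae (ae_restrict_of_ae ?_)
      filter_upwards [hRc.ae_notMem volume] with z hz
      rw [← hgφ z hz, hc z]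
    rw [h1, lintegral_const_mul' _ _ ENNReal.ofReal_ne_top,
      lintegral_ball_inv_sq_mul_logWeight z₀ hδ, ENNReal.mul_top (by simpa using hc0)] at hfin
    exact lt_irrefl _ hfin
  obtain ⟨z, p, j, h⟩ := hdense.nonempty
  refine hG.not_eventually_coefficient_eq_zero hA hσ₀ h ?_
  filter_upwards [h.eventually_isSheetAt hγ.continuous] with z' h'
  rw [← (hφ p j z' h').1, ← hgφ' z' ⟨p, j, h'⟩, hc, hc0]

end NoBasePoint

theorem mainTheorem11
    {X : Type} [TopologicalSpace X] [ChartedSpace ComplexPlane X] (hX : IsK3Surface X)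
    {S : Type*} [TopologicalSpace S] [ChartedSpace ℂ S] [IsManifold 𝓘(ℂ) ω S]
    [T2Space S] [CompactSpace S] [ConnectedSpace S]
    (E : S → Set X) (hE : IsEllipticCurveFamily E) :
    (¬ ∃ x : X, ∀ s : S, x ∈ E s) ∧ ∀ x : X, {s : S | x ∈ E s}.Finite := by
  have := hX.isManifold
  have := hX.compactSpace
  obtain ⟨σ, hσ, hσ₀⟩ := hX.canonical_trivial
  have hmain := hE.exists_notMem hσ hσ₀
  exact ⟨fun ⟨x, hx⟩ ↦ (hmain x).elim fun s hs ↦ hs (hx s), fun x ↦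
    (hE.finite_or_forall_mem x).resolve_right fun h ↦ (hmain x).elim fun s hs ↦ hs (h s)⟩
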